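/- An Emerson-Lei automaton $M=(\Sigma,Q,\delta,q_0,\gamma,\varphi)$ consists of an alphabet $\Sigma$, a set $Q$ of states, a transition relation $\delta\subseteq Q\times\Sigma\times Q$, an initial state $q_0$, a map $\gamma$ that assigns a set $\gamma(t)\subseteq C$ of colors to every transition $t\in\delta$, and a positive Boolean formula $\varphi$ over atoms $\mathsf{Inf}\,c$ and $\mathsf{Fin}\,c$ with $c\in C$ ("color $c$ occurs infinitely often", respectively "only finitely often"). A run on a word $a_0a_1\ldots\in\Sigma^\omega$ is a sequence $q_0q_1\ldots$ of states starting in the initial state, with $(q_i,a_i,q_{i+1})\in\delta$ for all $i$; it is accepting if the sequence of color sets $\gamma(q_i,a_i,q_{i+1})$ satisfies $\varphi$. $M$ is non-empty if there is an accepting run on some word. For $d,k\in\mathbb{N}$, the condition Rabin($d$)$\,\wedge\,$Streett($k$) is the formula $$\Big(\bigvee_{i=1}^{d}\mathsf{Inf}\,F_i\wedge\mathsf{Fin}\,E_i\Big)\;\wedge\;\Big(\bigwedge_{j=1}^{k}\mathsf{Fin}\,R_j\vee\mathsf{Inf}\,G_j\Big)$$ over the colors $E_i,F_i$ ($1\le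 i\le d$) and $R_j,G_j$ ($1\le j\le k$). Consider the problem of deciding, given a finite Emerson-Lei automaton $M$ with acceptance condition Rabin($d$)$\,\wedge\,$Streett($k$) (where $d$ and $k$ are part of the input), whether $M$ is non-empty. The automaton is given by its parameters, its initial state and the list of its transitions, in any order, each with the membership bits of its color set. This problem is in the class P. More precisely, there are a single program for a random access machine (with addition, truncated subtraction, indirect addressing and zero test, each at unit cost) and a constant $c$ such that the program decides the problem within $$c\cdot m\cdot d\cdot k^2$$ steps for all automata with $m$ edges; here each of the parameters $m,d,k$ is to be read as $1$ if it is $0$. -/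

import Mathlib

/-! ### Emerson-Lei formulas and automata -/

/-- Positive Boolean formulas over the atoms `Inf c` and `Fin c`, for colors `c` in `C`. -/
inductive ELFormula (C : Type) : Type
  | tt : ELFormula C
  | ff : ELFormula C
  | infOften : C → ELFormula C
  | finOften : C → ELFormula C
  | and : ELFormula C → ELFormula C → ELFormula C
  | or : ELFormula C → ELFormula C → ELFormula C

namespace ELFormula

variable {C : Type}

/-- Satisfaction of a formula by an infinite sequence of sets of colors. -/
def Sat (g : ℕ → Set C) : ELFormula C → Prop
  | tt => True
  | ff => False
  | infOften c => {i : ℕ | c ∈ g i}.Infinite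
  | finOften c => {i : ℕ | c ∈ g i}.Finite
  | and φ ψ => Sat g φ ∧ Sat g ψ
  | or φ ψ => Sat g φ ∨ Sat g ψ

/-- Conjunction of a finite list of formulas (true for the empty list). -/
def conj (l : List (ELFormula C)) : ELFormula C := l.foldr and tt

/-- Disjunction of a finite list of formulas (false for the empty list). -/
def disj (l : List (ELFormula C)) : ELFormula C := l.foldr or ff

/-- The Rabin condition with the `d` pairs `(E i, F i)`:
for some `i`, the color `F i` occurs infinitely often and `E i` only finitely often. -/
def rabin {d : ℕ} (E F : Fin d → C) : ELFormula C :=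
  disj ((List.finRange d).map fun i => and (infOften (F i)) (finOften (E i)))

/-- The Streett condition with the `k` pairs `(R i, G i)`:
for all `i`, if `R i` occurs infinitely often, then so does `G i`. -/
def streett {k : ℕ} (R G : Fin k → C) : ELFormula C :=
  conj ((List.finRange k).map fun i => or (finOften (R i)) (infOften (G i)))

end ELFormula

/-- Emerson-Lei automata with alphabet `A`, set of states `Q` and set of colors `C`. The coloring
is a function on all triples, but only its values on transitions are ever used. -/
structure ELAutomaton (A Q C : Type) where
  /-- the transition relation -/
  trans : Set (Q × A × Q)
  /-- the initial state -/
  start : Q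
  /-- the set of colors of each transition -/
  color : Q × A × Q → Set C
  /-- the acceptance formula -/
  acc : ELFormula C

namespace ELAutomaton

variable {A Q C : Type}

/-- `r` is a run of `M` on the infinite word `w`. -/
def IsRun (M : ELAutomaton A Q C) (w : ℕ → A) (r : ℕ → Q) : Prop :=
  r 0 = M.start ∧ ∀ i, (r i, w i, r (i + 1)) ∈ M.trans

/-- The language of `M`: the infinite words on which `M` has an accepting run. -/
def language (M : ELAutomaton A Q C) : Set (ℕ → A) :=
  {w | ∃ r : ℕ → Q, M.IsRun w r ∧ M.acc.Sat fun i => M.color (r i, w i, r (i + 1))}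

end ELAutomaton

/-- The colors of a Rabin(`d`) condition together with a Streett(`k`) condition. -/
inductive RSColor (d k : ℕ) : Type
  | rabinE : Fin d → RSColor d k
  | rabinF : Fin d → RSColor d k
  | streettR : Fin k → RSColor d k
  | streettG : Fin k → RSColor d k

/-- The acceptance condition Rabin(`d`) ∧ Streett(`k`). -/
def rabinStreett (d k : ℕ) : ELFormula (RSColor d k) :=
  ELFormula.and (ELFormula.rabin RSColor.rabinE RSColor.rabinF)
    (ELFormula.streett RSColor.streettR RSColor.streettG)

/-- A finite Emerson-Lei automaton whose acceptance condition is
Rabin(`rabinPairs`) ∧ Streett(`streettPairs`). -/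
structure RSAutomaton where
  numStates : ℕ
  numLetters : ℕ
  rabinPairs : ℕ
  streettPairs : ℕ
  aut : ELAutomaton (Fin numLetters) (Fin numStates) (RSColor rabinPairs streettPairs)
  acc_eq : aut.acc = rabinStreett rabinPairs streettPairs

namespace RSAutomaton

/-- The number of edges. -/
noncomputable def numEdges (M : RSAutomaton) : ℕ := M.aut.trans.ncard

/-- `M` is non-empty. -/
def IsNonempty (M : RSAutomaton) : Prop := M.aut.language ≠ ∅

open Classical in
/-- `1` if the transition `t` carries the color `c`, and `0` otherwise. -/
noncomputable def colorBit (M : RSAutomaton) (t : Fin M.numStates × Fin M.numLetters × Fin M.numStates)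
    (c : RSColor M.rabinPairs M.streettPairs) : ℕ :=
  if c ∈ M.aut.color t then 1 else 0

/-- A transition as a block of numbers: source, letter and target, followed by the membership bits
of its color set. -/
noncomputable def encodeEdge (M : RSAutomaton)
    (t : Fin M.numStates × Fin M.numLetters × Fin M.numStates) : List ℕ :=
  [(t.1 : ℕ), (t.2.1 : ℕ), (t.2.2 : ℕ)]
    ++ (List.finRange M.rabinPairs).map (fun i => M.colorBit t (RSColor.rabinE i))
    ++ (List.finRange M.rabinPairs).map (fun i => M.colorBit t (RSColor.rabinF i))
    ++ (List.finRange M.streettPairs).map (fun i => M.colorBit t (RSColor.streettR i))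
    ++ (List.finRange M.streettPairs).map (fun i => M.colorBit t (RSColor.streettG i))

/-- `x` is an encoding of `M`: the parameters and the initial state, followed by the list of all
transitions, each exactly once, in an arbitrary order. -/
def Encodes (M : RSAutomaton) (x : List ℕ) : Prop :=
  ∃ l : List (Fin M.numStates × Fin M.numLetters × Fin M.numStates),
    l.Nodup ∧ (∀ t, t ∈ l ↔ t ∈ M.aut.trans) ∧
    x = [M.numStates, M.numLetters, l.length, M.rabinPairs, M.streettPairs, (M.aut.start : ℕ)]
      ++ l.flatMap M.encodeEdge

end RSAutomaton

/-! ### Random access machines -/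

/-- Instructions of a random access machine, with registers `R 0, R 1, …` (a program mentions only
finitely many of them) and memory cells `M 0, M 1, …`, all of which hold natural numbers. -/
inductive RAMInstr : Type
  /-- `R i := c` -/
  | const (i c : ℕ)
  /-- `R i := R j + R l` -/
  | add (i j l : ℕ)
  /-- `R i := R j - R l`, or `0` if this is negative -/
  | sub (i j l : ℕ)
  /-- `R i := M (R j)` -/
  | load (i j : ℕ)
  /-- `M (R i) := R j` -/
  | store (i j : ℕ)
  /-- jump to instruction number `p` if `R i = 0` -/
  | jumpZero (i p : ℕ)

/-- Configurations: program counter, registers, memory. -/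
structure RAMConfig where
  pc : ℕ
  reg : ℕ → ℕ
  mem : ℕ → ℕ

namespace RAMInstr

/-- The effect of executing one instruction. -/
def exec : RAMInstr → RAMConfig → RAMConfig
  | const i c, s => ⟨s.pc + 1, Function.update s.reg i c, s.mem⟩
  | add i j l, s => ⟨s.pc + 1, Function.update s.reg i (s.reg j + s.reg l), s.mem⟩
  | sub i j l, s => ⟨s.pc + 1, Function.update s.reg i (s.reg j - s.reg l), s.mem⟩
  | load i j, s => ⟨s.pc + 1, Function.update s.reg i (s.mem (s.reg j)), s.mem⟩
  | store i j, s => ⟨s.pc + 1, s.reg, Function.update s.mem (s.reg i) (s.reg j)⟩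
  | jumpZero i p, s => ⟨if s.reg i = 0 then p else s.pc + 1, s.reg, s.mem⟩

/-- The logarithmic cost of executing one instruction: one plus the bit lengths of the numbers
and memory addresses that it handles. -/
def logCost : RAMInstr → RAMConfig → ℕ
  | const _ c, _ => 1 + c.size
  | add _ j l, s => 1 + (s.reg j).size + (s.reg l).size
  | sub _ j l, s => 1 + (s.reg j).size + (s.reg l).size
  | load _ j, s => 1 + (s.reg j).size + (s.mem (s.reg j)).size
  | store i j, s => 1 + (s.reg i).size + (s.reg j).size
  | jumpZero i _, s => 1 + (s.reg i).size

end RAMInstr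

/-- A program is a finite list of instructions. -/
abbrev RAMProgram : Type := List RAMInstr

namespace RAMProgram

/-- The machine has halted when the program counter has left the program. -/
def Halted (P : RAMProgram) (s : RAMConfig) : Prop := P.length ≤ s.pc

/-- One step of the machine; a halted machine stays where it is. -/
def step (P : RAMProgram) (s : RAMConfig) : RAMConfig :=
  match P[s.pc]? with
  | some ins => ins.exec s
  | none => s

/-- The logarithmic cost of the next step; it is zero if the machine has halted. -/
def stepLogCost (P : RAMProgram) (s : RAMConfig) : ℕ :=
  match P[s.pc]? with
  | some ins => ins.logCost s
  | none => 0

/-- Initially the memory holds the input `x`, followed by zeros, `R 0` holds the length of `x`,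
and the other registers hold zero. -/
def initial (x : List ℕ) : RAMConfig :=
  ⟨0, fun i => if i = 0 then x.length else 0, fun i => x.getD i 0⟩

/-- The configuration after `t` steps on input `x`. -/
def run (P : RAMProgram) (x : List ℕ) (t : ℕ) : RAMConfig := P.step^[t] (initial x)

/-- On input `x`, the program halts after at most `T` steps (each step costs one unit of time), with
`R 0 = 1` if `b` holds and with `R 0 = 0` otherwise. -/
def DecidesInTime (P : RAMProgram) (x : List ℕ) (b : Prop) (T : ℕ) : Prop :=
  ∃ t ≤ T, P.Halted (P.run x t) ∧
    (b → (P.run x t).reg 0 = 1) ∧ (¬ b → (P.run x t).reg 0 = 0)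

/-- On input `x`, the program halts after a computation of logarithmic cost at most `T`, with
`R 0 = 1` if `b` holds and with `R 0 = 0` otherwise. -/
def DecidesInLogCost (P : RAMProgram) (x : List ℕ) (b : Prop) (T : ℕ) : Prop :=
  ∃ t, (∑ i ∈ Finset.range t, P.stepLogCost (P.run x i)) ≤ T ∧ P.Halted (P.run x t) ∧
    (b → (P.run x t).reg 0 = 1) ∧ (¬ b → (P.run x t).reg 0 = 0)

end RAMProgram

/-- The bit length of a list of natural numbers, written in binary, with a separator after each. -/
def bitLength (x : List ℕ) : ℕ := (x.map fun a => a.size + 1).sum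

/-- The decision problem `prob`, whose instances are given by their encodings, is in the class P:
it is decided by a random access machine whose logarithmic cost is polynomial in the bit length
of the encoding. Random access machines with logarithmic cost and Turing machines simulate each
other with polynomial overhead, so that this is the usual class. -/
def InP {I : Type} (Encodes : I → List ℕ → Prop) (prob : I → Prop) : Prop :=
  ∃ (P : RAMProgram) (p : Polynomial ℕ), ∀ (a : I) (x : List ℕ), Encodes a x →
    P.DecidesInLogCost x (prob a) (p.eval (bitLength x))

/-! ### A structured language over random access machines -/

/-! An infinite path ends up among the edges that it takes infinitely often, and these form a
strongly connected set. Conversely, every reachable strongly connected set of edges is the limit of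
some path. Hence non-emptiness means: for some Rabin pair `i` there is a strongly connected set of
reachable edges that avoids `E i`, meets `F i`, and meets `G j` whenever it meets `R j`
(`exists_path_iff`, `RSAutomaton.isNonempty_iff`).

For fixed `i` such a good set is found by refinement, starting from the reachable edges without `E
i`. A round computes strongly connected components, deletes the edges between components and the
components without an `F i` edge, and then, for each `j`, deletes the `R j` edges of every component
in which no `G j` edge is left. A good set lies in one component and survives. Suppose conversely
that an edge `e` survives `k + 1` rounds although no good set exists. In every round the component
of `e` violates some Streett pair, so two rounds violate the same pair `j`; but the earlier one
removed all `R j` edges from a component that contains the later one (`nonempty_iff_of_refines`).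

Components are computed by Kosaraju's algorithm (`DfsInv`, `DfsResult.scc`) in time linear in the
number `m` of edges, and each Streett pair costs another linear pass. With `k + 1` rounds for each
of `d` Rabin pairs this gives the order `m * d * k ^ 2`. The number of states must not enter, so
only ends of edges are ever reset; the invariant `Clean` says that all other vertices have no list
and no label.

The algorithm is written in a small while language whose costs bound the steps of the compiled
machine program (`Cmd.compile_correct`). For membership in P, each step lengthens the numbers by at
most one bit, so the logarithmic cost is polynomial in the number of steps and the input length. If
there is an edge, then `m`, `d` and `k` are at most the length of the input; if there is none, the
program answers at once. -/

namespace WhileLang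

/-- States of structured programs: numeric variables and sixteen infinite arrays. -/
structure State where
  v : ℕ → ℕ
  a : Fin 16 → ℕ → ℕ

namespace State

/-- Assignment to a variable. -/
def setv (s : State) (x n : ℕ) : State := ⟨Function.update s.v x n, s.a⟩

/-- Assignment to an array cell. -/
def seta (s : State) (b : Fin 16) (i n : ℕ) : State :=
  ⟨s.v, Function.update s.a b (Function.update (s.a b) i n)⟩

@[simp] theorem setv_v (s : State) (x n y : ℕ) :
    (s.setv x n).v y = if y = x then n else s.v y := by
  simp [setv, Function.update_apply]

@[simp] theorem setv_a (s : State) (x n : ℕ) (b : Fin 16) : (s.setv x n).a b = s.a b := rfl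

@[simp] theorem seta_v (s : State) (b : Fin 16) (i n y : ℕ) : (s.seta b i n).v y = s.v y := rfl

@[simp] theorem seta_a (s : State) (b : Fin 16) (i n : ℕ) (c : Fin 16) :
    (s.seta b i n).a c = if c = b then Function.update (s.a b) i n else s.a c := by
  simp [seta, Function.update_apply]

end State

/-- Expressions; `inp e` reads the input. -/
inductive Expr : Type
  | lit (n : ℕ)
  | var (x : ℕ)
  | add (e f : Expr)
  | sub (e f : Expr)
  | arr (b : Fin 16) (e : Expr)
  | inp (e : Expr)

namespace Expr

/-- The value of an expression on input `X`. -/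
def eval (X : ℕ → ℕ) (s : State) : Expr → ℕ
  | lit n => n
  | var x => s.v x
  | add e f => eval X s e + eval X s f
  | sub e f => eval X s e - eval X s f
  | arr b e => s.a b (eval X s e)
  | inp e => X (eval X s e)

/-- Machine instructions turning an index in register `r` into the address of a cell of the
array `b`; register `r + 2` is scratch space. -/
def addrCode (b : Fin 16) (r : ℕ) : RAMProgram :=
  [.add r r r, .add r r r, .add r r r, .add r r r, .add r r 1, .const (r + 2) b, .add r r (r + 2)]

/-- Machine code leaving the value of the expression in register `2 * t + 7`, and changing
only odd registers from there on. -/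
def compile : Expr → ℕ → RAMProgram
  | lit n, t => [.const (2 * t + 7) n]
  | var x, t => [.add (2 * t + 7) (2 * x) 5]
  | add e f, t => compile e t ++ compile f (t + 1) ++
      [.add (2 * t + 7) (2 * t + 7) (2 * (t + 1) + 7)]
  | sub e f, t => compile e t ++ compile f (t + 1) ++
      [.sub (2 * t + 7) (2 * t + 7) (2 * (t + 1) + 7)]
  | arr b e, t => compile e t ++ addrCode b (2 * t + 7) ++ [.load (2 * t + 7) (2 * t + 7)]
  | inp e, t => compile e t ++ [.sub (2 * (t + 1) + 7) (2 * t + 7) 3,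
      .sub (2 * t + 7) (2 * t + 7) (2 * (t + 1) + 7), .load (2 * t + 7) (2 * t + 7)]

/-- The length of the machine code of an expression. -/
def len : Expr → ℕ
  | lit _ => 1
  | var _ => 1
  | add e f => len e + len f + 1
  | sub e f => len e + len f + 1
  | arr _ e => len e + 8
  | inp e => len e + 3

theorem length_compile (e : Expr) (t : ℕ) : (e.compile t).length = e.len := by
  induction e generalizing t <;> simp_all [compile, len, addrCode] <;> omega

end Expr

/-- Commands. -/
inductive Cmd : Type
  | skip
  | set (x : ℕ) (e : Expr)
  | put (b : Fin 16) (i e : Expr)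
  | seq (c d : Cmd)
  | ite (e : Expr) (c d : Cmd)
  | loop (e : Expr) (c : Cmd)

/-- `Exec X c s t s'`: on input `X`, the command `c` leads from state `s` to `s'` at cost `t`. -/
inductive Exec (X : ℕ → ℕ) : Cmd → State → ℕ → State → Prop
  | skip (s) : Exec X .skip s 0 s
  | set (x e s) : Exec X (.set x e) s (e.len + 1) (s.setv x (e.eval X s))
  | put (b i e s) : Exec X (.put b i e) s (i.len + e.len + 8) (s.seta b (i.eval X s) (e.eval X s))
  | seq {c d s t s' t' s''} : Exec X c s t s' → Exec X d s' t' s'' →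
      Exec X (.seq c d) s (t + t') s''
  | ite_true {e c d s t s'} : e.eval X s ≠ 0 → Exec X c s t s' →
      Exec X (.ite e c d) s (e.len + t + 2) s'
  | ite_false {e c d s t s'} : e.eval X s = 0 → Exec X d s t s' →
      Exec X (.ite e c d) s (e.len + t + 2) s'
  | loop_done {e c s} : e.eval X s = 0 → Exec X (.loop e c) s (e.len + 1) s
  | loop_step {e c s t s' t' s''} : e.eval X s ≠ 0 → Exec X c s t s' →
      Exec X (.loop e c) s' t' s'' → Exec X (.loop e c) s (e.len + t + 2 + t') s''

namespace Cmd

/-- The length of the machine code of a command. -/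
def len : Cmd → ℕ
  | skip => 0
  | set _ e => e.len + 1
  | put _ i e => i.len + e.len + 8
  | seq c d => len c + len d
  | ite e c d => e.len + len c + len d + 2
  | loop e c => e.len + len c + 2

/-- Machine code of a command, to be placed at position `p` of a program. -/
def compile : Cmd → ℕ → RAMProgram
  | skip, _ => []
  | set x e, _ => e.compile 0 ++ [.add (2 * x) 7 5]
  | put b i e, _ => i.compile 0 ++ Expr.addrCode b 7 ++ e.compile 1 ++ [.store 7 9]
  | seq c d, p => compile c p ++ compile d (p + len c)
  | ite e c d, p => e.compile 0 ++ [.jumpZero 7 (p + e.len + len c + 2)] ++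
      compile c (p + e.len + 1) ++ [.jumpZero 5 (p + e.len + len c + len d + 2)] ++
      compile d (p + e.len + len c + 2)
  | loop e c, p => e.compile 0 ++ [.jumpZero 7 (p + e.len + len c + 2)] ++
      compile c (p + e.len + 1) ++ [.jumpZero 5 p]

theorem length_compile (c : Cmd) (p : ℕ) : (c.compile p).length = c.len := by
  induction c generalizing p <;>
    simp_all [compile, len, Expr.addrCode, Expr.length_compile] <;> omega

end Cmd

/-! ### Correctness of the compilation -/

/-- The instructions `code` stand at position `p` of the program `P`. -/
def CodeAt (P : RAMProgram) (p : ℕ) (code : RAMProgram) : Prop :=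
  ∀ i < code.length, P[p + i]? = code[i]?

theorem codeAt_append {P : RAMProgram} {p : ℕ} {c d : RAMProgram} :
    CodeAt P p (c ++ d) ↔ CodeAt P p c ∧ CodeAt P (p + c.length) d := by
  constructor
  · intro h
    refine ⟨fun i hi => ?_, fun i hi => ?_⟩
    · rw [h i (by simp; omega), List.getElem?_append_left hi]
    · rw [add_assoc, h (c.length + i) (by simp; omega), List.getElem?_append_right (by omega)]
      simp
  · rintro ⟨h1, h2⟩ i hi
    by_cases hc : i < c.length
    · rw [h1 i hc, List.getElem?_append_left hc]
    · rw [List.getElem?_append_right (by omega), ← h2 (i - c.length) (by simp at hi; omega)]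
      congr 1
      omega

theorem codeAt_cons {P : RAMProgram} {p : ℕ} {a : RAMInstr} {d : RAMProgram} :
    CodeAt P p (a :: d) ↔ P[p]? = some a ∧ CodeAt P (p + 1) d := by
  rw [show a :: d = [a] ++ d from rfl, codeAt_append]
  simp [CodeAt]

theorem step_eq {P : RAMProgram} {s : RAMConfig} {a : RAMInstr} (h : P[s.pc]? = some a) :
    P.step s = a.exec s := by
  simp [RAMProgram.step, h]

/-- Execution of a block of instructions without jumps. -/
theorem iterate_step_block {P : RAMProgram} {code : RAMProgram} {s : RAMConfig}
    (hp : ∀ a ∈ code, ∀ s, (RAMInstr.exec a s).pc = s.pc + 1) (hc : CodeAt P s.pc code) :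
    P.step^[code.length] s = code.foldl (fun s a => a.exec s) s := by
  induction code generalizing s with
  | nil => rfl
  | cons a code ih =>
    rw [codeAt_cons] at hc
    rw [List.length_cons, Function.iterate_succ_apply, step_eq hc.1, List.foldl_cons]
    refine ih (fun b hb => hp b (by simp [hb])) ?_
    rw [hp a (by simp)]
    exact hc.2

/-- The machine configuration `σ` represents the state `s` on an input `X` of length `L`. -/
structure Sim (X : ℕ → ℕ) (L : ℕ) (s : State) (σ : RAMConfig) : Prop where
  var : ∀ x, σ.reg (2 * x) = s.v x
  base : σ.reg 1 = L + 1
  length : σ.reg 3 = L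
  zero : σ.reg 5 = 0
  inp : ∀ i ≤ L, σ.mem i = X i
  arr : ∀ (b : Fin 16) i, σ.mem (L + 1 + 16 * i + b) = s.a b i

/-- Variables sit in the even registers, and registers 1, 3, 5 hold the constants `L + 1`, `L`, `0`.
Code that writes only odd registers from 7 on therefore cannot disturb the simulation. -/
theorem Sim.of_agree {X : ℕ → ℕ} {L : ℕ} {s : State} {σ σ' : RAMConfig} {r : ℕ}
    (h : Sim X L s σ) (hm : σ'.mem = σ.mem)
    (hr : ∀ q, (q < 7 + r ∨ q % 2 = 0) → σ'.reg q = σ.reg q) : Sim X L s σ' := by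
  constructor
  · intro x; rw [hr _ (Or.inr (by omega)), h.var]
  · rw [hr _ (Or.inl (by omega)), h.base]
  · rw [hr _ (Or.inl (by omega)), h.length]
  · rw [hr _ (Or.inl (by omega)), h.zero]
  · intro i hi; rw [hm, h.inp i hi]
  · intro b i; rw [hm, h.arr]

/-- Four doublings multiply the index by 16: the sixteen arrays are interleaved in the memory above
the input. -/
theorem addrCode_correct {P : RAMProgram} {X : ℕ → ℕ} {L : ℕ} {s : State} {σ : RAMConfig}
    {b : Fin 16} {t : ℕ} (hs : Sim X L s σ)
    (hc : CodeAt P σ.pc (Expr.addrCode b (2 * t + 7))) :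
    ∃ σ', P.step^[7] σ = σ' ∧ σ'.pc = σ.pc + 7 ∧ σ'.mem = σ.mem ∧
      σ'.reg (2 * t + 7) = L + 1 + 16 * σ.reg (2 * t + 7) + b ∧
      ∀ q, (q < 2 * t + 7 ∨ q % 2 = 0) → σ'.reg q = σ.reg q := by
  refine ⟨_, rfl, ?_⟩
  have hb := hs.base
  have e1 : (1 : ℕ) ≠ 2 * t + 7 := by omega
  have := iterate_step_block (by simp [Expr.addrCode, RAMInstr.exec]) hc
  rw [show (Expr.addrCode b (2 * t + 7)).length = 7 from rfl] at this
  rw [this]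
  simp only [Expr.addrCode, List.foldl_cons, List.foldl_nil]
  refine ⟨rfl, rfl, ?_, ?_⟩
  · simp [RAMInstr.exec, hb]
    omega
  · intro q hq
    have e2 : q ≠ 2 * t + 7 := by omega
    have e3 : q ≠ 2 * t + 7 + 2 := by omega
    simp [RAMInstr.exec, e2, e3]

/-- The odd registers serve as an evaluation stack of depth `t`. A second operand is evaluated at
depth `t + 1` and writes only odd registers from `2 * t + 9` on, so the frame clause protects the
first operand in `2 * t + 7`. -/
theorem Expr.compile_correct {P : RAMProgram} {X : ℕ → ℕ} {L : ℕ} (hX : ∀ i, L ≤ i → X i = 0)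
    {s : State} (e : Expr) (t : ℕ) {σ : RAMConfig} (hs : Sim X L s σ)
    (hc : CodeAt P σ.pc (e.compile t)) :
    ∃ σ', P.step^[e.len] σ = σ' ∧ σ'.pc = σ.pc + e.len ∧ σ'.mem = σ.mem ∧
      σ'.reg (2 * t + 7) = e.eval X s ∧
      ∀ q, (q < 2 * t + 7 ∨ q % 2 = 0) → σ'.reg q = σ.reg q := by
  induction e generalizing t σ with
  | lit n =>
    simp only [compile, codeAt_cons] at hc
    refine ⟨_, rfl, ?_⟩
    simp only [len, Function.iterate_one]
    rw [step_eq hc.1]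
    refine ⟨rfl, rfl, by simp [RAMInstr.exec, eval], fun q hq => ?_⟩
    have : q ≠ 2 * t + 7 := by omega
    simp [RAMInstr.exec, this]
  | var x =>
    simp only [compile, codeAt_cons] at hc
    refine ⟨_, rfl, ?_⟩
    simp only [len, Function.iterate_one]
    rw [step_eq hc.1]
    refine ⟨rfl, rfl, by simp [RAMInstr.exec, eval, hs.var, hs.zero], fun q hq => ?_⟩
    have : q ≠ 2 * t + 7 := by omega
    simp [RAMInstr.exec, this]
  | add e f ihe ihf =>
    simp only [compile, codeAt_append, length_compile, codeAt_cons, List.length_append] at hc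
    obtain ⟨⟨h1, h2⟩, h3, -⟩ := hc
    obtain ⟨σ1, r1, p1, m1, v1, o1⟩ := ihe t hs h1
    have hs1 : Sim X L s σ1 := hs.of_agree (r := 2 * t) m1 (fun q hq => o1 q (by omega))
    obtain ⟨σ2, r2, p2, m2, v2, o2⟩ := ihf (t + 1) hs1 (by rwa [p1])
    refine ⟨_, rfl, ?_⟩
    simp only [len]
    rw [show e.len + f.len + 1 = 1 + (f.len + e.len) by omega, Function.iterate_add_apply,
      Function.iterate_add_apply, r1, r2, Function.iterate_one,
      step_eq (by rw [p2, p1, add_assoc]; exact h3)]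
    refine ⟨by simp [RAMInstr.exec, p2, p1]; omega, by simp [RAMInstr.exec, m2, m1], ?_, ?_⟩
    · simp [RAMInstr.exec, v2, o2 (2 * t + 7) (by omega), v1, eval]
    · intro q hq
      have : q ≠ 2 * t + 7 := by omega
      simp [RAMInstr.exec, this, o2 q (by omega), o1 q (by omega)]
  | sub e f ihe ihf =>
    simp only [compile, codeAt_append, length_compile, codeAt_cons, List.length_append] at hc
    obtain ⟨⟨h1, h2⟩, h3, -⟩ := hc
    obtain ⟨σ1, r1, p1, m1, v1, o1⟩ := ihe t hs h1
    have hs1 : Sim X L s σ1 := hs.of_agree (r := 2 * t) m1 (fun q hq => o1 q (by omega))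
    obtain ⟨σ2, r2, p2, m2, v2, o2⟩ := ihf (t + 1) hs1 (by rwa [p1])
    refine ⟨_, rfl, ?_⟩
    simp only [len]
    rw [show e.len + f.len + 1 = 1 + (f.len + e.len) by omega, Function.iterate_add_apply,
      Function.iterate_add_apply, r1, r2, Function.iterate_one,
      step_eq (by rw [p2, p1, add_assoc]; exact h3)]
    refine ⟨by simp [RAMInstr.exec, p2, p1]; omega, by simp [RAMInstr.exec, m2, m1], ?_, ?_⟩
    · simp [RAMInstr.exec, v2, o2 (2 * t + 7) (by omega), v1, eval]
    · intro q hq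
      have : q ≠ 2 * t + 7 := by omega
      simp [RAMInstr.exec, this, o2 q (by omega), o1 q (by omega)]
  | arr b e ihe =>
    simp only [compile, codeAt_append, length_compile, codeAt_cons, List.length_append] at hc
    obtain ⟨⟨h1, h2⟩, h3, -⟩ := hc
    obtain ⟨σ1, r1, p1, m1, v1, o1⟩ := ihe t hs h1
    have hs1 : Sim X L s σ1 := hs.of_agree (r := 2 * t) m1 (fun q hq => o1 q (by omega))
    obtain ⟨σ2, r2, p2, m2, v2, o2⟩ := addrCode_correct (t := t) (b := b) hs1 (by rwa [p1])
    refine ⟨_, rfl, ?_⟩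
    simp only [len]
    rw [show e.len + 8 = 1 + (7 + e.len) by omega, Function.iterate_add_apply,
      Function.iterate_add_apply, r1, r2, Function.iterate_one,
      step_eq (by rw [p2, p1, add_assoc]; exact h3)]
    refine ⟨by simp [RAMInstr.exec, p2, p1]; omega, by simp [RAMInstr.exec, m2, m1], ?_, ?_⟩
    · simp only [RAMInstr.exec, v2, v1, eval, Function.update_self, m2, m1, hs.arr]
    · intro q hq
      have : q ≠ 2 * t + 7 := by omega
      simp [RAMInstr.exec, this, o2 q (by omega), o1 q (by omega)]
  | inp e ihe =>
    simp only [compile, codeAt_append, length_compile, codeAt_cons] at hc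
    obtain ⟨σ1, r1, p1, m1, v1, o1⟩ := ihe t hs hc.1
    refine ⟨_, rfl, ?_⟩
    have := iterate_step_block (P := P) (s := σ1) (code := [.sub (2 * (t + 1) + 7) (2 * t + 7) 3,
      .sub (2 * t + 7) (2 * t + 7) (2 * (t + 1) + 7), .load (2 * t + 7) (2 * t + 7)])
      (by simp [RAMInstr.exec]) (by rw [p1]; simpa only [codeAt_cons] using hc.2)
    rw [show List.length _ = 3 from rfl] at this
    simp only [len]
    rw [show e.len + 3 = 3 + e.len by omega, Function.iterate_add_apply, r1, this]
    simp only [List.foldl_cons, List.foldl_nil]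
    have hL : σ1.reg 3 = L := by rw [o1 3 (by omega), hs.length]
    refine ⟨by simp [RAMInstr.exec, p1]; omega, by simp [RAMInstr.exec, m1], ?_, ?_⟩
    -- The two truncated subtractions compute `min a L` for the index `a`. An index past the input
    -- is thus read at cell `L`, which holds zero and belongs to no array.
    · simp only [RAMInstr.exec, Function.update_self, eval, hL, v1, m1]
      rw [Function.update_of_ne (by omega), v1, hs.inp _ (by omega)]
      rcases le_total L (e.eval X s) with h | h
      · rw [hX _ h, hX _ (by omega)]
      · congr 1
        omega
    · intro q hq
      have e1 : q ≠ 2 * t + 7 := by omega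
      have e2 : q ≠ 2 * (t + 1) + 7 := by omega
      simp [RAMInstr.exec, e1, e2, o1 q (by omega)]

/-- Induction on the execution rather than on the command treats a loop one pass at a time. The cost
is only an upper bound for the steps, since a conditional is charged for two jumps even if the
second branch, which needs one, is taken. -/
theorem Cmd.compile_correct {P : RAMProgram} {X : ℕ → ℕ} {L : ℕ} (hX : ∀ i, L ≤ i → X i = 0)
    {c : Cmd} {s : State} {t : ℕ} {s' : State} (h : Exec X c s t s') {σ : RAMConfig}
    (hs : Sim X L s σ) (hc : CodeAt P σ.pc (c.compile σ.pc)) :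
    ∃ n ≤ t, ∃ σ', P.step^[n] σ = σ' ∧ σ'.pc = σ.pc + c.len ∧ Sim X L s' σ' := by
  induction h generalizing σ with
  | skip s => exact ⟨0, le_rfl, σ, rfl, rfl, hs⟩
  | set x e s =>
    simp only [compile, codeAt_append, Expr.length_compile, codeAt_cons] at hc
    obtain ⟨h1, h2, -⟩ := hc
    obtain ⟨σ1, r1, p1, m1, v1, o1⟩ := Expr.compile_correct hX e 0 hs h1
    have hs1 : Sim X L s σ1 := hs.of_agree (r := 0) m1 (fun q hq => o1 q (by omega))
    refine ⟨_, le_rfl, _, rfl, ?_⟩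
    rw [add_comm, Function.iterate_add_apply, r1, Function.iterate_one,
      step_eq (by rw [p1]; exact h2)]
    refine ⟨by simp [RAMInstr.exec, p1, len]; omega, ?_⟩
    have e1 : (1 : ℕ) ≠ 2 * x := by omega
    have e3 : (3 : ℕ) ≠ 2 * x := by omega
    have e5 : (5 : ℕ) ≠ 2 * x := by omega
    constructor
    · intro y
      have := hs1.var y
      simp only [RAMInstr.exec, Function.update_apply, State.setv_v, hs1.zero]
      by_cases hy : y = x
      · simpa [hy] using v1
      · simpa [hy] using this
    · simp [RAMInstr.exec, e1, hs1.base]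
    · simp [RAMInstr.exec, e3, hs1.length]
    · simp [RAMInstr.exec, e5, hs1.zero]
    · intro i hi; simp [RAMInstr.exec, hs1.inp i hi]
    · intro b i; simp [RAMInstr.exec, hs1.arr b i]
  | put b i e s =>
    simp only [compile, codeAt_append, Expr.length_compile, codeAt_cons, List.length_append] at hc
    obtain ⟨⟨⟨h1, h2⟩, h3⟩, h4, -⟩ := hc
    obtain ⟨σ1, r1, p1, m1, v1, o1⟩ := Expr.compile_correct hX i 0 hs h1
    have hs1 : Sim X L s σ1 := hs.of_agree (r := 0) m1 (fun q hq => o1 q (by omega))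
    obtain ⟨σ2, r2, p2, m2, v2, o2⟩ := addrCode_correct (t := 0) (b := b) hs1 (by rwa [p1])
    have hs2 : Sim X L s σ2 := hs1.of_agree (r := 0) m2 (fun q hq => o2 q (by omega))
    have hl : (Expr.addrCode b 7).length = 7 := rfl
    rw [hl] at h3 h4
    obtain ⟨σ3, r3, p3, m3, v3, o3⟩ := Expr.compile_correct hX e 1 hs2
      (by rw [p2, p1, add_assoc]; exact h3)
    have hs3 : Sim X L s σ3 := hs2.of_agree (r := 0) m3 (fun q hq => o3 q (by omega))
    refine ⟨_, le_rfl, _, rfl, ?_⟩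
    rw [show i.len + e.len + 8 = 1 + (e.len + (7 + i.len)) by omega, Function.iterate_add_apply,
      Function.iterate_add_apply, Function.iterate_add_apply, r1, r2, r3, Function.iterate_one,
      step_eq (by rw [p3, p2, p1, add_assoc, add_assoc, ← add_assoc i.len]; exact h4)]
    refine ⟨by simp [RAMInstr.exec, p3, p2, p1, len]; omega, ?_⟩
    have hr7 : σ3.reg 7 = L + 1 + 16 * i.eval X s + b := by
      rw [o3 7 (by omega)]
      simpa [v1] using v2
    have hr9 : σ3.reg 9 = e.eval X s := v3
    constructor
    · intro y; simp [RAMInstr.exec, hs3.var]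
    · simp [RAMInstr.exec, hs3.base]
    · simp [RAMInstr.exec, hs3.length]
    · simp [RAMInstr.exec, hs3.zero]
    · intro j hj
      simp only [RAMInstr.exec, hr7]
      rw [Function.update_of_ne (by omega), hs3.inp j hj]
    · intro b' j
      simp only [RAMInstr.exec, hr7, hr9, State.seta_a, Function.update_apply]
      have := hs3.arr b' j
      by_cases hb : b' = b
      · subst hb
        by_cases hj : j = i.eval X s
        · simp [hj]
        · have : ¬ (L + 1 + 16 * j + (b' : ℕ) = L + 1 + 16 * i.eval X s + b') := by omega
          simp [hj, hs3.arr]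
      · have hb' : (b' : ℕ) ≠ b := fun h => hb (Fin.ext h)
        -- Both array numbers are below 16, so addresses in different arrays differ modulo 16.
        have : ¬ (L + 1 + 16 * j + (b' : ℕ) = L + 1 + 16 * i.eval X s + b) := by omega
        simp [hb, this, hs3.arr]
  | seq _ _ ih1 ih2 =>
    simp only [compile, codeAt_append, length_compile] at hc
    obtain ⟨n1, l1, σ1, r1, p1, hs1⟩ := ih1 hs hc.1
    obtain ⟨n2, l2, σ2, r2, p2, hs2⟩ := ih2 hs1 (by rw [p1]; exact hc.2)
    refine ⟨n2 + n1, by omega, σ2, by rw [Function.iterate_add_apply, r1, r2], ?_, hs2⟩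
    rw [p2, p1, len, add_assoc]
  | @ite_true e c d s t s' he _ ih =>
    simp only [compile, codeAt_append, length_compile, Expr.length_compile, codeAt_cons,
      List.length_append, List.length_cons, List.length_nil] at hc
    obtain ⟨⟨⟨⟨h1, h2, -⟩, h3⟩, h4, -⟩, h5⟩ := hc
    obtain ⟨σ1, r1, p1, m1, v1, o1⟩ := Expr.compile_correct hX e 0 hs h1
    have hs1 : Sim X L s σ1 := hs.of_agree (r := 0) m1 (fun q hq => o1 q (by omega))
    have hne : σ1.reg 7 ≠ 0 := by rw [show 7 = 2 * 0 + 7 from rfl, v1]; exact he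
    have hstep := step_eq (P := P) (s := σ1) (by rw [p1]; exact h2)
    simp only [RAMInstr.exec, hne, if_false] at hstep
    obtain ⟨n2, l2, σ2, r2, p2, hs2⟩ := ih (σ := P.step σ1)
      (by rw [hstep]; exact hs1.of_agree (r := 0) rfl (fun _ _ => rfl))
      (by rw [hstep, p1]; exact h3)
    -- Register 5 holds zero, so this jump is unconditional.
    have hstep2 := step_eq (P := P) (s := σ2) (a := .jumpZero 5 (σ.pc + e.len + c.len + d.len + 2))
      (by rw [p2, hstep, p1, ← h4]; congr 1; dsimp only; omega)
    simp only [RAMInstr.exec, hs2.zero, if_true] at hstep2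
    refine ⟨1 + (n2 + (1 + e.len)), by omega, P.step σ2, ?_, ?_, ?_⟩
    · rw [Function.iterate_add_apply, Function.iterate_add_apply, Function.iterate_add_apply, r1,
        Function.iterate_one, r2]
    · rw [hstep2, len]; dsimp only; omega
    · rw [hstep2]; exact hs2.of_agree (r := 0) rfl (fun _ _ => rfl)
  | @ite_false e c d s t s' he _ ih =>
    simp only [compile, codeAt_append, length_compile, Expr.length_compile, codeAt_cons,
      List.length_append, List.length_cons, List.length_nil] at hc
    obtain ⟨⟨⟨⟨h1, h2, -⟩, h3⟩, h4, -⟩, h5⟩ := hc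
    obtain ⟨σ1, r1, p1, m1, v1, o1⟩ := Expr.compile_correct hX e 0 hs h1
    have hs1 : Sim X L s σ1 := hs.of_agree (r := 0) m1 (fun q hq => o1 q (by omega))
    have hne : σ1.reg 7 = 0 := by rw [show 7 = 2 * 0 + 7 from rfl, v1]; exact he
    have hstep := step_eq (P := P) (s := σ1) (by rw [p1]; exact h2)
    simp only [RAMInstr.exec, hne, if_true] at hstep
    obtain ⟨n2, l2, σ2, r2, p2, hs2⟩ := ih (σ := P.step σ1)
      (by rw [hstep]; exact hs1.of_agree (r := 0) rfl (fun _ _ => rfl))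
      (by
        rw [hstep]
        dsimp only
        convert h5 using 1
        omega)
    refine ⟨n2 + (1 + e.len), by omega, σ2, ?_, ?_, hs2⟩
    · rw [Function.iterate_add_apply, Function.iterate_add_apply, r1, Function.iterate_one, r2]
    · rw [p2, hstep, len]; dsimp only; omega
  | @loop_done e c s he =>
    simp only [compile, codeAt_append, length_compile, Expr.length_compile, codeAt_cons,
      List.length_append, List.length_cons, List.length_nil] at hc
    obtain ⟨⟨⟨h1, h2, -⟩, h3⟩, h4, -⟩ := hc
    obtain ⟨σ1, r1, p1, m1, v1, o1⟩ := Expr.compile_correct hX e 0 hs h1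
    have hs1 : Sim X L s σ1 := hs.of_agree (r := 0) m1 (fun q hq => o1 q (by omega))
    have hne : σ1.reg 7 = 0 := by rw [show 7 = 2 * 0 + 7 from rfl, v1]; exact he
    have hstep := step_eq (P := P) (s := σ1) (by rw [p1]; exact h2)
    simp only [RAMInstr.exec, hne, if_true] at hstep
    refine ⟨1 + e.len, by omega, P.step σ1, ?_, ?_, ?_⟩
    · rw [Function.iterate_add_apply, r1, Function.iterate_one]
    · rw [hstep, len]; dsimp only; omega
    · rw [hstep]; exact hs1.of_agree (r := 0) rfl (fun _ _ => rfl)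
  | @loop_step e c s t s' t' s'' he _ _ ih1 ih2 =>
    have hc0 := hc
    simp only [compile, codeAt_append, length_compile, Expr.length_compile, codeAt_cons,
      List.length_append, List.length_cons, List.length_nil] at hc
    obtain ⟨⟨⟨h1, h2, -⟩, h3⟩, h4, -⟩ := hc
    obtain ⟨σ1, r1, p1, m1, v1, o1⟩ := Expr.compile_correct hX e 0 hs h1
    have hs1 : Sim X L s σ1 := hs.of_agree (r := 0) m1 (fun q hq => o1 q (by omega))
    have hne : σ1.reg 7 ≠ 0 := by rw [show 7 = 2 * 0 + 7 from rfl, v1]; exact he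
    have hstep := step_eq (P := P) (s := σ1) (by rw [p1]; exact h2)
    simp only [RAMInstr.exec, hne, if_false] at hstep
    obtain ⟨n2, l2, σ2, r2, p2, hs2⟩ := ih1 (σ := P.step σ1)
      (by rw [hstep]; exact hs1.of_agree (r := 0) rfl (fun _ _ => rfl))
      (by rw [hstep, p1]; exact h3)
    have hstep2 := step_eq (P := P) (s := σ2) (a := .jumpZero 5 σ.pc)
      (by rw [p2, hstep, p1, ← h4]; congr 1; dsimp only; omega)
    simp only [RAMInstr.exec, hs2.zero, if_true] at hstep2
    obtain ⟨n3, l3, σ3, r3, p3, hs3⟩ := ih2 (σ := P.step σ2)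
      (by rw [hstep2]; exact hs2.of_agree (r := 0) rfl (fun _ _ => rfl))
      (by rw [hstep2]; exact hc0)
    refine ⟨n3 + (1 + (n2 + (1 + e.len))), by omega, σ3, ?_, ?_, hs3⟩
    · rw [Function.iterate_add_apply, Function.iterate_add_apply, Function.iterate_add_apply,
        Function.iterate_add_apply, r1, Function.iterate_one, r2, r3]
    · rw [p3, hstep2]

/-- The machine program for a command: set up the reserved registers and run its code. -/
def Cmd.program (c : Cmd) : RAMProgram :=
  [.add 3 0 5, .const 1 1, .add 1 1 0] ++ c.compile 3

/-- The state at the start, for an input of length `L`. -/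
def initState (L : ℕ) : State := ⟨fun x => if x = 0 then L else 0, fun _ _ => 0⟩

/-- The machine starts with the input length in register 0, that is, in variable 0; hence the form
of `initState`. The three extra steps fill registers 3 and 1, while register 5 is zero from the
start. -/
theorem Cmd.program_correct {c : Cmd} {x : List ℕ} {t : ℕ} {s : State} {b : Prop}
    (h : Exec (fun i => x.getD i 0) c (initState x.length) t s)
    (hb : b → s.v 0 = 1) (hb' : ¬ b → s.v 0 = 0) :
    c.program.DecidesInTime x b (t + 3) := by
  have hP : CodeAt c.program 0 c.program := fun i _ => by simp
  have hP' := hP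
  rw [Cmd.program, codeAt_append] at hP
  obtain ⟨h1, h2⟩ := hP
  have e3 : c.program.step^[3] (RAMProgram.initial x) =
      RAMInstr.exec (.add 1 1 0) (RAMInstr.exec (.const 1 1)
        (RAMInstr.exec (.add 3 0 5) (RAMProgram.initial x))) := by
    exact iterate_step_block (code := [.add 3 0 5, .const 1 1, .add 1 1 0])
      (by simp [RAMInstr.exec]) h1
  have hsim : Sim (fun i => x.getD i 0) x.length (initState x.length)
      (c.program.step^[3] (RAMProgram.initial x)) := by
    rw [e3]
    constructor
    · intro y
      have a1 : 2 * y ≠ 1 := by omega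
      have a3 : 2 * y ≠ 3 := by omega
      simp [RAMInstr.exec, RAMProgram.initial, initState, a1, a3]
    · simp [RAMInstr.exec, RAMProgram.initial]; omega
    · simp [RAMInstr.exec, RAMProgram.initial]
    · simp [RAMInstr.exec, RAMProgram.initial]
    · intro i hi; simp [RAMInstr.exec, RAMProgram.initial]
    · intro b i
      simp only [RAMInstr.exec, RAMProgram.initial, initState]
      -- Memory beyond the input is zero, so all arrays start out as zero.
      rw [List.getD_eq_default _ _ (by omega)]
  have hpc : (c.program.step^[3] (RAMProgram.initial x)).pc = 3 := by rw [e3]; rfl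
  obtain ⟨n, hn, σ, r, p, hs⟩ := Cmd.compile_correct (P := c.program)
    (fun i hi => List.getD_eq_default _ _ hi) h hsim (by rw [hpc]; exact h2)
  have hrun : c.program.run x (n + 3) = σ := by
    rw [RAMProgram.run, Function.iterate_add_apply, r]
  have h0 : σ.reg 0 = s.v 0 := hs.var 0
  refine ⟨n + 3, by omega, ?_, ?_, ?_⟩
  · rw [hrun, RAMProgram.Halted, p, hpc]
    simp [Cmd.program, Cmd.length_compile]
    omega
  · rw [hrun, h0]; exact hb
  · rw [hrun, h0]; exact hb'

end WhileLang

/-! ### Logarithmic cost of short computations -/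

namespace RAMProgram

/-- All numbers in registers and memory have at most `b` binary digits. -/
def SizeLE (s : RAMConfig) (b : ℕ) : Prop :=
  (∀ i, (s.reg i).size ≤ b) ∧ ∀ i, (s.mem i).size ≤ b

theorem size_add_le {a b n : ℕ} (ha : a.size ≤ n) (hb : b.size ≤ n) : (a + b).size ≤ n + 1 := by
  rw [Nat.size_le] at *
  rw [pow_succ]
  omega

theorem exists_const_bound (P : RAMProgram) :
    ∃ b : ℕ, ∀ i c, RAMInstr.const i c ∈ P → c.size ≤ b := by
  induction P with
  | nil => exact ⟨0, by simp⟩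
  | cons a P ih =>
    obtain ⟨b, hb⟩ := ih
    cases a with
    | const j d =>
      refine ⟨max b d.size, fun i c h => ?_⟩
      rcases List.mem_cons.1 h with h | h
      · cases h; exact le_max_right _ _
      · exact (hb i c h).trans (le_max_left _ _)
    | _ => exact ⟨b, fun i c h => hb i c (by simpa using h)⟩

/-- Addition is the only instruction that can exceed the bound, and by one bit at most; constants
are short by hypothesis. -/
theorem SizeLE.step {P : RAMProgram} {s : RAMConfig} {b : ℕ} (h : SizeLE s b)
    (hP : ∀ i c, RAMInstr.const i c ∈ P → c.size ≤ b) : SizeLE (P.step s) (b + 1) := by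
  obtain ⟨h1, h2⟩ := h
  have up : ∀ (f : ℕ → ℕ) (i n : ℕ), (∀ i, (f i).size ≤ b) → n.size ≤ b + 1 →
      ∀ j, (Function.update f i n j).size ≤ b + 1 := by
    intro f i n hf hn j
    rw [Function.update_apply]
    split_ifs
    · exact hn
    · exact (hf j).trans (by omega)
  unfold RAMProgram.step
  split
  · rename_i a ha
    have hmem := List.mem_of_getElem? ha
    cases a with
    | const i c => exact ⟨up _ _ _ h1 ((hP i c hmem).trans (by omega)),
        fun i => (h2 i).trans (by simp)⟩
    | add i j l => exact ⟨up _ _ _ h1 (size_add_le (h1 j) (h1 l)), fun i => (h2 i).trans (by simp)⟩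
    | sub i j l =>
      exact ⟨up _ _ _ h1 (((Nat.size_le_size (Nat.sub_le _ _)).trans (h1 j)).trans (by omega)),
        fun i => (h2 i).trans (by simp)⟩
    | load i j => exact ⟨up _ _ _ h1 ((h2 _).trans (by omega)), fun i => (h2 i).trans (by simp)⟩
    | store i j => exact ⟨fun i => (h1 i).trans (by simp), up _ _ _ h2 ((h1 _).trans (by omega))⟩
    | jumpZero i p => exact ⟨fun i => (h1 i).trans (by simp), fun i => (h2 i).trans (by simp)⟩
  · exact ⟨fun i => (h1 i).trans (by simp), fun i => (h2 i).trans (by simp)⟩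

theorem SizeLE.stepLogCost_le {P : RAMProgram} {s : RAMConfig} {b : ℕ} (h : SizeLE s b)
    (hP : ∀ i c, RAMInstr.const i c ∈ P → c.size ≤ b) : P.stepLogCost s ≤ 1 + 2 * b := by
  obtain ⟨h1, h2⟩ := h
  unfold RAMProgram.stepLogCost
  split
  · rename_i a ha
    have hmem := List.mem_of_getElem? ha
    cases a with
    | const i c => have := hP i c hmem; simp only [RAMInstr.logCost]; omega
    | add i j l => have := h1 j; have := h1 l; simp only [RAMInstr.logCost]; omega
    | sub i j l => have := h1 j; have := h1 l; simp only [RAMInstr.logCost]; omega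
    | load i j => have := h1 j; have := h2 (s.reg j); simp only [RAMInstr.logCost]; omega
    | store i j => have := h1 i; have := h1 j; simp only [RAMInstr.logCost]; omega
    | jumpZero i p => have := h1 i; simp only [RAMInstr.logCost]; omega
  · omega

theorem size_le_self (n : ℕ) : n.size ≤ n := Nat.size_le.2 n.lt_two_pow_self

theorem size_le_bitLength {x : List ℕ} {a : ℕ} (h : a ∈ x) : a.size ≤ bitLength x := by
  have := List.le_sum_of_mem (List.mem_map_of_mem (f := fun a : ℕ => a.size + 1) h)
  simp only [bitLength]
  omega

theorem length_le_bitLength (x : List ℕ) : x.length ≤ bitLength x := by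
  induction x with
  | nil => simp
  | cons a x ih => simp only [bitLength, List.map_cons, List.sum_cons, List.length_cons] at *; omega

theorem sizeLE_initial (x : List ℕ) : SizeLE (initial x) (bitLength x) := by
  constructor
  · intro i
    by_cases h : i = 0
    · simpa [initial, h] using (size_le_self _).trans (length_le_bitLength x)
    · simp [initial, h]
  · intro i
    rcases lt_or_ge i x.length with h | h
    · simpa [initial, h] using size_le_bitLength (List.getElem_mem h)
    · simp [initial, h]

/-- A computation of `T` steps has a logarithmic cost that is polynomial in `T` and in the bit
length of the input. -/
theorem exists_decidesInLogCost (P : RAMProgram) : ∃ b : ℕ, ∀ (x : List ℕ) (p : Prop) (T : ℕ),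
    P.DecidesInTime x p T → P.DecidesInLogCost x p (T * (1 + 2 * (b + bitLength x + T))) := by
  obtain ⟨b, hb⟩ := exists_const_bound P
  refine ⟨b, fun x p T => ?_⟩
  rintro ⟨t, htT, hh, h1, h0⟩
  refine ⟨t, ?_, hh, h1, h0⟩
  have key : ∀ i, SizeLE (P.run x i) (b + bitLength x + i) := by
    intro i
    induction i with
    | zero =>
      have := sizeLE_initial x
      exact ⟨fun i => (this.1 i).trans (by omega), fun i => (this.2 i).trans (by omega)⟩
    | succ i ih =>
      rw [RAMProgram.run, Function.iterate_succ_apply']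
      exact ih.step fun j c h => (hb j c h).trans (by omega)
  calc ∑ i ∈ Finset.range t, P.stepLogCost (P.run x i)
      ≤ ∑ i ∈ Finset.range t, (1 + 2 * (b + bitLength x + T)) := by
        refine Finset.sum_le_sum fun i hi => ?_
        have hi := Finset.mem_range.1 hi
        refine ((key i).stepLogCost_le fun j c h => (hb j c h).trans (by omega)).trans ?_
        omega
    _ = t * (1 + 2 * (b + bitLength x + T)) := by simp
    _ ≤ _ := Nat.mul_le_mul_right _ htT

end RAMProgram

/-! ### Rules for structured programs -/

namespace WhileLang

notation:50 c:51 ";;" d:50 => Cmd.seq c d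

namespace Cmd

/-- The variables that a command may change. -/
def wv : Cmd → List ℕ
  | skip => []
  | set x _ => [x]
  | put _ _ _ => []
  | seq c d => wv c ++ wv d
  | ite _ c d => wv c ++ wv d
  | loop _ c => wv c

/-- The arrays that a command may change. -/
def wa : Cmd → List (Fin 16)
  | skip => []
  | set _ _ => []
  | put b _ _ => [b]
  | seq c d => wa c ++ wa d
  | ite _ c d => wa c ++ wa d
  | loop _ c => wa c

/-- Commands without loops. -/
def simple : Cmd → Bool
  | skip => true
  | set _ _ => true
  | put _ _ _ => true
  | seq c d => simple c && simple d
  | ite _ c d => simple c && simple d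
  | loop _ _ => false

/-- The effect of a command without loops. -/
def run (X : ℕ → ℕ) : Cmd → State → State
  | skip, s => s
  | set x e, s => s.setv x (e.eval X s)
  | put b i e, s => s.seta b (i.eval X s) (e.eval X s)
  | seq c d, s => run X d (run X c s)
  | ite e c d, s => if e.eval X s = 0 then run X d s else run X c s
  | loop _ _, s => s

end Cmd

/-- The states `s` and `s'` agree except for what the command `c` may change. -/
structure Agree (c : Cmd) (s s' : State) : Prop where
  v : ∀ y, y ∉ c.wv → s'.v y = s.v y
  a : ∀ b, b ∉ c.wa → s'.a b = s.a b

theorem Agree.refl (c : Cmd) (s : State) : Agree c s s := ⟨fun _ _ => rfl, fun _ _ => rfl⟩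

theorem Exec.agree {X : ℕ → ℕ} {c : Cmd} {s : State} {t : ℕ} {s' : State} (h : Exec X c s t s') :
    Agree c s s' := by
  induction h with
  | skip s => exact .refl _ _
  | set x e s => exact ⟨fun y hy => by simp_all [Cmd.wv], fun b _ => rfl⟩
  | put b i e s => exact ⟨fun y _ => rfl, fun b hb => by simp_all [Cmd.wa]⟩
  | seq _ _ ih1 ih2 =>
    exact ⟨fun y hy => by
        simp only [Cmd.wv, List.mem_append, not_or] at hy; rw [ih2.v y hy.2, ih1.v y hy.1],
      fun y hy => by
        simp only [Cmd.wa, List.mem_append, not_or] at hy; rw [ih2.a y hy.2, ih1.a y hy.1]⟩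
  | ite_true _ _ ih =>
    exact ⟨fun y hy => ih.v y (by simp_all [Cmd.wv]), fun y hy => ih.a y (by simp_all [Cmd.wa])⟩
  | ite_false _ _ ih =>
    exact ⟨fun y hy => ih.v y (by simp_all [Cmd.wv]), fun y hy => ih.a y (by simp_all [Cmd.wa])⟩
  | loop_done _ => exact .refl _ _
  | loop_step _ _ _ ih1 ih2 =>
    exact ⟨fun y hy => by rw [ih2.v y hy, ih1.v y hy], fun y hy => by rw [ih2.a y hy, ih1.a y hy]⟩

/-- From the state `s` the command `c` terminates at cost at most `K` in a state satisfying `Q`. -/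
def Runs (X : ℕ → ℕ) (c : Cmd) (s : State) (K : ℕ) (Q : State → Prop) : Prop :=
  ∃ t s', Exec X c s t s' ∧ t ≤ K ∧ Q s'

namespace Runs

variable {X : ℕ → ℕ} {c d : Cmd} {s : State} {K K' : ℕ} {Q Q' : State → Prop}

/-- The frame `Agree` is available when a postcondition is weakened, so specifications need to
mention only what a command changes. -/
theorem mono (h : Runs X c s K Q) (hK : K ≤ K') (hQ : ∀ s', Agree c s s' → Q s' → Q' s') :
    Runs X c s K' Q' := by
  obtain ⟨t, s', h1, h2, h3⟩ := h
  exact ⟨t, s', h1, h2.trans hK, hQ s' h1.agree h3⟩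

theorem seq (h : Runs X c s K Q) (h' : ∀ s', Agree c s s' → Q s' → Runs X d s' K' Q') :
    Runs X (c ;; d) s (K + K') Q' := by
  obtain ⟨t, s', h1, h2, h3⟩ := h
  obtain ⟨t', s'', h1', h2', h3'⟩ := h' s' h1.agree h3
  exact ⟨t + t', s'', .seq h1 h1', by omega, h3'⟩

/-- Without loops every instruction is executed at most once, so the code length bounds the cost,
and the effect can be computed symbolically by `run`. -/
theorem of_simple (hc : c.simple = true) (h : Q (c.run X s)) : Runs X c s c.len Q := by
  suffices ∃ t ≤ c.len, Exec X c s t (c.run X s) by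
    obtain ⟨t, h1, h2⟩ := this
    exact ⟨t, _, h2, h1, h⟩
  clear h
  induction c generalizing s with
  | skip => exact ⟨0, le_rfl, .skip s⟩
  | set x e => exact ⟨_, le_rfl, .set x e s⟩
  | put b i e => exact ⟨_, le_rfl, .put b i e s⟩
  | seq c d ih1 ih2 =>
    simp only [Cmd.simple, Bool.and_eq_true] at hc
    obtain ⟨t1, l1, e1⟩ := ih1 (s := s) hc.1
    obtain ⟨t2, l2, e2⟩ := ih2 (s := c.run X s) hc.2
    exact ⟨t1 + t2, by simp only [Cmd.len]; omega, .seq e1 e2⟩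
  | ite e c d ih1 ih2 =>
    simp only [Cmd.simple, Bool.and_eq_true] at hc
    simp only [Cmd.run, Cmd.len]
    split_ifs with h
    · obtain ⟨t2, l2, e2⟩ := ih2 (s := s) hc.2
      exact ⟨_, by omega, .ite_false h e2⟩
    · obtain ⟨t2, l2, e2⟩ := ih1 (s := s) hc.1
      exact ⟨_, by omega, .ite_true h e2⟩
  | loop => simp [Cmd.simple] at hc

/-- While loops with an invariant `I` and a potential `Φ`. -/
theorem loop {e : Expr} {I : State → Prop} (Φ : State → ℕ)
    (hb : ∀ s, I s → e.eval X s ≠ 0 → Runs X c s K fun s' => I s' ∧ Φ s' < Φ s) (hs : I s) :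
    Runs X (.loop e c) s ((K + e.len + 2) * (Φ s + 1)) fun s' => I s' ∧ e.eval X s' = 0 := by
  -- At most `Φ s` passes are made; the additional one pays for the final failing test.
  induction hn : Φ s using Nat.strong_induction_on generalizing s with
  | _ n ih =>
    by_cases he : e.eval X s = 0
    · refine ⟨_, s, .loop_done he, ?_, hs, he⟩
      nlinarith [Nat.zero_le ((K + e.len + 2) * n)]
    · obtain ⟨t, s', h1, h2, h3, h4⟩ := hb s hs he
      obtain ⟨t', s'', h1', h2', h3'⟩ := ih (Φ s') (hn ▸ h4) h3 rfl
      refine ⟨_, s'', .loop_step he h1 h1', ?_, h3'⟩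
      have : (K + e.len + 2) * (Φ s' + 1) ≤ (K + e.len + 2) * n := Nat.mul_le_mul_left _ (by omega)
      rw [Nat.mul_succ]
      omega

end Runs

/-- `for x = 0, …, N - 1`, where the bound is a variable. -/
def Cmd.forLoop (x N : ℕ) (c : Cmd) : Cmd :=
  .set x (.lit 0) ;; .loop (.sub (.var N) (.var x)) (c ;; .set x (.add (.var x) (.lit 1)))

/-- The invariant is indexed by the counter. A pass costs `K`, plus 4 for the increment and 5 for
test and jumps; 2 more per pass cover the initial assignment, and the factor `s.v N + 1` counts the
last test as a pass. -/
theorem Runs.forLoop {X : ℕ → ℕ} {x N : ℕ} {c : Cmd} {s : State} {K : ℕ} (I : ℕ → State → Prop)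
    (hxN : N ≠ x) (hx : x ∉ c.wv) (hN : N ∉ c.wv) (h0 : I 0 (s.setv x 0))
    (hb : ∀ s', Agree (Cmd.forLoop x N c) s s' → s'.v x < s.v N → I (s'.v x) s' →
      Runs X c s' K fun s'' => I (s'.v x + 1) (s''.setv x (s'.v x + 1))) :
    Runs X (Cmd.forLoop x N c) s ((K + 11) * (s.v N + 1)) (I (s.v N)) := by
  have h1 : Runs X (.set x (.lit 0)) s 2 fun s' => s' = s.setv x 0 :=
    ⟨_, _, .set x _ s, by simp [Expr.len], rfl⟩
  let J : State → Prop := fun s' => Agree (Cmd.forLoop x N c) s s' ∧ s'.v N = s.v N ∧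
    s'.v x ≤ s.v N ∧ I (s'.v x) s'
  have h2 : Runs X (.loop (.sub (.var N) (.var x)) (c ;; .set x (.add (.var x) (.lit 1))))
      (s.setv x 0) ((K + 4 + 3 + 2) * (s.v N + 1)) fun s' => J s' ∧
        (Expr.sub (.var N) (.var x)).eval X s' = 0 := by
    have := Runs.loop (X := X) (e := .sub (.var N) (.var x)) (s := s.setv x 0) (I := J) (K := K + 4)
      (c := c ;; .set x (.add (.var x) (.lit 1))) (fun s' => s.v N - s'.v x) ?_ ?_
    · simpa [Expr.len] using this
    · rintro s' ⟨a1, a2, a3, a4⟩ he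
      simp only [Expr.eval] at he
      have hlt : s'.v x < s.v N := by omega
      refine Runs.seq (hb s' a1 hlt a4) (fun s'' ag hI => ?_)
      refine ⟨_, _, .set x _ s'', le_rfl, ?_⟩
      have hxx : s''.v x = s'.v x := ag.v x hx
      simp only [Expr.eval, hxx]
      refine ⟨⟨⟨fun y hy => ?_, fun b hb => ?_⟩, ?_, ?_, ?_⟩, ?_⟩
      · simp only [Cmd.forLoop, Cmd.wv, List.mem_append, List.mem_singleton, not_or] at hy
        rw [State.setv_v, if_neg hy.1, ag.v y hy.2.1, a1.v y (by simp [Cmd.forLoop, Cmd.wv, hy])]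
      · simp only [Cmd.forLoop, Cmd.wa, List.append_nil, List.nil_append] at hb
        rw [State.setv_a, ag.a b hb, a1.a b (by simp [Cmd.forLoop, Cmd.wa, hb])]
      · rw [State.setv_v, if_neg hxN, ag.v N hN, a2]
      · simp; omega
      · simpa using hI
      · simp; omega
    · refine ⟨⟨fun y hy => ?_, fun b hb => rfl⟩, ?_, ?_, ?_⟩
      · simp only [Cmd.forLoop, Cmd.wv, List.mem_append, List.mem_singleton, not_or] at hy
        simp [hy.1]
      · simp [hxN]
      · simp
      · simpa using h0
  refine (h1.seq (fun s' _ e => by rw [e]; exact h2)).mono ?_ ?_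
  · nlinarith [Nat.zero_le (s.v N)]
  · rintro s' - ⟨⟨-, b2, b3, b4⟩, b5⟩
    simp only [Expr.eval] at b5
    rwa [show s'.v x = s.v N by omega] at b4

end WhileLang

/-! ### Edge-indexed graphs, infinite paths and strongly connected sets of edges -/

namespace EdgeGraph

/-- Reachability along the edges in `A`, where the edge `e` leads from `src e` to `tgt e`. -/
def Reach (src tgt : ℕ → ℕ) (A : Set ℕ) : ℕ → ℕ → Prop :=
  Relation.ReflTransGen fun u v => ∃ e ∈ A, src e = u ∧ tgt e = v

variable {src tgt : ℕ → ℕ} {A B : Set ℕ} {u v w : ℕ}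

theorem Reach.refl (u : ℕ) : Reach src tgt A u u := Relation.ReflTransGen.refl

theorem Reach.trans (h : Reach src tgt A u v) (h' : Reach src tgt A v w) : Reach src tgt A u w :=
  Relation.ReflTransGen.trans h h'

theorem Reach.of_mem {e : ℕ} (h : e ∈ A) : Reach src tgt A (src e) (tgt e) :=
  Relation.ReflTransGen.single ⟨e, h, rfl, rfl⟩

theorem Reach.mono (hAB : A ⊆ B) (h : Reach src tgt A u v) : Reach src tgt B u v :=
  Relation.ReflTransGen.mono (fun _ _ ⟨e, he, h⟩ => ⟨e, hAB he, h⟩) _ _ h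

theorem Reach.swap (h : Reach src tgt A u v) : Reach tgt src A v u := by
  induction h with
  | refl => exact .refl _
  | tail _ h ih =>
    obtain ⟨e, he, rfl, rfl⟩ := h
    exact (Reach.of_mem (src := tgt) (tgt := src) he).trans ih

/-- A strongly connected set of edges that satisfies the acceptance condition. -/
structure GoodSet (src tgt : ℕ → ℕ) (k : ℕ) (F : ℕ → Prop) (R G : ℕ → ℕ → Prop) (S : Set ℕ) :
    Prop where
  conn : ∀ e ∈ S, ∀ e' ∈ S, Reach src tgt S (tgt e) (src e')
  inf : ∃ e ∈ S, F e
  resp : ∀ j < k, (∃ e ∈ S, R j e) → ∃ e ∈ S, G j e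

/-- The list `l` of edges is a walk from `u` to `v`. -/
def IsWalk (src tgt : ℕ → ℕ) : ℕ → List ℕ → ℕ → Prop
  | u, [], v => u = v
  | u, e :: l, v => src e = u ∧ IsWalk src tgt (tgt e) l v

theorem IsWalk.append {l l' : List ℕ} (h : IsWalk src tgt u l v) (h' : IsWalk src tgt v l' w) :
    IsWalk src tgt u (l ++ l') w := by
  induction l generalizing u with
  | nil => simpa [show u = v from h] using h'
  | cons e l ih => exact ⟨h.1, ih h.2⟩

theorem Reach.exists_walk (h : Reach src tgt A u v) :
    ∃ l, IsWalk src tgt u l v ∧ ∀ e ∈ l, e ∈ A := by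
  induction h with
  | refl => exact ⟨[], rfl, by simp⟩
  | tail _ h ih =>
    obtain ⟨l, h1, h2⟩ := ih
    obtain ⟨e, he, he1, he2⟩ := h
    refine ⟨l ++ [e], h1.append ⟨he1, he2⟩, ?_⟩
    simp only [List.mem_append, List.mem_singleton]
    rintro e' (h | rfl)
    · exact h2 _ h
    · exact he

theorem IsWalk.chain {l : List ℕ} (h : IsWalk src tgt u l v) (i : ℕ) (hi : i + 1 < l.length) :
    tgt (l.getD i 0) = src (l.getD (i + 1) 0) := by
  induction l generalizing u i with
  | nil => simp at hi
  | cons e l ih =>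
    cases i with
    | zero =>
      cases l with
      | nil => simp at hi
      | cons e' l => simpa using h.2.1.symm
    | succ i => simpa using ih h.2 i (by simpa using hi)

theorem IsWalk.src_zero {l : List ℕ} (h : IsWalk src tgt u l v) (hl : 0 < l.length) :
    src (l.getD 0 0) = u := by
  cases l with
  | nil => simp at hl
  | cons e l => simpa using h.1

/-- Concatenation of the first `n` of a sequence of lists. -/
def concat (w : ℕ → List ℕ) : ℕ → List ℕ
  | 0 => []
  | n + 1 => concat w n ++ w n

theorem concat_getD {w : ℕ → List ℕ} {n n' i : ℕ} (hn : n ≤ n') (hi : i < (concat w n).length) :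
    (concat w n').getD i 0 = (concat w n).getD i 0 := by
  induction n', hn using Nat.le_induction with
  | base => rfl
  | succ n' hn ih =>
    have : (concat w n).length ≤ (concat w n').length := by
      clear ih
      induction n', hn using Nat.le_induction with
      | base => rfl
      | succ n' hn ih => simp only [concat, List.length_append]; omega
    rw [← ih, concat, List.getD_append _ _ _ _ (by omega)]

/-- An infinite path from `u` that runs into `S` and takes every edge of `S` infinitely often. -/
theorem exists_path_of_conn {S : Set ℕ} (hSA : S ⊆ A) (hS : S.Nonempty)
    (hc : ∀ e ∈ S, ∀ e' ∈ S, Reach src tgt S (tgt e) (src e'))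
    (hu : ∀ e ∈ S, Reach src tgt A u (src e)) :
    ∃ (p : ℕ → ℕ) (N : ℕ), (∀ t, p t ∈ A) ∧ src (p 0) = u ∧ (∀ t, tgt (p t) = src (p (t + 1))) ∧
      (∀ t, N ≤ t → p t ∈ S) ∧ ∀ e ∈ S, {t | p t = e}.Infinite := by
  obtain ⟨g, hg⟩ := (Set.to_countable S).exists_eq_range hS
  -- Unpairing repeats the enumeration, so every edge of `S` is `f n` for arbitrarily large `n`.
  let f : ℕ → ℕ := fun n => g n.unpair.1
  have hf : ∀ n, f n ∈ S := fun n => by rw [hg]; exact ⟨_, rfl⟩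
  have hfi : ∀ e ∈ S, ∀ n, ∃ n' ≥ n, f n' = e := by
    intro e he n
    rw [hg] at he
    obtain ⟨a, rfl⟩ := he
    exact ⟨Nat.pair a n, Nat.right_le_pair _ _, by simp [f]⟩
  have h0 : ∃ l, IsWalk src tgt u l (src (f 0)) ∧ ∀ e ∈ l, e ∈ A := (hu _ (hf 0)).exists_walk
  have h1 : ∀ n, ∃ l, IsWalk src tgt (tgt (f n)) l (src (f (n + 1))) ∧ ∀ e ∈ l, e ∈ S :=
    fun n => (hc _ (hf n) _ (hf (n + 1))).exists_walk
  obtain ⟨l0, hl0, hl0A⟩ := h0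
  choose l hl hlS using h1
  -- Block `n` is a connecting walk followed by `f n`; only block 0 may leave `S`.
  let w : ℕ → List ℕ := fun n => (n.casesOn l0 l) ++ [f n]
  have hw : ∀ n, IsWalk src tgt u (concat w (n + 1)) (tgt (f n)) := by
    intro n
    induction n with
    | zero => exact (IsWalk.append (l := []) rfl (hl0.append ⟨rfl, rfl⟩))
    | succ n ih => exact ih.append ((hl n).append ⟨rfl, rfl⟩)
  have hlen : ∀ n, n ≤ (concat w n).length := by
    intro n
    induction n with
    | zero => simp
    | succ n ih =>
      have : 1 ≤ (w n).length := by simp [w]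
      rw [concat, List.length_append]
      omega
  -- No block is empty, so the first `t + 1` blocks reach past position `t`.
  let p : ℕ → ℕ := fun t => (concat w (t + 1)).getD t 0
  have hp : ∀ n t, t < (concat w n).length → p t = (concat w n).getD t 0 := by
    intro n t ht
    have := hlen (t + 1)
    rcases le_total n (t + 1) with h | h
    · exact concat_getD h ht
    · exact (concat_getD h (by omega)).symm
  have hmem : ∀ n e, e ∈ w (n + 1) → e ∈ S := by
    intro n e he
    rcases List.mem_append.1 he with h | h
    · exact hlS n _ h
    · rw [List.mem_singleton.1 h]; exact hf _
  have hmem0 : ∀ e, e ∈ w 0 → e ∈ A := by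
    intro e he
    rcases List.mem_append.1 he with h | h
    · exact hl0A _ h
    · rw [List.mem_singleton.1 h]; exact hSA (hf _)
  have htail : ∀ t, (w 0).length ≤ t → p t ∈ S := by
    intro t ht
    have key : ∀ n t, (w 0).length ≤ t → t < (concat w (n + 1)).length →
        (concat w (n + 1)).getD t 0 ∈ S := by
      intro n
      induction n with
      | zero => intro t h1 h2; simp [concat] at h2; omega
      | succ n ih =>
        intro t h1 h2
        rcases lt_or_ge t (concat w (n + 1)).length with h | h
        · rw [concat_getD (Nat.le_succ _) h]; exact ih t h1 h
        · rw [concat, List.getD_append_right _ _ _ _ h]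
          rw [concat, List.length_append] at h2
          rw [List.getD_eq_getElem _ _ (by omega)]
          exact hmem n _ (List.getElem_mem _)
    exact key t t ht (by have := hlen (t + 1); omega)
  refine ⟨p, (w 0).length, ?_, ?_, ?_, htail, ?_⟩
  · intro t
    rcases lt_or_ge t (w 0).length with h | h
    · rw [hp 1 t (by simpa [concat] using h)]
      simp only [concat, List.nil_append]
      rw [List.getD_eq_getElem _ _ h]
      exact hmem0 _ (List.getElem_mem _)
    · exact hSA (htail t h)
  · exact (hw 0).src_zero (by have := hlen (0 + 1); omega)
  · intro t
    have := hlen (t + 1 + 1)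
    rw [hp (t + 1 + 1) t (by omega), hp (t + 1 + 1) (t + 1) (by omega)]
    exact (hw (t + 1)).chain t (by omega)
  · intro e he
    refine Set.infinite_of_forall_exists_gt fun a => ?_
    obtain ⟨n, hn, hne⟩ := hfi e he (a + 1)
    -- The last position of block `n` holds `f n = e`, and it exceeds `a` because `n` does.
    refine ⟨(concat w (n + 1)).length - 1, ?_, ?_⟩
    · have := hlen (n + 1)
      rw [Set.mem_ofPred_eq, hp (n + 1) _ (by omega), concat]
      rw [List.getD_append_right _ _ _ _ (by simp [w])]
      simp only [w, List.length_append, List.length_singleton]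
      rw [List.getD_append_right _ _ _ _ (by omega)]
      rw [← hne]
      convert List.getD_cons_zero using 2
      omega
    · have := hlen (n + 1); omega

/-- The edges that an infinite path takes infinitely often are strongly connected. -/
theorem infinitely_often_conn {m : ℕ} {p : ℕ → ℕ} (hm : ∀ t, p t < m)
    (hc : ∀ t, tgt (p t) = src (p (t + 1))) :
    (∃ N, ∀ t, N ≤ t → {t' | p t' = p t}.Infinite) ∧
      ∀ e ∈ {e | {t | p t = e}.Infinite}, ∀ e' ∈ {e | {t | p t = e}.Infinite},
        Reach src tgt {e | {t | p t = e}.Infinite} (tgt e) (src e') := by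
  set S : Set ℕ := {e | {t | p t = e}.Infinite} with hS
  have h1 : ∃ N, ∀ t, N ≤ t → p t ∈ S := by
    -- There are finitely many edges, and each one outside `S` is taken at finitely many times.
    have hfin : {t | p t ∉ S}.Finite := by
      refine ((Set.finite_lt_nat m).inter_of_left Sᶜ).biUnion (t := fun e => {t | p t = e})
        (fun e he => ?_) |>.subset ?_
      · simpa [hS] using he.2
      · intro t ht
        simp only [Set.mem_iUnion]
        exact ⟨p t, ⟨hm t, ht⟩, rfl⟩
    obtain ⟨N, hN⟩ := hfin.bddAbove
    refine ⟨N + 1, fun t ht => ?_⟩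
    by_contra hcon
    have := hN hcon
    omega
  obtain ⟨N, hN⟩ := h1
  refine ⟨⟨N, hN⟩, fun e he e' he' => ?_⟩
  -- From an occurrence of `e` beyond `N` to a later one of `e'`, the path stays in `S`.
  obtain ⟨t, ht, htN⟩ := Set.Infinite.exists_gt he N
  obtain ⟨t', ht', htt⟩ := Set.Infinite.exists_gt he' t
  have key : ∀ n, Reach src tgt S (tgt (p t)) (src (p (t + 1 + n))) := by
    intro n
    induction n with
    | zero => rw [hc t]; exact .refl _
    | succ n ih =>
      refine ih.trans ?_
      rw [← add_assoc, ← hc]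
      exact .of_mem (hN _ (by omega))
  have := key (t' - (t + 1))
  rw [show t + 1 + (t' - (t + 1)) = t' by omega] at this
  rwa [show p t = e from ht, show p t' = e' from ht'] at this

/-- There is an accepting path from `u` if and only if there is a good set of reachable edges. -/
theorem exists_path_iff {m k : ℕ} {E F : ℕ → Prop} {R G : ℕ → ℕ → Prop} :
    (∃ p : ℕ → ℕ, (∀ t, p t < m) ∧ src (p 0) = u ∧ (∀ t, tgt (p t) = src (p (t + 1))) ∧
      {t | F (p t)}.Infinite ∧ {t | E (p t)}.Finite ∧
      ∀ j < k, {t | R j (p t)}.Finite ∨ {t | G j (p t)}.Infinite) ↔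
    ∃ S ⊆ {e | e < m ∧ Reach src tgt {e | e < m} u (src e) ∧ ¬ E e}, GoodSet src tgt k F R G S := by
  constructor
  · rintro ⟨p, hm, h0, hc, hF, hE, hRG⟩
    obtain ⟨⟨N, hN⟩, hconn⟩ := infinitely_often_conn hm hc
    have hr : ∀ t, Reach src tgt {e | e < m} u (src (p t)) := by
      intro t
      induction t with
      | zero => rw [h0]; exact .refl _
      | succ t ih => rw [← hc]; exact ih.trans (.of_mem (hm t))
    have hinf : ∀ {Q : ℕ → Prop} {e : ℕ}, {t | p t = e}.Infinite → Q e → {t | Q (p t)}.Infinite :=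
      fun he hQ => he.mono fun t ht => by rw [Set.mem_ofPred_eq] at *; rwa [ht]
    have hex : ∀ {Q : ℕ → Prop}, {t | Q (p t)}.Infinite → ∃ e, {t | p t = e}.Infinite ∧ Q e := by
      intro Q hQ
      obtain ⟨t, ht, htN⟩ := hQ.exists_gt N
      exact ⟨p t, hN t htN.le, ht⟩
    refine ⟨{e | {t | p t = e}.Infinite}, fun e he => ?_, hconn, hex hF, ?_⟩
    · obtain ⟨t, ht⟩ := Set.Infinite.nonempty he
      rw [Set.mem_ofPred_eq] at ht
      exact ⟨ht ▸ hm t, ht ▸ hr t, fun h => hinf he h hE⟩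
    · rintro j hj ⟨e, he, hR⟩
      exact hex ((hRG j hj).resolve_left (hinf he hR))
  · rintro ⟨S, hSA, hS⟩
    obtain ⟨p, N, hA, h0, hc, hN, hi⟩ := exists_path_of_conn (A := {e | e < m})
      (fun e he => (hSA he).1) ⟨_, hS.inf.choose_spec.1⟩ hS.conn (fun e he => (hSA he).2.1)
    have hinf : ∀ {Q : ℕ → Prop} {e : ℕ}, e ∈ S → Q e → {t | Q (p t)}.Infinite :=
      fun he hQ => (hi _ he).mono fun t ht => by rw [Set.mem_ofPred_eq] at *; rwa [ht]
    have hfin : ∀ {Q : ℕ → Prop}, (∀ e ∈ S, ¬ Q e) → {t | Q (p t)}.Finite := by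
      intro Q hQ
      refine (Set.finite_lt_nat N).subset fun t ht => ?_
      by_contra hcon
      exact hQ _ (hN t (not_lt.1 hcon)) ht
    obtain ⟨e, he, hF⟩ := hS.inf
    refine ⟨p, hA, h0, hc, hinf he hF, hfin fun e he => (hSA he).2.2, fun j hj => ?_⟩
    by_cases h : ∃ e ∈ S, R j e
    · obtain ⟨e, he, hG⟩ := hS.resp j hj h
      exact Or.inr (hinf he hG)
    · exact Or.inl (hfin (by simpa using h))

/-! ### Refinement of a set of edges by strongly connected components -/

/-- The edges of `A` in the strongly connected component of the edge `e`. -/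
def component (src tgt : ℕ → ℕ) (A : Set ℕ) (e : ℕ) : Set ℕ :=
  {f ∈ A | Reach src tgt A (tgt e) (src f) ∧ Reach src tgt A (tgt f) (src e)}

theorem component_mono (hAB : A ⊆ B) (e : ℕ) : component src tgt A e ⊆ component src tgt B e :=
  fun _ hf => ⟨hAB hf.1, hf.2.1.mono hAB, hf.2.2.mono hAB⟩

/-- Every edge on an `A`-path from `f` to `f'` lies on a closed walk through `e`, hence in the
component itself. Such a path exists: it goes through `e`, which is why `e ∈ A` is needed. -/
theorem reach_component {e f f' : ℕ} (he : e ∈ A) (hf : f ∈ component src tgt A e)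
    (hf' : f' ∈ component src tgt A e) :
    Reach src tgt (component src tgt A e) (tgt f) (src f') := by
  have key : ∀ v, Reach src tgt A (tgt f) v → Reach src tgt A v (src f') →
      Reach src tgt (component src tgt A e) (tgt f) v := by
    intro v hv
    induction hv with
    | refl => intro _; exact .refl _
    | tail h1 h2 ih =>
      intro h3
      obtain ⟨g, hg, rfl, rfl⟩ := h2
      have hg' : g ∈ component src tgt A e :=
        ⟨hg, hf.2.1.trans ((Reach.of_mem hf.1).trans h1), h3.trans
            ((Reach.of_mem hf'.1).trans hf'.2.2)⟩
      exact (ih ((Reach.of_mem hg).trans h3)).trans (.of_mem hg')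
  exact key _ (hf.2.2.trans ((Reach.of_mem he).trans hf'.2.1)) (.refl _)

/-- Refinement leads from the set `A` of edges to the set `A'`, where the first `l` of the `k`
Streett pairs have been treated. -/
structure Refines (src tgt : ℕ → ℕ) (k l : ℕ) (F : ℕ → Prop) (R G : ℕ → ℕ → Prop) (A A' : Set ℕ) :
    Prop where
  sub : A' ⊆ A
  keep : ∀ S ⊆ A, GoodSet src tgt k F R G S → S ⊆ A'
  mem : ∀ e ∈ A', e ∈ component src tgt A e
  inf : ∀ e ∈ A', ∃ f ∈ component src tgt A e, F f
  resp : ∀ e ∈ A', ∀ j < l, (∀ g ∈ component src tgt A e, ¬ G j g) →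
    ∀ g ∈ component src tgt A e, g ∈ A' → ¬ R j g

/-- After `k + 1` rounds of refinement the remaining set is non-empty if and only if there is a
good set of edges. -/
theorem nonempty_iff_of_refines {k : ℕ} {F : ℕ → Prop} {R G : ℕ → ℕ → Prop} {A : ℕ → Set ℕ}
    (h : ∀ r ≤ k, Refines src tgt k k F R G (A r) (A (r + 1))) :
    (A (k + 1)).Nonempty ↔ ∃ S ⊆ A 0, GoodSet src tgt k F R G S := by
  constructor
  · rintro ⟨e, he⟩
    have hmono : ∀ r ≤ k + 1, ∀ r' ≤ r, A r ⊆ A r' := by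
      intro r hr r' hr'
      induction r, hr' using Nat.le_induction with
      | base => exact subset_rfl
      | succ n hn ih => exact ((h n (by omega)).sub).trans (ih (by omega))
    by_contra hcon
    -- In each round the component of `e` is strongly connected and meets `F`. As it is not good, it
    -- violates some Streett pair.
    have hbad : ∀ r : Fin (k + 1), ∃ j : Fin k, (∃ g ∈ component src tgt (A r) e, R j g) ∧
        ∀ g ∈ component src tgt (A r) e, ¬ G j g := by
      intro ⟨r, hr⟩
      by_contra hb
      push Not at hb
      have her : e ∈ A (r + 1) := hmono (k + 1) le_rfl (r + 1) (by omega) he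
      refine hcon ⟨component src tgt (A r) e,
        fun f hf => hmono r (by omega) 0 (by omega) hf.1, ?_, (h r (by omega)).inf e her, ?_⟩
      · intro f hf f' hf'; exact reach_component (hmono (k + 1) le_rfl r (by omega) he) hf hf'
      · rintro j hj ⟨g, hg, hR⟩
        exact hb ⟨j, hj⟩ ⟨g, hg, hR⟩
    choose j hjR hjG using hbad
    -- Pigeonhole: `k + 1` rounds and only `k` pairs.
    obtain ⟨r, r', hne, hrr⟩ := Fintype.exists_ne_map_eq_of_card_lt j (by simp)
    wlog hlt : r < r' generalizing r r'
    · exact this r' r hne.symm hrr.symm (lt_of_le_of_ne (not_lt.1 hlt) hne.symm)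
    obtain ⟨g, hg, hR⟩ := hjR r'
    have hr' := r'.2
    have hlt' : (r : ℕ) + 1 ≤ r' := hlt
    have hsub : A r' ⊆ A (r + 1) := hmono r' (by omega) _ hlt'
    -- Round `r` removed the edges in `R (j r)` from the component of `e`, but the component in
    -- round `r'` lies inside what was left and still contains such an edge.
    refine (h r (by omega)).resp e (hmono (k + 1) le_rfl (r + 1) (by omega) he) (j r) (j r).2
      (hjG r) g (component_mono (hsub.trans (h r (by omega)).sub) e hg) (hsub hg.1) ?_
    rwa [hrr]
  · rintro ⟨S, hS, hgood⟩
    have : ∀ r ≤ k + 1, S ⊆ A r := by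
      intro r
      induction r with
      | zero => exact fun _ => hS
      | succ r ih => exact fun hr => (h r (by omega)).keep S (ih (by omega)) hgood
    obtain ⟨e, he, -⟩ := hgood.inf
    exact ⟨e, this _ le_rfl he⟩

end EdgeGraph

/-! ### Depth-first search -/

namespace EdgeGraph

/-- The array `nx` links the edges in `A` with the same source, in decreasing order and
with an offset of one; zero ends a list. -/
structure Linked (A : Set ℕ) (src nx : ℕ → ℕ) : Prop where
  mem : ∀ e ∈ A, nx e ≠ 0 → nx e - 1 ∈ A ∧ src (nx e - 1) = src e
  le : ∀ e ∈ A, nx e ≤ e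
  next : ∀ e ∈ A, ∀ e' ∈ A, src e' = src e → e' < e → e' < nx e

/-- The edges that the lists starting at `head` still contain. -/
def pending (A : Set ℕ) (src head : ℕ → ℕ) : Set ℕ := {e ∈ A | e < head (src e)}

/-- The result of a depth-first search with the roots `rt (nr - 1), …, rt 0`: `lab` labels every
vertex that was found with the successor of its root, and `ord` lists the `n` vertices that were
found in the order in which they were finished. -/
structure DfsResult (A : Set ℕ) (src tgt : ℕ → ℕ) (nr : ℕ) (rt lab : ℕ → ℕ) (n : ℕ)
    (ord : ℕ → ℕ) : Prop where
  lab_iff : ∀ v, lab v ≠ 0 ↔ ∃ i < nr, Reach src tgt A (rt i) v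
  lab_spec : ∀ v, lab v ≠ 0 → ∃ i < nr, lab v = rt i + 1 ∧ Reach src tgt A (rt i) v ∧
    ∀ j, i < j → j < nr → ¬ Reach src tgt A (rt j) v
  ord_iff : ∀ v, (∃ j < n, ord j = v) ↔ lab v ≠ 0
  ord_inj : ∀ j < n, ∀ j' < n, ord j = ord j' → j = j'
  ord_spec : ∀ j < n, ∀ e ∈ A, src e = ord j → Reach src tgt A (tgt e) (ord j) ∨
    ∀ z, Reach src tgt A (tgt e) z → ∃ j' < j, ord j' = z

/-- Labels of a backward search in reverse order of finishing are strongly connected components. -/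
theorem DfsResult.scc {A : Set ℕ} {src tgt : ℕ → ℕ} {nr n n' : ℕ} {rt lab ord comp ord' : ℕ → ℕ}
    (h : DfsResult A src tgt nr rt lab n ord) (h' : DfsResult A tgt src n ord comp n' ord')
    (hs : ∀ e ∈ A, lab (src e) ≠ 0) {u v : ℕ} (hu : comp u ≠ 0) (hv : comp v ≠ 0) :
    comp u = comp v ↔ Reach src tgt A u v ∧ Reach src tgt A v u := by
  have key : ∀ v, comp v ≠ 0 → ∃ i < n, comp v = ord i + 1 ∧ Reach src tgt A v (ord i) ∧
      Reach src tgt A (ord i) v ∧ ∀ j, i < j → j < n → ¬ Reach src tgt A v (ord j) := by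
    intro v hv
    obtain ⟨i, hi, h1, h2, h3⟩ := h'.lab_spec v hv
    have h2 := h2.swap
    have h3 : ∀ j, i < j → j < n → ¬ Reach src tgt A v (ord j) :=
      fun j hij hj hr => h3 j hij hj hr.swap
    refine ⟨i, hi, h1, h2, ?_, h3⟩
    -- Kosaraju's argument, along a path from `w` to `ord i`. Let `e` be its first edge, with source
    -- `ord j`. Either `tgt e` leads back to `ord j`, or all that is reachable from `tgt e` was
    -- finished before `ord j`. In the second case `i < j`, although `i` is the largest index with
    -- `ord i` reachable from `v`.
    have back : ∀ w, Reach src tgt A w (ord i) → Reach src tgt A v w →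
        Reach src tgt A (ord i) w := by
      intro w hw
      induction hw using Relation.ReflTransGen.head_induction_on with
      | refl => exact fun _ => .refl _
      | head hstep hrest ih =>
        intro hvw
        obtain ⟨e, he, rfl, rfl⟩ := hstep
        obtain ⟨j, hj, hje⟩ := (h.ord_iff _).2 (hs e he)
        rcases h.ord_spec j hj e he hje.symm with hr | hr
        · rw [hje] at hr
          exact (ih (hvw.trans (.of_mem he))).trans hr
        · obtain ⟨j', hj', hr⟩ := hr _ hrest
          have := h.ord_inj j' (by omega) i hi hr
          exact absurd (hje ▸ hvw) (h3 j (by omega) hj)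
    exact back v h2 (.refl _)
  obtain ⟨i, hi, e1, a1, b1, c1⟩ := key u hu
  obtain ⟨j, hj, e2, a2, b2, c2⟩ := key v hv
  rw [e1, e2]
  constructor
  · intro hij
    rw [Nat.add_right_cancel hij] at a1 b1
    exact ⟨a1.trans b2, a2.trans b1⟩
  · rintro ⟨huv, hvu⟩
    have l1 : ¬ i < j := fun hij => c1 j hij hj (huv.trans a2)
    have l2 : ¬ j < i := fun hij => c2 i hij hi (hvu.trans a1)
    rw [show i = j by omega]

/-- The invariant of depth-first search. The next root is `rt (i - 1)`; the stack holds
`stk 0, …, stk (sp - 1)`; and `lb` is the current label. -/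
structure DfsInv (A : Set ℕ) (src tgt : ℕ → ℕ) (nr : ℕ) (rt head lab stk ord : ℕ → ℕ)
    (i sp n lb : ℕ) : Prop where
  head_ok : ∀ v, head v ≠ 0 → head v - 1 ∈ A ∧ src (head v - 1) = v
  scanned : ∀ e ∈ A, head (src e) ≤ e → lab (tgt e) ≠ 0
  lab_iff : ∀ v, lab v ≠ 0 ↔ (∃ j < sp, stk j = v) ∨ ∃ j < n, ord j = v
  stk_inj : ∀ j < sp, ∀ j' < sp, stk j = stk j' → j = j'
  ord_inj : ∀ j < n, ∀ j' < n, ord j = ord j' → j = j'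
  disj : ∀ j < sp, ∀ j' < n, stk j ≠ ord j'
  ord_head : ∀ j < n, head (ord j) = 0
  stk_reach : ∀ j j', j ≤ j' → j' < sp → Reach src tgt A (stk j) (stk j')
  stk_root : 0 < sp → i < nr ∧ stk 0 = rt i ∧ lb = rt i + 1
  lab_spec : ∀ v, lab v ≠ 0 → ∃ i', i ≤ i' ∧ i' < nr ∧ lab v = rt i' + 1 ∧
    Reach src tgt A (rt i') v ∧ ∀ j, i' < j → j < nr → ¬ Reach src tgt A (rt j) v
  done : ∀ i', i < i' → i' < nr → ∀ v, Reach src tgt A (rt i') v → lab v ≠ 0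
  cur : i < nr → lab (rt i) ≠ 0
  ord_spec : ∀ j < n, ∀ e ∈ A, src e = ord j → Reach src tgt A (tgt e) (ord j) ∨
    ∀ z, Reach src tgt A (tgt e) z → ∃ j' < j, ord j' = z

namespace DfsInv

variable {A : Set ℕ} {src tgt nx rt head lab stk ord : ℕ → ℕ} {m nr i sp n lb : ℕ}

theorem initial (h1 : ∀ v, head v ≠ 0 → head v - 1 ∈ A ∧ src (head v - 1) = v)
    (h2 : ∀ e ∈ A, e < head (src e)) (h3 : ∀ v, lab v = 0) :
    DfsInv A src tgt nr rt head lab stk ord nr 0 0 lb where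
  head_ok := h1
  scanned e he h := absurd (h2 e he) (by omega)
  lab_iff v := by simp [h3]
  stk_inj j hj := by omega
  ord_inj j hj := by omega
  disj j hj := by omega
  ord_head j hj := by omega
  stk_reach j j' h h' := by omega
  stk_root h := by omega
  lab_spec v hv := absurd (h3 v) hv
  done i' h h' := by omega
  cur h := by omega
  ord_spec j hj := by omega

/-- When the stack is empty, all labelled vertices are finished and their lists exhausted, so every
edge out of them has been scanned. -/
theorem closed (h : DfsInv A src tgt nr rt head lab stk ord i 0 n lb) {u v : ℕ} (hu : lab u ≠ 0)
    (hr : Reach src tgt A u v) : lab v ≠ 0 := by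
  induction hr with
  | refl => exact hu
  | tail _ hstep ih =>
    obtain ⟨e, he, rfl, rfl⟩ := hstep
    obtain ⟨j, hj, -⟩ | ⟨j, hj, hje⟩ := (h.lab_iff _).1 ih
    · omega
    · exact h.scanned e he (by rw [← hje, h.ord_head j hj]; omega)

theorem done' (h : DfsInv A src tgt nr rt head lab stk ord (i + 1) 0 n lb) :
    ∀ i', i < i' → i' < nr → ∀ v, Reach src tgt A (rt i') v → lab v ≠ 0 := by
  intro i' h1 h2 v hv
  rcases Nat.lt_or_ge (i + 1) i' with h3 | h3
  · exact h.done i' h3 h2 v hv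
  · obtain rfl : i' = i + 1 := by omega
    exact h.closed (h.cur h2) hv

theorem root_skip (h : DfsInv A src tgt nr rt head lab stk ord (i + 1) 0 n lb)
    (hl : lab (rt i) ≠ 0) : DfsInv A src tgt nr rt head lab stk ord i 0 n lb :=
  { h with
    stk_root := fun h => by omega
    lab_spec := fun v hv => by
      obtain ⟨i', h1, h2⟩ := h.lab_spec v hv
      exact ⟨i', by omega, h2⟩
    done := h.done'
    cur := fun _ => hl }

theorem root_push (h : DfsInv A src tgt nr rt head lab stk ord (i + 1) 0 n lb) (hi : i < nr)
    (hl : lab (rt i) = 0) :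
    DfsInv A src tgt nr rt head (Function.update lab (rt i) (rt i + 1))
      (Function.update stk 0 (rt i)) ord i 1 n (rt i + 1) := by
  have hup : ∀ v, lab v ≠ 0 → Function.update lab (rt i) (rt i + 1) v ≠ 0 := by
    intro v hv
    rw [Function.update_apply]
    split_ifs <;> omega
  constructor
  · exact h.head_ok
  · exact fun e he hh => hup _ (h.scanned e he hh)
  · intro v
    by_cases hv : v = rt i
    · subst hv
      simp only [Function.update_self]
      exact ⟨fun _ => Or.inl ⟨0, by omega, by simp⟩, fun _ => by omega⟩
    · rw [Function.update_of_ne hv, h.lab_iff]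
      constructor
      · rintro (⟨j, hj, -⟩ | hj)
        · omega
        · exact Or.inr hj
      · rintro (⟨j, hj, hjv⟩ | hj)
        · obtain rfl : j = 0 := by omega
          simp at hjv
          exact absurd hjv.symm hv
        · exact Or.inr hj
  · intro j hj j' hj' _; omega
  · exact h.ord_inj
  · intro j hj j' hj' hjj
    obtain rfl : j = 0 := by omega
    rw [Function.update_self] at hjj
    exact (h.lab_iff _).2 (Or.inr ⟨j', hj', hjj.symm⟩) hl
  · exact h.ord_head
  · intro j j' h1 h2
    obtain rfl : j = j' := by omega
    exact .refl _
  · exact fun _ => ⟨hi, by simp, rfl⟩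
  · intro v hv
    by_cases hvi : v = rt i
    · subst hvi
      exact ⟨i, le_rfl, hi, by simp, .refl _, fun j h1 h2 hr => h.done' j h1 h2 _ hr hl⟩
    · rw [Function.update_of_ne hvi] at hv ⊢
      obtain ⟨i', h1, h2⟩ := h.lab_spec v hv
      exact ⟨i', by omega, h2⟩
  · exact fun i' h1 h2 v hv => hup _ (h.done' i' h1 h2 v hv)
  · intro _; simp
  · exact h.ord_spec

/-- The point is `ord_spec` for the top of the stack. All vertices on the stack reach the top. If
the target of an edge out of the top does not lead back to it, then no path from that target meets
the stack, and by induction along paths all that is reachable from there is finished already. -/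
theorem finish (h : DfsInv A src tgt nr rt head lab stk ord i (sp + 1) n lb)
    (hh : head (stk sp) = 0) :
    DfsInv A src tgt nr rt head lab stk (Function.update ord n (stk sp)) i sp (n + 1) lb := by
  have hord : ∀ j < n, Function.update ord n (stk sp) j = ord j :=
    fun j hj => Function.update_of_ne (by omega) _ _
  constructor
  · exact h.head_ok
  · exact h.scanned
  · intro v
    rw [h.lab_iff]
    constructor
    · rintro (⟨j, hj, hjv⟩ | ⟨j, hj, hjv⟩)
      · rcases Nat.lt_succ_iff_lt_or_eq.1 hj with h1 | rfl
        · exact Or.inl ⟨j, h1, hjv⟩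
        · exact Or.inr ⟨n, by omega, by simpa using hjv⟩
      · exact Or.inr ⟨j, by omega, by rw [hord j hj, hjv]⟩
    · rintro (⟨j, hj, hjv⟩ | ⟨j, hj, hjv⟩)
      · exact Or.inl ⟨j, by omega, hjv⟩
      · rcases Nat.lt_succ_iff_lt_or_eq.1 hj with h1 | rfl
        · exact Or.inr ⟨j, h1, by rw [← hjv, hord j h1]⟩
        · exact Or.inl ⟨sp, by omega, by simpa using hjv⟩
  · exact fun j hj j' hj' => h.stk_inj j (by omega) j' (by omega)
  · intro j hj j' hj' hjj
    rcases Nat.lt_succ_iff_lt_or_eq.1 hj with h1 | h1 <;>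
      rcases Nat.lt_succ_iff_lt_or_eq.1 hj' with h2 | h2
    · rw [hord j h1, hord j' h2] at hjj; exact h.ord_inj j h1 j' h2 hjj
    · subst h2
      rw [hord j h1, Function.update_self] at hjj
      exact absurd hjj.symm (h.disj sp (by omega) j h1)
    · subst h1
      rw [hord j' h2, Function.update_self] at hjj
      exact absurd hjj (h.disj sp (by omega) j' h2)
    · omega
  · intro j hj j' hj' hjj
    rcases Nat.lt_succ_iff_lt_or_eq.1 hj' with h2 | rfl
    · rw [hord j' h2] at hjj; exact h.disj j (by omega) j' h2 hjj
    · rw [Function.update_self] at hjj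
      have := h.stk_inj j (by omega) sp (by omega) hjj
      omega
  · intro j hj
    rcases Nat.lt_succ_iff_lt_or_eq.1 hj with h1 | rfl
    · rw [hord j h1]; exact h.ord_head j h1
    · rwa [Function.update_self]
  · exact fun j j' h1 h2 => h.stk_reach j j' h1 (by omega)
  · exact fun _ => h.stk_root (by omega)
  · exact h.lab_spec
  · exact h.done
  · exact h.cur
  · intro j hj e he hej
    rcases Nat.lt_succ_iff_lt_or_eq.1 hj with h1 | rfl
    · rw [hord j h1] at hej ⊢
      refine (h.ord_spec j h1 e he hej).imp id fun hz z hr => ?_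
      obtain ⟨j', hj', hjz⟩ := hz z hr
      exact ⟨j', hj', by rw [hord j' (by omega), hjz]⟩
    · rw [Function.update_self] at hej ⊢
      refine or_iff_not_imp_left.2 fun hnr => ?_
      have gray : ∀ z, (∃ j' < sp + 1, stk j' = z) → ¬ Reach src tgt A (tgt e) z := by
        rintro z ⟨j', hj', rfl⟩ hr
        exact hnr (hr.trans (h.stk_reach j' sp (by omega) (by omega)))
      have black : ∀ z, Reach src tgt A (tgt e) z → ∃ j' < j, ord j' = z := by
        intro z hr
        induction hr with
        | refl =>
          have := h.scanned e he (by rw [hej, hh]; omega)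
          exact ((h.lab_iff _).1 this).resolve_left fun hg => gray _ hg (.refl _)
        | tail h1 hstep ih =>
          obtain ⟨f, hf, rfl, rfl⟩ := hstep
          obtain ⟨j', hj', hjf⟩ := ih
          have := h.scanned f hf (by rw [← hjf, h.ord_head j' hj']; omega)
          exact ((h.lab_iff _).1 this).resolve_left fun hg => gray _ hg
            (Reach.trans h1 (.of_mem hf))
      intro z hr
      obtain ⟨j', hj', hjz⟩ := black z hr
      exact ⟨j', hj', by rw [hord j' hj', hjz]⟩

/-- Roots of larger index have been treated, and all that they reach is labelled. An unlabelled
target is therefore reachable from none of them, which gives the maximality in `lab_spec`. -/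
theorem push (h : DfsInv A src tgt nr rt head lab stk ord i (sp + 1) n lb) {e : ℕ} (he : e ∈ A)
    (hs : src e = stk sp) (hl : lab (tgt e) = 0) :
    DfsInv A src tgt nr rt head (Function.update lab (tgt e) lb)
      (Function.update stk (sp + 1) (tgt e)) ord i (sp + 2) n lb := by
  obtain ⟨hi, h0, hlb⟩ := h.stk_root (by omega)
  have hup : ∀ v, lab v ≠ 0 → Function.update lab (tgt e) lb v ≠ 0 := by
    intro v hv
    rw [Function.update_apply]
    split_ifs <;> omega
  have hstk : ∀ j < sp + 1, Function.update stk (sp + 1) (tgt e) j = stk j :=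
    fun j hj => Function.update_of_ne (by omega) _ _
  have hnew : ∀ j < sp + 1, stk j ≠ tgt e :=
    fun j hj hjj => (h.lab_iff _).2 (Or.inl ⟨j, hj, hjj⟩) hl
  have hreach : ∀ j < sp + 1, Reach src tgt A (stk j) (tgt e) :=
    fun j hj => (h.stk_reach j sp (by omega) (by omega)).trans (hs ▸ .of_mem he)
  constructor
  · exact h.head_ok
  · exact fun e he hh => hup _ (h.scanned e he hh)
  · intro v
    by_cases hv : v = tgt e
    · subst hv
      simp only [Function.update_self]
      exact ⟨fun _ => Or.inl ⟨sp + 1, by omega, by simp⟩, fun _ => by omega⟩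
    · rw [Function.update_of_ne hv, h.lab_iff]
      constructor
      · rintro (⟨j, hj, hjv⟩ | hj)
        · exact Or.inl ⟨j, by omega, by rw [hstk j hj, hjv]⟩
        · exact Or.inr hj
      · rintro (⟨j, hj, hjv⟩ | hj)
        · rcases Nat.lt_succ_iff_lt_or_eq.1 hj with h1 | rfl
          · exact Or.inl ⟨j, h1, by rw [← hjv, hstk j h1]⟩
          · rw [Function.update_self] at hjv
            exact absurd hjv.symm hv
        · exact Or.inr hj
  · intro j hj j' hj' hjj
    rcases Nat.lt_succ_iff_lt_or_eq.1 hj with h1 | h1 <;>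
      rcases Nat.lt_succ_iff_lt_or_eq.1 hj' with h2 | h2
    · rw [hstk j h1, hstk j' h2] at hjj; exact h.stk_inj j h1 j' h2 hjj
    · subst h2
      rw [hstk j h1, Function.update_self] at hjj
      exact absurd hjj (hnew j h1)
    · subst h1
      rw [hstk j' h2, Function.update_self] at hjj
      exact absurd hjj.symm (hnew j' h2)
    · omega
  · exact h.ord_inj
  · intro j hj j' hj' hjj
    rcases Nat.lt_succ_iff_lt_or_eq.1 hj with h1 | rfl
    · rw [hstk j h1] at hjj; exact h.disj j h1 j' hj' hjj
    · rw [Function.update_self] at hjj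
      exact (h.lab_iff _).2 (Or.inr ⟨j', hj', hjj.symm⟩) hl
  · exact h.ord_head
  · intro j j' h1 h2
    rcases Nat.lt_succ_iff_lt_or_eq.1 h2 with h3 | rfl
    · rw [hstk j (by omega), hstk j' h3]; exact h.stk_reach j j' h1 h3
    · rw [Function.update_self]
      rcases Nat.lt_or_ge j (sp + 1) with h3 | h3
      · rw [hstk j h3]; exact hreach j h3
      · obtain rfl : j = sp + 1 := by omega
        rw [Function.update_self]; exact .refl _
  · exact fun _ => ⟨hi, by rw [hstk 0 (by omega), h0], hlb⟩
  · intro v hv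
    by_cases hve : v = tgt e
    · subst hve
      refine ⟨i, le_rfl, hi, by rw [Function.update_self, hlb], h0 ▸ hreach 0 (by omega),
        fun j h1 h2 hr => h.done j h1 h2 _ hr hl⟩
    · rw [Function.update_of_ne hve] at hv ⊢
      exact h.lab_spec v hv
  · exact fun i' h1 h2 v hv => hup _ (h.done i' h1 h2 v hv)
  · exact fun hi => hup _ (h.cur hi)
  · exact h.ord_spec

/-- The head edge may be dropped once its target is labelled: by `Linked.next` no edge with source
`v` lies between the new head and the dropped one, so none is skipped unscanned. -/
theorem pop (h : DfsInv A src tgt nr rt head lab stk ord i sp n lb) (hx : Linked A src nx) {v : ℕ}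
    (hv : head v ≠ 0) (hl : lab (tgt (head v - 1)) ≠ 0) :
    DfsInv A src tgt nr rt (Function.update head v (nx (head v - 1))) lab stk ord i sp n lb := by
  obtain ⟨hA, hsv⟩ := h.head_ok v hv
  refine { h with head_ok := ?_, scanned := ?_, ord_head := ?_ }
  · intro w hw
    by_cases hwv : w = v
    · subst hwv
      rw [Function.update_self] at hw ⊢
      have := hx.mem _ hA hw
      rwa [hsv] at this
    · rw [Function.update_of_ne hwv] at hw ⊢
      exact h.head_ok w hw
  · intro e he hle
    by_cases hev : src e = v
    · rw [hev, Function.update_self] at hle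
      rcases lt_trichotomy e (head v - 1) with h1 | h1 | h1
      · have := hx.next _ hA e he (by rw [hev, hsv]) h1
        omega
      · rwa [h1]
      · exact h.scanned e he (by rw [hev]; omega)
    · rw [Function.update_of_ne hev] at hle
      exact h.scanned e he hle
  · intro j hj
    rw [Function.update_of_ne, h.ord_head j hj]
    rintro rfl
    exact hv (h.ord_head j hj)

theorem result (h : DfsInv A src tgt nr rt head lab stk ord 0 0 n lb) :
    DfsResult A src tgt nr rt lab n ord where
  lab_iff v := by
    constructor
    · intro hv
      obtain ⟨i, -, h1, -, h2, -⟩ := h.lab_spec v hv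
      exact ⟨i, h1, h2⟩
    · rintro ⟨i, hi, hr⟩
      rcases Nat.eq_zero_or_pos i with rfl | h0
      · exact h.closed (h.cur hi) hr
      · exact h.done i h0 hi v hr
  lab_spec v hv := by
    obtain ⟨i, -, h1⟩ := h.lab_spec v hv
    exact ⟨i, h1⟩
  ord_iff v := by
    rw [h.lab_iff]
    simp
  ord_inj := h.ord_inj
  ord_spec := h.ord_spec

end DfsInv

/-- Because of the offset of one, `nx e ≤ e` means that links point strictly down. The head edge
leaves the pending set and no edge enters it; this drives the termination of the search. -/
theorem ncard_pending_update {A : Set ℕ} {src nx head : ℕ → ℕ} (hA : A.Finite)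
    (hx : Linked A src nx) {v : ℕ} (hv : head v ≠ 0) (hm : head v - 1 ∈ A)
    (hs : src (head v - 1) = v) :
    (pending A src (Function.update head v (nx (head v - 1)))).ncard <
      (pending A src head).ncard := by
  refine Set.ncard_lt_ncard ⟨?_, ?_⟩ (hA.subset fun e he => he.1)
  · rintro e ⟨he, hlt⟩
    refine ⟨he, ?_⟩
    have := hx.le _ hm
    by_cases hev : src e = v
    · rw [hev, Function.update_self] at hlt
      rw [hev]
      omega
    · rwa [Function.update_of_ne hev] at hlt
  · intro hsub
    have := hx.le _ hm
    have h1 : head v - 1 ∈ pending A src head := ⟨hm, by rw [hs]; omega⟩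
    have h2 := (hsub h1).2
    rw [hs, Function.update_self] at h2
    omega

end EdgeGraph

/-! ### Programs for strongly connected components -/

namespace EdgeGraph

/-- The lists starting at `head` and linked by `nx` contain exactly the edges in `A`. -/
structure Adj (A : Set ℕ) (src nx head : ℕ → ℕ) : Prop where
  linked : Linked A src nx
  head_ok : ∀ v, head v ≠ 0 → head v - 1 ∈ A ∧ src (head v - 1) = v
  lt_head : ∀ e ∈ A, e < head (src e)

theorem Adj.empty {src nx head : ℕ → ℕ} (h : ∀ v, head v = 0) : Adj ∅ src nx head :=
  ⟨⟨by simp, by simp, by simp⟩, fun v hv => absurd (h v) hv, by simp⟩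

/-- The new edge exceeds all earlier ones and is put at the front, which keeps the lists decreasing.
-/
theorem Adj.insert {A : Set ℕ} {src nx head : ℕ → ℕ} (h : Adj A src nx head) {x : ℕ}
    (hx : ∀ e ∈ A, e < x) :
    Adj (insert x A) src (Function.update nx x (head (src x)))
      (Function.update head (src x) (x + 1)) := by
  have hxA : ∀ e ∈ A, e ≠ x := fun e he => (hx e he).ne
  have hle : ∀ v, head v ≤ x := by
    intro v
    by_contra hcon
    have := hx _ (h.head_ok v (by omega)).1
    omega
  refine ⟨⟨?_, ?_, ?_⟩, ?_, ?_⟩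
  · rintro e (rfl | he) hne
    · rw [Function.update_self] at *
      obtain ⟨h1, h2⟩ := h.head_ok _ hne
      exact ⟨Or.inr h1, h2⟩
    · rw [Function.update_of_ne (hxA e he)] at *
      obtain ⟨h1, h2⟩ := h.linked.mem e he hne
      exact ⟨Or.inr h1, h2⟩
  · rintro e (rfl | he)
    · rw [Function.update_self]; exact hle _
    · rw [Function.update_of_ne (hxA e he)]; exact h.linked.le e he
  · rintro e (rfl | he) e' (rfl | he') hs hlt
    · omega
    · rw [Function.update_self, ← hs]; exact h.lt_head e' he'
    · have := hx e he; omega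
    · rw [Function.update_of_ne (hxA e he)]; exact h.linked.next e he e' he' hs hlt
  · intro v hv
    by_cases hvx : v = src x
    · subst hvx; simp
    · rw [Function.update_of_ne hvx] at *
      obtain ⟨h1, h2⟩ := h.head_ok v hv
      exact ⟨Or.inr h1, h2⟩
  · rintro e (rfl | he)
    · simp
    · by_cases hse : src e = src x
      · have := hx e he
        rw [hse, Function.update_self]; omega
      · rw [Function.update_of_ne hse]; exact h.lt_head e he

theorem reach_congr {A : Set ℕ} {src tgt src' tgt' : ℕ → ℕ}
    (h : ∀ e ∈ A, src e = src' e ∧ tgt e = tgt' e) : Reach src tgt A = Reach src' tgt' A := by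
  unfold Reach
  congr 1
  ext u v
  refine exists_congr fun e => and_congr_right fun he => ?_
  rw [(h e he).1, (h e he).2]

/-- The arrays of the program agree with the graph only on actual edges and roots, so results have
to be transferred between functions that agree there. -/
theorem DfsResult.congr {A : Set ℕ} {src tgt src' tgt' rt rt' lab ord : ℕ → ℕ} {nr n : ℕ}
    (hA : ∀ e ∈ A, src e = src' e ∧ tgt e = tgt' e) (hr : ∀ i < nr, rt i = rt' i)
    (h : DfsResult A src tgt nr rt lab n ord) : DfsResult A src' tgt' nr rt' lab n ord := by
  obtain ⟨h1, h2, h3, h4, h5⟩ := h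
  rw [reach_congr hA] at h1 h2 h5
  refine ⟨fun v => ?_, fun v hv => ?_, h3, h4, fun j hj e he hs => ?_⟩
  · rw [h1]
    exact exists_congr fun i => and_congr_right fun hi => by rw [hr i hi]
  · obtain ⟨i, hi, a, b, c⟩ := h2 v hv
    exact ⟨i, hi, hr i hi ▸ a, hr i hi ▸ b, fun j hij hj => hr j hj ▸ c j hij hj⟩
  · rw [← (hA e he).2]
    exact h5 j hj e he (by rw [(hA e he).1, hs])

/-- Shows that a search labels only roots and ends of edges, as needed to preserve `Clean`. -/
theorem Reach.eq_or_exists {A : Set ℕ} {src tgt : ℕ → ℕ} {u v : ℕ} (h : Reach src tgt A u v) :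
    u = v ∨ ∃ e ∈ A, tgt e = v := by
  cases h with
  | refl => exact Or.inl rfl
  | tail _ h =>
    obtain ⟨e, he, -, h⟩ := h
    exact Or.inr ⟨e, he, h⟩

end EdgeGraph

/-! ### Depth-first search as a program -/

namespace EmptinessProgram

open WhileLang EdgeGraph

/-- Depth-first search. Variables: `9` number of roots, `10` next root, `11` height of the stack,
`12` number of finished vertices, `13` label, `14` and `15` scratch. Arrays: `5` ends of edges,
`6` heads of lists, `7` links, `8` labels, `9` stack, `10` finished vertices, `11` roots. -/
def searchBody : Cmd :=
  .ite (.var 11)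
    (.set 14 (.arr 9 (.sub (.var 11) (.lit 1))) ;;
      .ite (.arr 6 (.var 14))
        (.set 15 (.arr 5 (.sub (.arr 6 (.var 14)) (.lit 1))) ;;
          .put 6 (.var 14) (.arr 7 (.sub (.arr 6 (.var 14)) (.lit 1))) ;;
          .ite (.arr 8 (.var 15)) .skip
            (.put 8 (.var 15) (.var 13) ;; .put 9 (.var 11) (.var 15) ;;
              .set 11 (.add (.var 11) (.lit 1))))
        (.put 10 (.var 12) (.var 14) ;; .set 12 (.add (.var 12) (.lit 1)) ;;
          .set 11 (.sub (.var 11) (.lit 1))))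
    (.set 10 (.sub (.var 10) (.lit 1)) ;; .set 15 (.arr 11 (.var 10)) ;;
      .ite (.arr 8 (.var 15)) .skip
        (.set 13 (.add (.var 15) (.lit 1)) ;; .put 8 (.var 15) (.var 13) ;;
          .put 9 (.lit 0) (.var 15) ;; .set 11 (.lit 1)))

/-- Depth-first search; see `searchBody` for the variables and arrays. -/
def search : Cmd :=
  .set 10 (.var 9) ;; .set 11 (.lit 0) ;; .set 12 (.lit 0) ;;
    .loop (.add (.var 10) (.var 11)) searchBody

/-- The invariant of depth-first search in terms of the state of the program. -/
structure SearchInv (A : Set ℕ) (s₀ s : State) : Prop where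
  agree : Agree search s₀ s
  inv : DfsInv A (s₀.a 4) (s₀.a 5) (s₀.v 9) (s₀.a 11) (s.a 6) (s.a 8) (s.a 9) (s.a 10)
    (s.v 10) (s.v 11) (s.v 12) (s.v 13)
  le : s.v 10 ≤ s₀.v 9
  count : s.v 12 + s.v 11 + s.v 10 + (pending A (s₀.a 4) (s.a 6)).ncard ≤ s₀.v 9 + A.ncard

/-- The potential of depth-first search. -/
noncomputable def searchPotential (A : Set ℕ) (s₀ s : State) : ℕ :=
  2 * (s.v 10 + (pending A (s₀.a 4) (s.a 6)).ncard) + s.v 11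

theorem _root_.WhileLang.Agree.trans {c : Cmd} {s s' s'' : State} (h : Agree c s s')
    (h' : Agree c s' s'') :
    Agree c s s'' :=
  ⟨fun y hy => (h'.v y hy).trans (h.v y hy), fun b hb => (h'.a b hb).trans (h.a b hb)⟩

/-- Taking a root or scanning an edge lowers the doubled part of the potential and pushes at most
one vertex; finishing a vertex lowers the stack. No step increases the sum in `count`, which
therefore bounds the finished vertices by roots plus edges. -/
theorem searchBody_step {X : ℕ → ℕ} {A : Set ℕ} {s₀ s : State} (hA : A.Finite)
    (hl : Linked A (s₀.a 4) (s₀.a 7)) (h : SearchInv A s₀ s) (hne : s.v 10 + s.v 11 ≠ 0) :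
    SearchInv A s₀ (searchBody.run X s) ∧
      searchPotential A s₀ (searchBody.run X s) < searchPotential A s₀ s := by
  obtain ⟨hag, hinv, hle, hcount⟩ := h
  have hag' : Agree search s₀ (searchBody.run X s) := by
    obtain ⟨t, s', h1, -, rfl⟩ := Runs.of_simple (X := X) (c := searchBody) (s := s)
      (Q := fun s' => s' = searchBody.run X s) rfl rfl
    have := h1.agree
    refine hag.trans ⟨fun y hy => this.v y fun hc => hy ?_, fun y hy => this.a y fun hc => hy ?_⟩
    · simp only [search, Cmd.wv, List.mem_append]; simp [hc]
    · simp only [search, Cmd.wa, List.mem_append]; simp [hc]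
  have a5 : s.a 5 = s₀.a 5 := hag.a 5 (by decide)
  have a7 : s.a 7 = s₀.a 7 := hag.a 7 (by decide)
  have a11 : s.a 11 = s₀.a 11 := hag.a 11 (by decide)
  by_cases h11 : s.v 11 = 0
  · obtain ⟨i, hi⟩ : ∃ i, s.v 10 = i + 1 := ⟨s.v 10 - 1, by omega⟩
    rw [h11, hi] at hinv
    rw [h11, hi] at hcount
    by_cases hlab : s.a 8 (s₀.a 11 i) = 0
    · have := hinv.root_push (by omega) hlab
      have e : searchBody.run X s = (((((s.setv 10 i).setv 15 (s₀.a 11 i)).setv 13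
          (s₀.a 11 i + 1)).seta 8 (s₀.a 11 i) (s₀.a 11 i + 1)).seta 9 0 (s₀.a 11 i)).setv 11 1 := by
        simp [searchBody, Cmd.run, Expr.eval, h11, hi, hlab, a11]
      rw [e] at hag' ⊢
      refine ⟨⟨hag', ?_, ?_, ?_⟩, ?_⟩
      · simpa using this
      · simp; omega
      · simp; omega
      · simp [searchPotential, h11, hi]; omega
    · have := hinv.root_skip hlab
      have e : searchBody.run X s = (s.setv 10 i).setv 15 (s₀.a 11 i) := by
        simp [searchBody, Cmd.run, Expr.eval, h11, hi, hlab, a11]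
      rw [e] at hag' ⊢
      refine ⟨⟨hag', ?_, ?_, ?_⟩, ?_⟩
      · simpa [h11] using this
      · simp; omega
      · simp [h11]; omega
      · simp [searchPotential, h11, hi]
  · obtain ⟨sp, hsp⟩ : ∃ sp, s.v 11 = sp + 1 := ⟨s.v 11 - 1, by omega⟩
    rw [hsp] at hinv
    rw [hsp] at hcount
    by_cases hhead : s.a 6 (s.a 9 sp) = 0
    · have := hinv.finish hhead
      have e : searchBody.run X s = (((s.setv 14 (s.a 9 sp)).seta 10 (s.v 12) (s.a 9 sp)).setv 12
          (s.v 12 + 1)).setv 11 sp := by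
        simp [searchBody, Cmd.run, Expr.eval, hsp, hhead]
      rw [e] at hag' ⊢
      refine ⟨⟨hag', ?_, ?_, ?_⟩, ?_⟩
      · simpa using this
      · simpa using hle
      · simp; omega
      · simp [searchPotential, hsp]
    · obtain ⟨hm, hs⟩ := hinv.head_ok _ hhead
      have hlt := ncard_pending_update hA hl hhead hm hs
      set v := s.a 9 sp with hv
      by_cases hlab : s.a 8 (s₀.a 5 (s.a 6 v - 1)) = 0
      -- The program advances the list first, with the same final state. Here the push comes first,
      -- since `pop` requires a labelled target.
      · have h1 := hinv.push hm hs hlab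
        have hlb := (hinv.stk_root (by omega)).2.2
        have := h1.pop hl hhead (by rw [Function.update_self]; omega)
        have e : searchBody.run X s = (((((s.setv 14 v).setv 15 (s₀.a 5 (s.a 6 v - 1))).seta 6 v
            (s₀.a 7 (s.a 6 v - 1))).seta 8 (s₀.a 5 (s.a 6 v - 1)) (s.v 13)).seta 9 (sp + 1)
            (s₀.a 5 (s.a 6 v - 1))).setv 11 (sp + 2) := by
          simp [searchBody, Cmd.run, Expr.eval, hsp, ← hv, hhead, hlab, a5, a7]
        rw [e] at hag' ⊢
        refine ⟨⟨hag', ?_, ?_, ?_⟩, ?_⟩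
        · simpa using this
        · simpa using hle
        · simp; omega
        · simp [searchPotential, hsp]; omega
      · have := hinv.pop hl hhead hlab
        have e : searchBody.run X s = ((s.setv 14 v).setv 15 (s₀.a 5 (s.a 6 v - 1))).seta 6 v
            (s₀.a 7 (s.a 6 v - 1)) := by
          simp [searchBody, Cmd.run, Expr.eval, hsp, ← hv, hhead, hlab, a5, a7]
        rw [e] at hag' ⊢
        refine ⟨⟨hag', ?_, ?_, ?_⟩, ?_⟩
        · simpa [hsp] using this
        · simpa using hle
        · simp [hsp]; omega
        · simp [searchPotential, hsp]; omega

/-- The initial potential is at most twice the number of roots and edges; the number of vertices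
does not enter. The last clause is used to restore `Clean`. -/
theorem search_runs {X : ℕ → ℕ} {A : Set ℕ} {s : State} (hA : A.Finite)
    (hadj : Adj A (s.a 4) (s.a 7) (s.a 6)) (hlab : ∀ v, s.a 8 v = 0) :
    Runs X search s (2 * search.len * (s.v 9 + A.ncard + 1)) fun s' =>
      DfsResult A (s.a 4) (s.a 5) (s.v 9) (s.a 11) (s'.a 8) (s'.v 12) (s'.a 10) ∧
      s'.v 12 ≤ s.v 9 + A.ncard ∧ ∀ v, s'.a 6 v ≠ 0 → ∃ e ∈ A, s.a 4 e = v := by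
  set s1 := ((s.setv 10 (s.v 9)).setv 11 0).setv 12 0 with hs1
  have hpend : (pending A (s.a 4) (s.a 6)).ncard ≤ A.ncard :=
    Set.ncard_le_ncard (fun e he => he.1) hA
  have hI : SearchInv A s s1 := by
    refine ⟨⟨fun y hy => ?_, fun b _ => rfl⟩, ?_, ?_, ?_⟩
    · simp only [search, Cmd.wv, List.mem_append, List.mem_singleton, not_or] at hy
      simp [hs1, hy]
    · have := DfsInv.initial (A := A) (src := s.a 4) (tgt := s.a 5) (nr := s.v 9) (rt := s.a 11)
        (stk := s.a 9) (ord := s.a 10) (lb := s.v 13) hadj.head_ok hadj.lt_head hlab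
      simpa [hs1] using this
    · simp [hs1]
    · simp [hs1]; omega
  have h1 : Runs X (.loop (.add (.var 10) (.var 11)) searchBody) s1 _ _ :=
    Runs.loop (I := SearchInv A s) (searchPotential A s)
      (fun s' hs' he => Runs.of_simple rfl (searchBody_step hA hadj.linked hs' he)) hI
  refine Runs.mono (Runs.seq (Runs.of_simple (Q := fun s' => s' = s.setv 10 (s.v 9)) rfl rfl)
    fun s' _ hs' => Runs.seq (Runs.of_simple (Q := fun s' => s' = (s.setv 10 (s.v 9)).setv 11 0) rfl
      (by rw [hs']; rfl)) fun s' _ hs' =>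
        Runs.seq (Runs.of_simple (Q := fun s' => s' = s1) rfl (by rw [hs']; rfl))
          fun s' _ hs' => by rw [hs']; exact h1) ?_ ?_
  · have : searchPotential A s s1 + 1 ≤ 2 * (s.v 9 + A.ncard) + 1 := by
      simp [searchPotential, hs1]; omega
    have h2 := Nat.mul_le_mul_left (searchBody.len + (Expr.add (.var 10) (.var 11)).len + 2) this
    have h3 : search.len = 6 + (searchBody.len + (Expr.add (.var 10) (.var 11)).len + 2) := by
      simp [search, Cmd.len, Expr.len]; omega
    rw [h3]
    simp only [Cmd.len, Expr.len] at *
    nlinarith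
  · rintro s' - ⟨⟨-, hinv, -, hcount⟩, he⟩
    simp only [Expr.eval] at he
    have e10 : s'.v 10 = 0 := by omega
    have e11 : s'.v 11 = 0 := by omega
    rw [e10, e11] at hinv
    exact ⟨hinv.result, by omega, fun v hv => ⟨_, hinv.head_ok v hv⟩⟩

end EmptinessProgram

/-! ### Adjacency lists and Kosaraju's algorithm as programs -/

namespace EmptinessProgram

open WhileLang EdgeGraph

/-- Reset the lists and labels of all ends of edges. -/
def resetLists : Cmd :=
  .forLoop 5 1 (.put 6 (.arr 4 (.var 5)) (.lit 0) ;; .put 6 (.arr 5 (.var 5)) (.lit 0) ;;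
    .put 8 (.arr 4 (.var 5)) (.lit 0) ;; .put 8 (.arr 5 (.var 5)) (.lit 0))

/-- Insert the edges marked in array `3` into the lists of their sources. -/
def linkEdges : Cmd :=
  .forLoop 5 1 (.ite (.arr 3 (.var 5))
    (.put 7 (.var 5) (.arr 6 (.arr 4 (.var 5))) ;;
      .put 6 (.arr 4 (.var 5)) (.add (.var 5) (.lit 1))) .skip)

/-- The marked edges. -/
def alive (s : State) : Set ℕ := {e | e < s.v 1 ∧ s.a 3 e ≠ 0}

theorem alive_finite (s : State) : (alive s).Finite :=
  (Set.finite_lt_nat (s.v 1)).subset fun _ he => he.1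

theorem alive_ncard_le (s : State) : (alive s).ncard ≤ s.v 1 := by
  refine (Set.ncard_le_ncard (t := {e | e < s.v 1}) (fun _ he => he.1)
    (Set.finite_lt_nat _)).trans ?_
  rw [show {e | e < s.v 1} = Set.Iio (s.v 1) from rfl, Set.ncard_eq_toFinset_card' (Set.Iio _)]
  simp

/-- Only ends of edges are reset, so that the cost depends on the edges and not on the states;
elsewhere the entries vanish by hypothesis. -/
theorem resetLists_runs {X : ℕ → ℕ} {s : State}
    (h : ∀ v, (∀ e < s.v 1, s.a 4 e ≠ v ∧ s.a 5 e ≠ v) → s.a 6 v = 0 ∧ s.a 8 v = 0) :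
    Runs X resetLists s (resetLists.len * (s.v 1 + 1)) fun s' =>
      ∀ v, s'.a 6 v = 0 ∧ s'.a 8 v = 0 := by
  refine Runs.mono (Runs.forLoop (x := 5) (N := 1) (fun x s' => ∀ v,
    (∀ e, x ≤ e → e < s.v 1 → s.a 4 e ≠ v ∧ s.a 5 e ≠ v) → s'.a 6 v = 0 ∧ s'.a 8 v = 0)
    (by decide) (by decide) (by decide) ?_ fun s' hag hlt hI => Runs.of_simple rfl ?_) le_rfl ?_
  · intro v hv; simpa using h v fun e he => hv e (Nat.zero_le _) he
  · intro v hv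
    have a4 : s'.a 4 = s.a 4 := hag.a 4 (by decide)
    have a5 : s'.a 5 = s.a 5 := hag.a 5 (by decide)
    simp only [Cmd.run, Expr.eval, State.setv_a, State.seta_a, State.seta_v, a4, a5]
    by_cases h1 : s.a 4 (s'.v 5) = v
    · simp [h1, Function.update_apply]
    · by_cases h2 : s.a 5 (s'.v 5) = v
      · simp [h2]
      · have := hI v fun e he he' => by
          rcases Nat.eq_or_lt_of_le he with rfl | h3
          · exact ⟨h1, h2⟩
          · exact hv e h3 he'
        simpa [Function.update_apply, Ne.symm h1, Ne.symm h2] using this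
  · intro s' _ hs' v
    exact hs' v fun e he he' => by omega

theorem linkEdges_runs {X : ℕ → ℕ} {s : State} (h : ∀ v, s.a 6 v = 0) :
    Runs X linkEdges s (linkEdges.len * (s.v 1 + 1)) fun s' =>
      Adj (alive s) (s.a 4) (s'.a 7) (s'.a 6) := by
  refine Runs.mono (Runs.forLoop (x := 5) (N := 1) (fun x s' => Adj
    {e | e < x ∧ s.a 3 e ≠ 0} (s.a 4) (s'.a 7) (s'.a 6))
    (by decide) (by decide) (by decide) ?_ fun s' hag hlt hI => Runs.of_simple rfl ?_) le_rfl ?_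
  · simpa using Adj.empty h
  · have a4 : s'.a 4 = s.a 4 := hag.a 4 (by decide)
    have a3 : s'.a 3 = s.a 3 := hag.a 3 (by decide)
    by_cases h3 : s.a 3 (s'.v 5) = 0
    · have : {e | e < s'.v 5 + 1 ∧ s.a 3 e ≠ 0} = {e | e < s'.v 5 ∧ s.a 3 e ≠ 0} := by
        ext e
        simp only [Set.mem_ofPred_eq]
        constructor
        · rintro ⟨h1, h2⟩
          exact ⟨lt_of_le_of_ne (by omega) (by rintro rfl; exact h2 h3), h2⟩
        · rintro ⟨h1, h2⟩; exact ⟨by omega, h2⟩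
      rw [this]
      simpa [Cmd.run, Expr.eval, a3, h3] using hI
    · have : {e | e < s'.v 5 + 1 ∧ s.a 3 e ≠ 0} =
          insert (s'.v 5) {e | e < s'.v 5 ∧ s.a 3 e ≠ 0} := by
        ext e
        simp only [Set.mem_ofPred_eq, Set.mem_insert_iff]
        constructor
        · rintro ⟨h1, h2⟩
          rcases Nat.lt_succ_iff_lt_or_eq.1 h1 with h | h
          · exact Or.inr ⟨h, h2⟩
          · exact Or.inl h
        · rintro (rfl | ⟨h1, h2⟩)
          · exact ⟨by omega, h3⟩
          · exact ⟨by omega, h2⟩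
      rw [this]
      simpa [Cmd.run, Expr.eval, a3, a4, h3] using hI.insert (x := s'.v 5) fun e he => he.1
  · exact fun s' _ hs' => hs'

/-- Search the graph of the marked edges. -/
def buildSearch : Cmd := resetLists ;; linkEdges ;; search

theorem buildSearch_runs {X : ℕ → ℕ} {s : State}
    (h : ∀ v, (∀ e < s.v 1, s.a 4 e ≠ v ∧ s.a 5 e ≠ v) → s.a 6 v = 0 ∧ s.a 8 v = 0) :
    Runs X buildSearch s (2 * buildSearch.len * (s.v 9 + s.v 1 + 1)) fun s' =>
      DfsResult (alive s) (s.a 4) (s.a 5) (s.v 9) (s.a 11) (s'.a 8) (s'.v 12) (s'.a 10) ∧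
      s'.v 12 ≤ s.v 9 + s.v 1 ∧ ∀ v, s'.a 6 v ≠ 0 → ∃ e ∈ alive s, s.a 4 e = v := by
  refine Runs.mono (Runs.seq (K' := linkEdges.len * (s.v 1 + 1) +
    2 * search.len * (s.v 9 + s.v 1 + 1)) (resetLists_runs h) fun s1 ag1 h1 => Runs.seq
    ((linkEdges_runs fun v => (h1 v).1).mono (by rw [ag1.v 1 (by decide)]) fun _ _ h => h)
    fun s2 ag2 h2 => (search_runs (alive_finite s1) (A := alive s1)
      (by rwa [ag2.a 4 (by decide)]) (fun v => by rw [ag2.a 8 (by decide)]; exact (h1 v).2)).mono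
      (Nat.mul_le_mul_left _ ?_) (fun s3 ag3 h3 => ?_)) ?_ (fun _ _ h => h)
  · rw [ag2.v 9 (by decide), ag1.v 9 (by decide)]
    have := alive_ncard_le s1
    rw [ag1.v 1 (by decide)] at this
    omega
  · have hal : alive s1 = alive s := by
      simp only [alive, ag1.v 1 (by decide), ag1.a 3 (by decide)]
    have hn := alive_ncard_le s
    rw [hal, ag2.a 4 (by decide), ag2.a 5 (by decide), ag2.v 9 (by decide), ag2.a 11 (by decide),
      ag1.a 4 (by decide), ag1.a 5 (by decide), ag1.v 9 (by decide), ag1.a 11 (by decide)] at h3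
    exact ⟨h3.1, by omega, h3.2.2⟩
  · have e : buildSearch.len = resetLists.len + (linkEdges.len + search.len) := rfl
    rw [e]
    nlinarith [Nat.zero_le (resetLists.len * s.v 9), Nat.zero_le (linkEdges.len * s.v 9),
      Nat.zero_le (resetLists.len * s.v 1), Nat.zero_le (linkEdges.len * s.v 1)]

/-- No vertex other than the ends of edges has a list or a label. -/
def Clean (s : State) : Prop :=
  ∀ v, (∀ e < s.v 1, s.a 0 e ≠ v ∧ s.a 1 e ≠ v) → s.a 6 v = 0 ∧ s.a 8 v = 0

/-- Prepare a search with the sources of all edges as roots. -/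
def prepareForward : Cmd :=
  .forLoop 5 1 (.put 4 (.var 5) (.arr 0 (.var 5)) ;; .put 5 (.var 5) (.arr 1 (.var 5)) ;;
    .put 11 (.var 5) (.arr 0 (.var 5))) ;; .set 9 (.var 1)

/-- Reverse all edges. -/
def reverseEdges : Cmd :=
  .forLoop 5 1 (.put 4 (.var 5) (.arr 1 (.var 5)) ;; .put 5 (.var 5) (.arr 0 (.var 5)))

/-- Take the finished vertices as roots. -/
def copyRoots : Cmd := .forLoop 5 12 (.put 11 (.var 5) (.arr 10 (.var 5)))

/-- Prepare a backward search in reverse order of finishing. -/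
def prepareBackward : Cmd := reverseEdges ;; copyRoots ;; .set 9 (.var 12)

theorem prepareForward_runs {X : ℕ → ℕ} {s : State} :
    Runs X prepareForward s (prepareForward.len * (s.v 1 + 1)) fun s' =>
      (∀ e < s.v 1, s'.a 4 e = s.a 0 e ∧ s'.a 5 e = s.a 1 e ∧ s'.a 11 e = s.a 0 e) ∧
        s'.v 9 = s.v 1 := by
  refine Runs.mono (Runs.seq (Runs.forLoop (x := 5) (N := 1) (fun x s' => ∀ e < x,
    s'.a 4 e = s.a 0 e ∧ s'.a 5 e = s.a 1 e ∧ s'.a 11 e = s.a 0 e)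
    (by decide) (by decide) (by decide) ?_ fun s' hag hlt hI => Runs.of_simple rfl ?_)
    fun s1 ag1 h1 => Runs.of_simple
      (Q := fun s' => (∀ e < s.v 1, s'.a 4 e = s.a 0 e ∧ s'.a 5 e = s.a 1 e ∧ s'.a 11 e = s.a 0 e) ∧
        s'.v 9 = s.v 1) rfl ⟨h1, ?_⟩) ?_ (fun _ _ h => h)
  · intro e he; omega
  · intro e he
    have a0 : s'.a 0 = s.a 0 := hag.a 0 (by decide)
    have a1 : s'.a 1 = s.a 1 := hag.a 1 (by decide)
    simp only [Cmd.run, Expr.eval, State.setv_a, State.seta_a, State.seta_v, a0, a1]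
    by_cases h1 : e = s'.v 5
    · simp [h1]
    · simpa [Function.update_apply, h1] using hI e (by omega)
  · simp [Cmd.run, Expr.eval, ag1.v 1 (by decide)]
  · simp only [prepareForward, Cmd.forLoop, Cmd.len, Expr.len]
    nlinarith

theorem reverseEdges_runs {X : ℕ → ℕ} {s : State} :
    Runs X reverseEdges s (reverseEdges.len * (s.v 1 + 1)) fun s' =>
      ∀ e < s.v 1, s'.a 4 e = s.a 1 e ∧ s'.a 5 e = s.a 0 e := by
  refine Runs.mono (Runs.forLoop (x := 5) (N := 1) (fun x s' => ∀ e < x,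
    s'.a 4 e = s.a 1 e ∧ s'.a 5 e = s.a 0 e)
    (by decide) (by decide) (by decide) ?_ fun s' hag hlt hI => Runs.of_simple rfl ?_) le_rfl
    fun _ _ h => h
  · intro e he; omega
  · intro e he
    have a0 : s'.a 0 = s.a 0 := hag.a 0 (by decide)
    have a1 : s'.a 1 = s.a 1 := hag.a 1 (by decide)
    simp only [Cmd.run, Expr.eval, State.setv_a, State.seta_a, State.seta_v, a0, a1]
    by_cases h1 : e = s'.v 5
    · simp [h1]
    · simpa [Function.update_apply, h1] using hI e (by omega)

theorem copyRoots_runs {X : ℕ → ℕ} {s : State} :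
    Runs X copyRoots s (copyRoots.len * (s.v 12 + 1)) fun s' =>
      ∀ i < s.v 12, s'.a 11 i = s.a 10 i := by
  refine Runs.mono (Runs.forLoop (x := 5) (N := 12) (fun x s' => ∀ e < x, s'.a 11 e = s.a 10 e)
    (by decide) (by decide) (by decide) ?_ fun s' hag hlt hI => Runs.of_simple rfl ?_) le_rfl
    fun _ _ h => h
  · intro e he; omega
  · intro e he
    have a0 : s'.a 10 = s.a 10 := hag.a 10 (by decide)
    simp only [Cmd.run, Expr.eval, State.setv_a, State.seta_a, a0]
    by_cases h1 : e = s'.v 5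
    · simp [h1]
    · simpa [Function.update_apply, h1] using hI e (by omega)

theorem prepareBackward_runs {X : ℕ → ℕ} {s : State} :
    Runs X prepareBackward s (prepareBackward.len * (s.v 1 + s.v 12 + 1)) fun s' =>
      (∀ e < s.v 1, s'.a 4 e = s.a 1 e ∧ s'.a 5 e = s.a 0 e) ∧
        (∀ i < s.v 12, s'.a 11 i = s.a 10 i) ∧ s'.v 9 = s.v 12 := by
  refine Runs.mono (Runs.seq (K' := copyRoots.len * (s.v 12 + 1) + 2) reverseEdges_runs
    fun s1 ag1 h1 => Runs.seq (copyRoots_runs.mono ?_ fun _ _ h => h)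
    fun s2 ag2 h2 => Runs.of_simple rfl ⟨?_, ?_, ?_⟩) ?_ fun _ _ h => h
  · rw [ag1.v 12 (by decide)]
  rotate_left
  · intro e he
    have := h1 e he
    simpa [Cmd.run, ag2.a 4 (by decide), ag2.a 5 (by decide)] using this
  · intro i hi
    have := h2 i (by rwa [ag1.v 12 (by decide)])
    rw [ag1.a 10 (by decide)] at this
    simpa [Cmd.run] using this
  · simp [Cmd.run, Expr.eval, ag2.v 12 (by decide), ag1.v 12 (by decide)]
  · simp only [prepareBackward, Cmd.len, Expr.len]
    nlinarith [Nat.zero_le (reverseEdges.len * s.v 12), Nat.zero_le (copyRoots.len * s.v 1)]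

/-- Label the vertices by strongly connected components of the graph of the marked edges. -/
def sccLabels : Cmd := prepareForward ;; buildSearch ;; prepareBackward ;; buildSearch

/-- Kosaraju's algorithm: a search from the sources of all edges, then one in the reversed graph
with the finished vertices as roots, last finished first. `DfsResult.scc` reads off the components.
-/
theorem exists_sccLabels_runs : ∃ C, ∀ (X : ℕ → ℕ) (s : State), Clean s →
    Runs X sccLabels s (C * (s.v 1 + 1)) fun s' => Clean s' ∧
      ∀ u v, (∃ e ∈ alive s, s.a 0 e = u ∨ s.a 1 e = u) →
          (∃ e ∈ alive s, s.a 0 e = v ∨ s.a 1 e = v) →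
        (s'.a 8 u = s'.a 8 v ↔
          Reach (s.a 0) (s.a 1) (alive s) u v ∧ Reach (s.a 0) (s.a 1) (alive s) v u) := by
  refine ⟨prepareForward.len + 4 * buildSearch.len + 3 * prepareBackward.len + 6 * buildSearch.len,
    fun X s hc => ?_⟩
  obtain ⟨t1, s1, x1, k1, h1, h1'⟩ := prepareForward_runs (X := X) (s := s)
  have ag1 := x1.agree
  have e1 : s1.v 1 = s.v 1 := ag1.v 1 (by decide)
  have al1 : alive s1 = alive s := by simp only [alive, e1, ag1.a 3 (by decide)]
  obtain ⟨t2, s2, x2, k2, h2, h2', h2''⟩ := buildSearch_runs (X := X) (s := s1) fun v hv => by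
    rw [ag1.a 6 (by decide), ag1.a 8 (by decide)]
    refine hc v fun e he => ?_
    have := hv e (by rwa [e1])
    rwa [(h1 e he).1, (h1 e he).2.1] at this
  have ag2 := x2.agree
  have e2 : s2.v 1 = s.v 1 := (ag2.v 1 (by decide)).trans e1
  rw [al1, h1'] at h2
  rw [h1', e1] at h2' k2
  rw [al1] at h2''
  have d1 : DfsResult (alive s) (s.a 0) (s.a 1) (s.v 1) (s.a 0) (s2.a 8) (s2.v 12) (s2.a 10) :=
    h2.congr (fun e he => ⟨(h1 e he.1).1, (h1 e he.1).2.1⟩) fun i hi => (h1 i hi).2.2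
  obtain ⟨t3, s3, x3, k3, h3, h3', h3''⟩ := prepareBackward_runs (X := X) (s := s2)
  have ag3 := x3.agree
  have e3 : s3.v 1 = s.v 1 := (ag3.v 1 (by decide)).trans e2
  have al3 : alive s3 = alive s := by
    simp only [alive, e3, ag3.a 3 (by decide), ag2.a 3 (by decide), ag1.a 3 (by decide)]
  rw [e2, ag2.a 1 (by decide), ag1.a 1 (by decide), ag2.a 0 (by decide), ag1.a 0 (by decide)] at h3
  -- A labelled vertex is a root or a target, and the roots are sources; so labels appear only at
  -- ends of edges.
  have c1 : ∀ v, (∀ e < s.v 1, s.a 0 e ≠ v ∧ s.a 1 e ≠ v) → s2.a 8 v = 0 := by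
    intro v hv
    by_contra hcon
    obtain ⟨i, hi, hr⟩ := (d1.lab_iff v).1 hcon
    rcases hr.eq_or_exists with h | ⟨e, he, h⟩
    · exact (hv i hi).1 h
    · exact (hv e he.1).2 h
  obtain ⟨t4, s4, x4, k4, h4, -, h4''⟩ := buildSearch_runs (X := X) (s := s3) fun v hv => by
    have hv' : ∀ e < s.v 1, s.a 0 e ≠ v ∧ s.a 1 e ≠ v := fun e he => by
      have := hv e (by rwa [e3])
      rw [(h3 e he).1, (h3 e he).2] at this
      exact ⟨this.2, this.1⟩
    rw [ag3.a 6 (by decide), ag3.a 8 (by decide)]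
    refine ⟨?_, c1 v hv'⟩
    by_contra hcon
    obtain ⟨e, he, hev⟩ := h2'' v hcon
    rw [(h1 e he.1).1] at hev
    exact (hv' e he.1).1 hev
  have ag4 := x4.agree
  rw [al3] at h4 h4''
  rw [h3''] at h4 k4
  have d2 : DfsResult (alive s) (s.a 1) (s.a 0) (s2.v 12) (s2.a 10) (s4.a 8) (s4.v 12) (s4.a 10) :=
    h4.congr (fun e he => h3 e he.1) h3'
  have hs : ∀ e ∈ alive s, s2.a 8 (s.a 0 e) ≠ 0 := fun e he =>
    (d1.lab_iff _).2 ⟨e, he.1, .refl _⟩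
  have hcomp : ∀ u, (∃ e ∈ alive s, s.a 0 e = u ∨ s.a 1 e = u) → s4.a 8 u ≠ 0 := by
    rintro u ⟨e, he, hu⟩
    have : s2.a 8 u ≠ 0 := by
      rcases hu with rfl | rfl
      · exact hs e he
      · exact (d1.lab_iff _).2 ⟨e, he.1, .of_mem he⟩
    obtain ⟨j, hj, rfl⟩ := (d1.ord_iff u).2 this
    exact (d2.lab_iff _).2 ⟨j, hj, .refl _⟩
  refine ⟨_, s4, .seq x1 (.seq x2 (.seq x3 x4)), ?_, fun v hv => ⟨?_, ?_⟩,
    fun u v hu hv => d1.scc d2 hs (hcomp u hu) (hcomp v hv)⟩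
  -- The first search has one root per edge, so it finishes at most twice as many vertices as there
  -- are edges; these are the roots of the second.
  · have b2 : 2 * buildSearch.len * (s.v 1 + s.v 1 + 1) ≤ 4 * buildSearch.len * (s.v 1 + 1) := by
      nlinarith [Nat.zero_le (buildSearch.len * s.v 1)]
    have b3 : prepareBackward.len * (s2.v 1 + s2.v 12 + 1) ≤
        prepareBackward.len * (3 * (s.v 1 + 1)) := Nat.mul_le_mul_left _ (by omega)
    have b4 : 2 * buildSearch.len * (s2.v 12 + s3.v 1 + 1) ≤
        2 * buildSearch.len * (3 * (s.v 1 + 1)) := Nat.mul_le_mul_left _ (by omega)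
    nlinarith
  all_goals
    have hv' : ∀ e < s.v 1, s.a 0 e ≠ v ∧ s.a 1 e ≠ v := by
      have := (x1.seq (x2.seq (x3.seq x4))).agree
      rwa [this.v 1 (by decide), this.a 0 (by decide), this.a 1 (by decide)] at hv
    by_contra hcon
  · obtain ⟨e, he, hev⟩ := h4'' v hcon
    rw [(h3 e he.1).1] at hev
    exact (hv' e he.1).2 hev
  · obtain ⟨i, hi, hr⟩ := (d2.lab_iff v).1 hcon
    rcases hr.eq_or_exists with h | ⟨e, he, h⟩
    · exact (d1.ord_iff v).1 ⟨i, hi, h⟩ (c1 v hv')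
    · exact (hv' e he.1).1 h

end EmptinessProgram

/-! ### One round of refinement -/

namespace EdgeGraph

/-- `lab` labels the ends of the edges in `A` by strongly connected components. -/
def IsSccLabel (src tgt : ℕ → ℕ) (A : Set ℕ) (lab : ℕ → ℕ) : Prop :=
  ∀ u v, (∃ e ∈ A, src e = u ∨ tgt e = u) → (∃ e ∈ A, src e = v ∨ tgt e = v) →
    (lab u = lab v ↔ Reach src tgt A u v ∧ Reach src tgt A v u)

namespace IsSccLabel

variable {src tgt lab : ℕ → ℕ} {A B : Set ℕ} {k l : ℕ} {F : ℕ → Prop} {R G : ℕ → ℕ → Prop}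

theorem src_eq_src (h : IsSccLabel src tgt A lab) {e f : ℕ} (he : e ∈ A) (hf : f ∈ A) :
    lab (src e) = lab (src f) ↔ Reach src tgt A (src e) (src f) ∧ Reach src tgt A (src f) (src e) :=
  h _ _ ⟨e, he, Or.inl rfl⟩ ⟨f, hf, Or.inl rfl⟩

/-- An edge always leads from its source to its target, so equal labels amount to a path back, that
is, to the edge lying on a cycle. -/
theorem intra_iff (h : IsSccLabel src tgt A lab) {e : ℕ} (he : e ∈ A) :
    lab (src e) = lab (tgt e) ↔ e ∈ component src tgt A e := by
  rw [h _ _ ⟨e, he, Or.inl rfl⟩ ⟨e, he, Or.inr rfl⟩]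
  exact ⟨fun hr => ⟨he, hr.2, hr.2⟩, fun hr => ⟨.of_mem he, hr.2.1⟩⟩

theorem mem_component_iff (h : IsSccLabel src tgt A lab) {e f : ℕ}
    (he : e ∈ component src tgt A e) :
    f ∈ component src tgt A e ↔ f ∈ component src tgt A f ∧ lab (src f) = lab (src e) := by
  constructor
  · intro hf
    have h1 := (Reach.of_mem he.1).trans hf.2.1
    have h2 := (Reach.of_mem hf.1).trans hf.2.2
    have h3 := hf.2.2.trans h1
    exact ⟨⟨hf.1, h3, h3⟩, (h.src_eq_src hf.1 he.1).2 ⟨h2, h1⟩⟩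
  · rintro ⟨hf, hl⟩
    obtain ⟨h1, h2⟩ := (h.src_eq_src hf.1 he.1).1 hl
    exact ⟨hf.1, he.2.1.trans h2, hf.2.1.trans h1⟩

theorem _root_.EdgeGraph.GoodSet.mem_component {S : Set ℕ} (hS : GoodSet src tgt k F R G S)
    (hSA : S ⊆ A) {e f : ℕ} (he : e ∈ S) (hf : f ∈ S) : f ∈ component src tgt A e :=
  ⟨hSA hf, (hS.conn e he f hf).mono hSA, (hS.conn f hf e he).mono hSA⟩

/-- A good set lies in a single component and meets `F`; so it is not affected when the edges
between components and the components without `F` are removed. -/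
theorem refines_zero (h : IsSccLabel src tgt A lab)
    (hB : ∀ e, e ∈ B ↔ (e ∈ A ∧ lab (src e) = lab (tgt e)) ∧
      ∃ f, (f ∈ A ∧ lab (src f) = lab (tgt f)) ∧ lab (src f) = lab (src e) ∧ F f) :
    Refines src tgt k 0 F R G A B := by
  have hA : ∀ e, e ∈ A ∧ lab (src e) = lab (tgt e) ↔ e ∈ component src tgt A e :=
    fun e => ⟨fun he => (h.intra_iff he.1).1 he.2, fun he => ⟨he.1, (h.intra_iff he.1).2 he⟩⟩
  simp only [hA] at hB
  refine ⟨fun e he => ((hB e).1 he).1.1, fun S hSA hS e he => ?_, fun e he => ((hB e).1 he).1,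
    fun e he => ?_, fun e he j hj => by omega⟩
  · obtain ⟨f, hf, hF⟩ := hS.inf
    have h1 := hS.mem_component hSA he he
    have h2 := (h.mem_component_iff h1).1 (hS.mem_component hSA he hf)
    exact (hB e).2 ⟨h1, f, h2.1, h2.2, hF⟩
  · obtain ⟨h1, f, hf, hl, hF⟩ := (hB e).1 he
    exact ⟨f, (h.mem_component_iff h1).2 ⟨hf, hl⟩, hF⟩

/-- Edges in `G l` are sought only in `B`, the edges still left, while the labels remain those of
`A`. A good set is safe, since it is contained in `B` together with its `G l` edge. So one labelling
serves all pairs of a round. -/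
theorem refines_succ (h : IsSccLabel src tgt A lab) {B' : Set ℕ}
    (hr : Refines src tgt k l F R G A B) (hl : l < k)
    (hB : ∀ e, e ∈ B' ↔ e ∈ B ∧ ¬ (R l e ∧ ∀ f ∈ B, lab (src f) = lab (src e) → ¬ G l f)) :
    Refines src tgt k (l + 1) F R G A B' := by
  have hsub : B' ⊆ B := fun e he => ((hB e).1 he).1
  refine ⟨hsub.trans hr.sub, fun S hSA hS e he => (hB e).2 ⟨hr.keep S hSA hS he, ?_⟩,
    fun e he => hr.mem e (hsub he), fun e he => hr.inf e (hsub he), fun e he j hj hG g hg hgB => ?_⟩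
  · rintro ⟨hR, hG⟩
    obtain ⟨f, hf, hGf⟩ := hS.resp l hl ⟨e, he, hR⟩
    refine hG f (hr.keep S hSA hS hf) ?_ hGf
    exact ((h.mem_component_iff (hS.mem_component hSA he he)).1 (hS.mem_component hSA he hf)).2
  · rcases Nat.lt_succ_iff_lt_or_eq.1 hj with hj | rfl
    · exact hr.resp e (hsub he) j hj hG g hg (hsub hgB)
    · intro hR
      refine ((hB g).1 hgB).2 ⟨hR, fun f hf hlab => hG f ?_⟩
      have hee := hr.mem e (hsub he)
      refine (h.mem_component_iff hee).2 ⟨hr.mem f hf, hlab.trans ?_⟩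
      exact ((h.mem_component_iff hee).1 hg).2

end IsSccLabel

end EdgeGraph

/-! ### Unmarking edges by component -/

namespace EmptinessProgram

open WhileLang EdgeGraph

/-- Unmark the edges whose ends have different labels. -/
def unmarkInter : Cmd :=
  .forLoop 5 1 (.ite (.add (.sub (.arr 8 (.arr 0 (.var 5))) (.arr 8 (.arr 1 (.var 5))))
    (.sub (.arr 8 (.arr 1 (.var 5))) (.arr 8 (.arr 0 (.var 5))))) (.put 3 (.var 5) (.lit 0)) .skip)

theorem unmarkInter_runs {X : ℕ → ℕ} {s : State} :
    Runs X unmarkInter s (unmarkInter.len * (s.v 1 + 1)) fun s' =>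
      ∀ e, e ∈ alive s' ↔ e ∈ alive s ∧ s.a 8 (s.a 0 e) = s.a 8 (s.a 1 e) := by
  refine Runs.mono (Runs.forLoop (x := 5) (N := 1) (fun x s' => ∀ e, s'.a 3 e ≠ 0 ↔
    s.a 3 e ≠ 0 ∧ (e < x → s.a 8 (s.a 0 e) = s.a 8 (s.a 1 e)))
    (by decide) (by decide) (by decide) ?_ fun s' hag hlt hI => Runs.of_simple rfl ?_) le_rfl
    fun s' ag h e => ?_
  · intro e; simp
  · intro e
    have a0 : s'.a 0 = s.a 0 := hag.a 0 (by decide)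
    have a1 : s'.a 1 = s.a 1 := hag.a 1 (by decide)
    have a8 : s'.a 8 = s.a 8 := hag.a 8 (by decide)
    have := hI e
    by_cases heq : s.a 8 (s.a 0 (s'.v 5)) = s.a 8 (s.a 1 (s'.v 5))
    · simp only [Cmd.run, Expr.eval, a0, a1, a8, heq, Nat.sub_self, if_true, State.setv_a, this]
      refine and_congr_right fun _ => ⟨fun h hlt => ?_, fun h hlt => h (by omega)⟩
      rcases Nat.lt_succ_iff_lt_or_eq.1 hlt with h1 | rfl
      · exact h h1
      · exact heq
    -- With truncated subtraction, `(a - b) + (b - a)` vanishes only if `a = b`.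
    · have hne : s.a 8 (s.a 0 (s'.v 5)) - s.a 8 (s.a 1 (s'.v 5)) +
          (s.a 8 (s.a 1 (s'.v 5)) - s.a 8 (s.a 0 (s'.v 5))) ≠ 0 := by omega
      simp only [Cmd.run, Expr.eval, a0, a1, a8, hne, if_false, State.setv_a, State.seta_a, if_true]
      by_cases he : e = s'.v 5
      · subst he
        simp [heq]
      · rw [Function.update_of_ne he, this]
        refine and_congr_right fun _ => ⟨fun h hlt => h (by omega), fun h hlt => h (by omega)⟩
  · simp only [alive, Set.mem_ofPred_eq, ag.v 1 (by decide), h e]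
    tauto

/-- Unmark the edges satisfying `cR` whose component has no marked edge satisfying `cG`. -/
def unmark (cR cG : Expr) : Cmd :=
  .forLoop 5 1 (.put 13 (.arr 8 (.arr 0 (.var 5))) (.lit 0)) ;;
  .forLoop 5 1 (.ite (.arr 3 (.var 5)) (.ite cG (.put 13 (.arr 8 (.arr 0 (.var 5))) (.lit 1)) .skip)
    .skip) ;;
  .forLoop 5 1 (.ite (.arr 3 (.var 5)) (.ite cR (.ite (.arr 13 (.arr 8 (.arr 0 (.var 5)))) .skip
    (.put 3 (.var 5) (.lit 0))) .skip) .skip)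

/-- The expression `c` computes the predicate `p` of the edge in variable `5`, in all states that
agree with `s` except for this variable, the marks and the flags. -/
def Computes (X : ℕ → ℕ) (s : State) (c : Expr) (p : ℕ → Prop) : Prop :=
  ∀ s' : State, (∀ y, y ≠ 5 → s'.v y = s.v y) → (∀ b, b ≠ 3 → b ≠ 13 → s'.a b = s.a b) →
    s'.v 5 < s.v 1 → (c.eval X s' ≠ 0 ↔ p (s'.v 5))

/-- Array 13 holds a flag for each component, indexed by its label. Three passes clear, set and
consult the flags, at linear cost for any number of components. Only flags at labels of sources of
edges are read, so only these are cleared. -/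
theorem unmark_runs {X : ℕ → ℕ} {s : State} {cR cG : Expr} {pR pG : ℕ → Prop}
    (hR : Computes X s cR pR) (hG : Computes X s cG pG) :
    Runs X (unmark cR cG) s ((unmark cR cG).len * (s.v 1 + 1)) fun s' =>
      ∀ e, e ∈ alive s' ↔ e ∈ alive s ∧
        ¬ (pR e ∧ ∀ f ∈ alive s, s.a 8 (s.a 0 f) = s.a 8 (s.a 0 e) → ¬ pG f) := by
  have agree_of : ∀ {s' : State}, Agree (unmark cR cG) s s' →
      (∀ y, y ≠ 5 → s'.v y = s.v y) ∧ (∀ b, b ≠ 3 → b ≠ 13 → s'.a b = s.a b) := fun ag =>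
    ⟨fun y hy => ag.v y (by simp [unmark, Cmd.forLoop, Cmd.wv, hy]),
      fun b hb hb' => ag.a b (by simp [unmark, Cmd.forLoop, Cmd.wa, hb, hb'])⟩
  have r1 : Runs X (.forLoop 5 1 (.put 13 (.arr 8 (.arr 0 (.var 5))) (.lit 0))) s _ _ :=
    Runs.forLoop (fun x s' => ∀ e < x, s'.a 13 (s.a 8 (s.a 0 e)) = 0)
      (by decide) (by decide) (by decide) (by intro e he; omega) fun s' hag hlt hI =>
        Runs.of_simple rfl (by
          have a0 : s'.a 0 = s.a 0 := hag.a 0 (by decide)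
          have a8 : s'.a 8 = s.a 8 := hag.a 8 (by decide)
          intro e he
          simp only [Cmd.run, Expr.eval, State.setv_a, State.seta_a, a0, a8, if_true,
            Function.update_apply]
          split_ifs with h
          · rfl
          · exact hI e (lt_of_le_of_ne (by omega) (by rintro rfl; exact h rfl)))
  obtain ⟨t1, s1, x1, k1, h1⟩ := r1
  have ag1 := x1.agree
  have e1 : s1.v 1 = s.v 1 := ag1.v 1 (by decide)
  have r2 : Runs X (.forLoop 5 1 (.ite (.arr 3 (.var 5))
      (.ite cG (.put 13 (.arr 8 (.arr 0 (.var 5))) (.lit 1)) .skip) .skip)) s1 _ _ :=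
    Runs.forLoop (fun x s' => ∀ e < s.v 1, s'.a 13 (s.a 8 (s.a 0 e)) ≠ 0 ↔
        ∃ f < x, s.a 3 f ≠ 0 ∧ s.a 8 (s.a 0 f) = s.a 8 (s.a 0 e) ∧ pG f)
      (by decide) (by simp [Cmd.wv]) (by simp [Cmd.wv])
      (by intro e he; simp [h1 e he]) fun s' hag hlt hI => Runs.of_simple rfl (by
          have b : ∀ b, b ≠ 13 → s'.a b = s.a b := fun b hb =>
            (hag.a b (by simp [Cmd.forLoop, Cmd.wa, hb])).trans
              (ag1.a b (by simp [Cmd.forLoop, Cmd.wa, hb]))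
          have a0 := b 0 (by decide)
          have a8 := b 8 (by decide)
          have a3 := b 3 (by decide)
          have hc := hG s' (fun y hy => (hag.v y (by simp [Cmd.forLoop, Cmd.wv, hy])).trans
              (ag1.v y (by simp [Cmd.forLoop, Cmd.wv, hy]))) (fun y _ hy => b y hy) (by omega)
          intro e he
          have hIe := hI e he
          by_cases hset : s.a 3 (s'.v 5) ≠ 0 ∧ pG (s'.v 5)
          · have e0 : cG.eval X s' ≠ 0 := hc.2 hset.2
            simp only [Cmd.run, Expr.eval, a3, a0, a8, hset.1, e0, if_false, State.setv_a,
              State.seta_a, if_true, Function.update_apply]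
            split_ifs with h
            · exact ⟨fun _ => ⟨s'.v 5, by omega, hset.1, h.symm, hset.2⟩, fun _ => by omega⟩
            · rw [hIe]
              refine exists_congr fun f => ⟨fun hf => ⟨by omega, hf.2⟩, fun hf => ⟨?_, hf.2⟩⟩
              exact lt_of_le_of_ne (by omega) (by rintro rfl; exact h hf.2.2.1.symm)
          · have e0 : Cmd.run X (.ite (.arr 3 (.var 5))
                (.ite cG (.put 13 (.arr 8 (.arr 0 (.var 5))) (.lit 1)) .skip) .skip) s' = s' := by
              simp only [Cmd.run, Expr.eval, a3]
              split_ifs with h3 h4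
              · rfl
              · rfl
              · exact absurd ⟨h3, hc.1 h4⟩ hset
            rw [e0, State.setv_a, hIe]
            refine exists_congr fun f => ⟨fun hf => ⟨by omega, hf.2⟩, fun hf => ⟨?_, hf.2⟩⟩
            exact lt_of_le_of_ne (by omega) (by rintro rfl; exact hset ⟨hf.2.1, hf.2.2.2⟩))
  obtain ⟨t2, s2, x2, k2, h2⟩ := r2
  have ag2 := x2.agree
  have e2 : s2.v 1 = s.v 1 := (ag2.v 1 (by simp [Cmd.forLoop, Cmd.wv])).trans e1
  have r3 : Runs X (.forLoop 5 1 (.ite (.arr 3 (.var 5)) (.ite cR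
      (.ite (.arr 13 (.arr 8 (.arr 0 (.var 5)))) .skip (.put 3 (.var 5) (.lit 0))) .skip) .skip)) s2
      _ _ :=
    -- The flags stay as in `s2`, so removals in this pass do not influence later tests.
    Runs.forLoop (fun x s' => ∀ e < s.v 1, s'.a 3 e ≠ 0 ↔
        s.a 3 e ≠ 0 ∧ (e < x → ¬ (pR e ∧ s2.a 13 (s.a 8 (s.a 0 e)) = 0)))
      (by decide) (by simp [Cmd.wv]) (by simp [Cmd.wv])
      (by
        intro e he
        simp [ag2.a 3 (by simp [Cmd.forLoop, Cmd.wa]), ag1.a 3 (by simp [Cmd.forLoop, Cmd.wa])])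
      fun s' hag hlt hI => Runs.of_simple rfl (by
          have b : ∀ b, b ≠ 3 → s'.a b = s2.a b := fun b hb =>
            hag.a b (by simp [Cmd.forLoop, Cmd.wa, hb])
          have b' : ∀ b, b ≠ 3 → b ≠ 13 → s'.a b = s.a b := fun y hy hy' => (b y hy).trans
            ((ag2.a y (by simp [Cmd.forLoop, Cmd.wa, hy'])).trans
              (ag1.a y (by simp [Cmd.forLoop, Cmd.wa, hy'])))
          have a0 := b' 0 (by decide) (by decide)
          have a8 := b' 8 (by decide) (by decide)
          have a13 := b 13 (by decide)
          have hc := hR s' (fun y hy => (hag.v y (by simp [Cmd.forLoop, Cmd.wv, hy])).trans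
              ((ag2.v y (by simp [Cmd.forLoop, Cmd.wv, hy])).trans
                (ag1.v y (by simp [Cmd.forLoop, Cmd.wv, hy])))) b' (by omega)
          intro e he
          have hIe := hI e he
          by_cases hset : pR (s'.v 5) ∧ s2.a 13 (s.a 8 (s.a 0 (s'.v 5))) = 0
          · have e0 : ∀ f, f ≠ s'.v 5 → (Cmd.run X (.ite (.arr 3 (.var 5)) (.ite cR
                (.ite (.arr 13 (.arr 8 (.arr 0 (.var 5)))) .skip (.put 3 (.var 5) (.lit 0)))
                  .skip) .skip) s').a 3 f = s'.a 3 f := by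
              intro f hf
              by_cases c1 : s'.a 3 (s'.v 5) = 0 <;> by_cases c2 : cR.eval X s' = 0 <;>
                by_cases c3 : s'.a 13 (s'.a 8 (s'.a 0 (s'.v 5))) = 0 <;>
                simp [Cmd.run, Expr.eval, c1, c2, c3, hf]
            have e1 : (Cmd.run X (.ite (.arr 3 (.var 5)) (.ite cR
                (.ite (.arr 13 (.arr 8 (.arr 0 (.var 5)))) .skip (.put 3 (.var 5) (.lit 0)))
                  .skip) .skip) s').a 3 (s'.v 5) = 0 := by
              have := hc.2 hset.1
              simp only [Cmd.run, Expr.eval, this, a13, a8, a0, hset.2, if_true, if_false]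
              split_ifs with h
              · exact h
              · simp
            rw [State.setv_a]
            by_cases hev : e = s'.v 5
            · subst hev
              rw [e1]
              simp [hset]
            · rw [e0 e hev, hIe]
              refine and_congr_right fun _ => ⟨fun h hlt => h (by omega), fun h hlt => h (by omega)⟩
          · have e0 : Cmd.run X (.ite (.arr 3 (.var 5)) (.ite cR
                (.ite (.arr 13 (.arr 8 (.arr 0 (.var 5)))) .skip (.put 3 (.var 5) (.lit 0)))
                  .skip) .skip) s' = s' := by
              simp only [Cmd.run, Expr.eval, a13, a8, a0]
              split_ifs with h3 h4 h5
              · rfl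
              · rfl
              · exact absurd ⟨hc.1 h4, h5⟩ hset
              · rfl
            rw [e0, State.setv_a, hIe]
            refine and_congr_right fun _ => ⟨fun h hlt => ?_, fun h hlt => h (by omega)⟩
            rcases Nat.lt_succ_iff_lt_or_eq.1 hlt with h1 | rfl
            · exact h h1
            · exact hset)
  obtain ⟨t3, s3, x3, k3, h3⟩ := r3
  have x := x1.seq (x2.seq x3)
  refine ⟨_, s3, x, ?_, fun e => ?_⟩
  · rw [e1] at k2
    rw [e2] at k3
    simp only [unmark, Cmd.forLoop, Cmd.len, Expr.len] at *
    nlinarith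
  · have e3 : s3.v 1 = s.v 1 := (agree_of x.agree).1 1 (by decide)
    simp only [alive, Set.mem_ofPred_eq, e3]
    rw [and_assoc]
    refine and_congr_right fun he => ?_
    rw [h3 e he]
    refine and_congr_right fun _ => ?_
    rw [e2]
    have := h2 e he
    rw [e1] at this
    simp only [he, true_imp_iff]
    refine not_congr (and_congr_right fun _ => ?_)
    rw [← not_iff_not, ← ne_eq, this]
    push Not
    simp only [and_assoc]

end EmptinessProgram

/-! ### Iterated refinement for one Rabin pair -/

namespace EmptinessProgram

open WhileLang EdgeGraph

/-- The bit number `o` in the block of the edge in variable `5`. -/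
def bitExpr (o : Expr) : Expr := .inp (.add (.add (.arr 2 (.var 5)) (.lit 3)) o)

/-- The edge `e` carries the color number `o`. -/
def Bit (X : ℕ → ℕ) (s : State) (o e : ℕ) : Prop := X (s.a 2 e + 3 + o) ≠ 0

/-- The offset 3 skips source, letter and target, which precede the color bits in a block. -/
theorem computes_bitExpr {X : ℕ → ℕ} {s : State} {o : Expr} {n : ℕ}
    (h : ∀ s' : State, (∀ y, y ≠ 5 → s'.v y = s.v y) → o.eval X s' = n) :
    Computes X s (bitExpr o) (Bit X s n) := by
  intro s' hv ha _
  simp only [bitExpr, Expr.eval, Bit, ha 2 (by decide) (by decide), h s' hv]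

/-- One round of refinement, for the Rabin pair in variable `6`. -/
def round : Cmd :=
  sccLabels ;; unmarkInter ;; unmark (.lit 1) (bitExpr (.add (.var 2) (.var 6))) ;;
    .forLoop 8 3 (unmark (bitExpr (.add (.add (.var 2) (.var 2)) (.var 8)))
      (bitExpr (.add (.add (.add (.var 2) (.var 2)) (.var 3)) (.var 8))))

/-- Refinement for the Rabin pair number `i`, in terms of the state of the program. -/
def StateRefines (X : ℕ → ℕ) (s : State) (i l : ℕ) : Set ℕ → Set ℕ → Prop :=
  Refines (s.a 0) (s.a 1) (s.v 3) l (Bit X s (s.v 2 + i)) (fun j => Bit X s (s.v 2 + s.v 2 + j))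
    fun j => Bit X s (s.v 2 + s.v 2 + s.v 3 + j)

theorem Clean.congr {s s' : State} (h : Clean s) (h1 : s'.v 1 = s.v 1) (h0 : s'.a 0 = s.a 0)
    (h1' : s'.a 1 = s.a 1) (h6 : s'.a 6 = s.a 6) (h8 : s'.a 8 = s.a 8) : Clean s' := by
  unfold Clean
  rw [h1, h0, h1', h6, h8]
  exact h

/-- A labelling at linear cost is followed by a linear pass for each Streett pair, hence the product
in the bound. Unmarking changes only marks and flags besides counters, so `Clean` survives. -/
theorem exists_round_runs : ∃ C, ∀ (X : ℕ → ℕ) (s : State), Clean s →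
    Runs X round s (C * ((s.v 1 + 1) * (s.v 3 + 1))) fun s' => Clean s' ∧
      StateRefines X s (s.v 6) (s.v 3) (alive s) (alive s') := by
  obtain ⟨C, hC⟩ := exists_sccLabels_runs
  refine ⟨C + round.len + 11, fun X s hc => ?_⟩
  obtain ⟨t1, s1, x1, k1, h1, h1'⟩ := hC X s hc
  have ag1 := x1.agree
  obtain ⟨t2, s2, x2, k2, h2⟩ := unmarkInter_runs (X := X) (s := s1)
  have ag2 := x2.agree
  -- With the constantly true condition `1`, whole components without an `F` edge are removed.
  obtain ⟨t3, s3, x3, k3, h3⟩ := unmark_runs (X := X) (s := s2) (cR := .lit 1)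
    (cG := bitExpr (.add (.var 2) (.var 6))) (pR := fun _ => True)
    (fun _ _ _ _ => by simp [Expr.eval])
    (computes_bitExpr (n := s2.v 2 + s2.v 6) fun s' h => by
      simp only [Expr.eval, h 2 (by decide), h 6 (by decide)])
  have ag3 := x3.agree
  have v13 : ∀ y ∈ [1, 2, 3, 6], s3.v y = s.v y := fun y hy => by
    rw [ag3.v y (by revert y; decide), ag2.v y (by revert y; decide), ag1.v y (by revert y; decide)]
  have v12 : ∀ y ∈ [1, 2, 3, 6], s2.v y = s.v y := fun y hy => by
    rw [ag2.v y (by revert y; decide), ag1.v y (by revert y; decide)]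
  have a13 : ∀ b ∈ [(0 : Fin 16), 1, 2], s3.a b = s.a b := fun b hb => by
    rw [ag3.a b (by revert b; decide), ag2.a b (by revert b; decide), ag1.a b (by revert b; decide)]
  have a12 : ∀ b ∈ [(0 : Fin 16), 1, 2], s2.a b = s.a b := fun b hb => by
    rw [ag2.a b (by revert b; decide), ag1.a b (by revert b; decide)]
  have al1 : alive s1 = alive s := by
    simp only [alive, ag1.v 1 (by decide), ag1.a 3 (by decide)]
  have hlab : IsSccLabel (s.a 0) (s.a 1) (alive s) (s1.a 8) := h1'
  have r0 : StateRefines X s (s.v 6) 0 (alive s) (alive s3) := by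
    refine hlab.refines_zero fun e => ?_
    rw [h3 e]
    simp only [h2, al1, ag2.a 8 (by decide), a12 0 (by decide), ag1.a 0 (by decide),
      ag1.a 1 (by decide), v12 2 (by decide), v12 6 (by decide)]
    refine and_congr_right fun _ => ?_
    simp only [true_and, not_forall, not_not, exists_prop, Bit, a12 2 (by decide)]
  have r4 : Runs X (.forLoop 8 3 (unmark (bitExpr (.add (.add (.var 2) (.var 2)) (.var 8)))
      (bitExpr (.add (.add (.add (.var 2) (.var 2)) (.var 3)) (.var 8))))) s3 _ _ :=
    Runs.forLoop (fun j s' => StateRefines X s (s.v 6) j (alive s) (alive s'))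
      (K := (unmark (bitExpr (.add (.add (.var 2) (.var 2)) (.var 8)))
      (bitExpr (.add (.add (.add (.var 2) (.var 2)) (.var 3)) (.var 8)))).len * (s.v 1 + 1))
      (by decide) (by decide) (by decide) r0 fun s' ag hlt hI => by
        have v' : ∀ y ∈ [1, 2, 3, 6], s'.v y = s.v y := fun y hy => by
          rw [ag.v y (by revert y; decide), v13 y hy]
        have a' : ∀ b ∈ [(0 : Fin 16), 1, 2], s'.a b = s.a b := fun b hb => by
          rw [ag.a b (by revert b; decide), a13 b hb]
        have a8 : s'.a 8 = s1.a 8 := by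
          rw [ag.a 8 (by decide), ag3.a 8 (by decide), ag2.a 8 (by decide)]
        refine (unmark_runs (X := X) (s := s')
          (computes_bitExpr (n := s'.v 2 + s'.v 2 + s'.v 8) fun s'' h => by
            simp only [Expr.eval, h 2 (by decide), h 8 (by decide)])
          (computes_bitExpr (n := s'.v 2 + s'.v 2 + s'.v 3 + s'.v 8) fun s'' h => by
            simp only [Expr.eval, h 2 (by decide), h 3 (by decide), h 8 (by decide)])).mono
            (by rw [v' 1 (by decide)]) fun s'' ag'' h => ?_
        have hal : alive (s''.setv 8 (s'.v 8 + 1)) = alive s'' := by simp [alive]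
        rw [hal]
        refine hlab.refines_succ hI (by rwa [v13 3 (by decide)] at hlt) fun e => ?_
        rw [h e]
        simp only [a8, a' 0 (by decide), v' 2 (by decide), v' 3 (by decide), Bit,
          a' 2 (by decide)]
  obtain ⟨t4, s4, x4, k4, h4⟩ := r4
  have ag4 := x4.agree
  refine ⟨_, s4, x1.seq (x2.seq (x3.seq x4)), ?_, ?_, ?_⟩
  · rw [ag1.v 1 (by decide)] at k2
    rw [v12 1 (by decide)] at k3
    rw [v13 3 (by decide)] at k4
    have e : round.len = sccLabels.len + (unmarkInter.len +
      ((unmark (.lit 1) (bitExpr (.add (.var 2) (.var 6)))).len +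
      ((unmark (bitExpr (.add (.add (.var 2) (.var 2)) (.var 8)))
      (bitExpr (.add (.add (.add (.var 2) (.var 2)) (.var 3)) (.var 8)))).len + 11))) := rfl
    rw [e]
    generalize sccLabels.len = l1 at *
    generalize unmarkInter.len = l2 at *
    generalize (unmark (.lit 1) (bitExpr (.add (.var 2) (.var 6)))).len = l3 at *
    generalize (unmark _ _).len = l4 at *
    have hp : s.v 1 + 1 ≤ (s.v 1 + 1) * (s.v 3 + 1) := Nat.le_mul_of_pos_right _ (by omega)
    have hp' : s.v 3 + 1 ≤ (s.v 1 + 1) * (s.v 3 + 1) := Nat.le_mul_of_pos_left _ (by omega)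
    have := Nat.mul_le_mul_left C hp
    have := Nat.mul_le_mul_left l2 hp
    have := Nat.mul_le_mul_left l3 hp
    have : (l4 * (s.v 1 + 1) + 11) * (s.v 3 + 1) =
      l4 * ((s.v 1 + 1) * (s.v 3 + 1)) + 11 * (s.v 3 + 1) := by ring
    rw [this] at k4
    generalize (s.v 1 + 1) * (s.v 3 + 1) = N at *
    calc t1 + (t2 + (t3 + t4)) ≤ (C + l2 + l3 + l4 + 11) * N := by
          simp only [add_mul]
          omega
      _ ≤ _ := Nat.mul_le_mul_right _ (by omega)
  · have ag := (x2.seq (x3.seq x4)).agree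
    exact h1.congr (ag.v 1 (by decide)) (ag.a 0 (by decide)) (ag.a 1 (by decide))
      (ag.a 6 (by decide)) (ag.a 8 (by decide))
  · rwa [v13 3 (by decide)] at h4

/-- Mark the reachable edges without the color `E` of the Rabin pair in variable `6`. -/
def markStart : Cmd :=
  .forLoop 5 1 (.put 3 (.var 5) (.lit 0) ;;
    .ite (.arr 12 (.var 5)) (.ite (bitExpr (.var 6)) .skip (.put 3 (.var 5) (.lit 1))) .skip)

theorem markStart_runs {X : ℕ → ℕ} {s : State} :
    Runs X markStart s (markStart.len * (s.v 1 + 1)) fun s' =>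
      alive s' = {e | e < s.v 1 ∧ s.a 12 e ≠ 0 ∧ ¬ Bit X s (s.v 6) e} := by
  refine Runs.mono (Runs.forLoop (x := 5) (N := 1) (fun x s' => ∀ e < x, s'.a 3 e ≠ 0 ↔
    s.a 12 e ≠ 0 ∧ ¬ Bit X s (s.v 6) e)
    (by decide) (by decide) (by decide) ?_ fun s' hag hlt hI => Runs.of_simple rfl ?_) le_rfl
    fun s' ag h => ?_
  · intro e he; omega
  · intro e he
    have a2 : s'.a 2 = s.a 2 := hag.a 2 (by decide)
    have a12 : s'.a 12 = s.a 12 := hag.a 12 (by decide)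
    have v6 : s'.v 6 = s.v 6 := hag.v 6 (by decide)
    by_cases hev : e = s'.v 5
    · subst hev
      by_cases c1 : s.a 12 (s'.v 5) = 0 <;> by_cases c2 : X (s.a 2 (s'.v 5) + 3 + s.v 6) = 0 <;>
        simp [Cmd.run, Expr.eval, bitExpr, Bit, a2, a12, v6, c1, c2]
    · have := hI e (by omega)
      by_cases c1 : s.a 12 (s'.v 5) = 0 <;> by_cases c2 : X (s.a 2 (s'.v 5) + 3 + s.v 6) = 0 <;>
        simpa [Cmd.run, Expr.eval, bitExpr, Bit, a2, a12, v6, c1, c2, hev] using this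
  · ext e
    simp only [alive, ag.v 1 (by decide), Set.mem_ofPred_eq]
    exact and_congr_right fun he => h e he

/-- Record in variable `0` whether some edge is marked. -/
def collect : Cmd := .forLoop 5 1 (.ite (.arr 3 (.var 5)) (.set 0 (.lit 1)) .skip)

/-- The result variable is left alone if nothing is marked, so that successive Rabin pairs
accumulate a disjunction. -/
theorem collect_runs {X : ℕ → ℕ} {s : State} :
    Runs X collect s (collect.len * (s.v 1 + 1)) fun s' =>
      ((alive s).Nonempty → s'.v 0 = 1) ∧ (¬ (alive s).Nonempty → s'.v 0 = s.v 0) := by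
  refine Runs.mono (Runs.forLoop (x := 5) (N := 1) (fun x s' =>
    ((∃ e < x, s.a 3 e ≠ 0) → s'.v 0 = 1) ∧ ((¬ ∃ e < x, s.a 3 e ≠ 0) → s'.v 0 = s.v 0))
    (by decide) (by decide) (by decide) ?_ fun s' hag hlt hI => Runs.of_simple rfl ?_) le_rfl
    fun s' ag h => h
  · simp
  · have a3 : s'.a 3 = s.a 3 := hag.a 3 (by decide)
    by_cases c : s.a 3 (s'.v 5) = 0
    · have : (∃ e < s'.v 5 + 1, s.a 3 e ≠ 0) ↔ ∃ e < s'.v 5, s.a 3 e ≠ 0 := by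
        refine exists_congr fun e => ⟨fun h => ⟨?_, h.2⟩, fun h => ⟨by omega, h.2⟩⟩
        exact lt_of_le_of_ne (by omega) (by rintro rfl; exact h.2 c)
      simp only [this]
      simpa [Cmd.run, Expr.eval, a3, c] using hI
    · have : ∃ e < s'.v 5 + 1, s.a 3 e ≠ 0 := ⟨s'.v 5, by omega, c⟩
      simp only [this]
      simp [Cmd.run, Expr.eval, a3, c]

/-- The search for a good set of edges for the Rabin pair in variable `6`. -/
def treatPair : Cmd := markStart ;; .forLoop 7 16 round ;; collect

/-- There is a good set of edges for the Rabin pair number `i`. -/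
def PairGood (X : ℕ → ℕ) (s : State) (i : ℕ) : Prop :=
  ∃ S ⊆ {e | e < s.v 1 ∧ s.a 12 e ≠ 0 ∧ ¬ Bit X s i e},
    GoodSet (s.a 0) (s.a 1) (s.v 3) (Bit X s (s.v 2 + i)) (fun j => Bit X s (s.v 2 + s.v 2 + j))
      (fun j => Bit X s (s.v 2 + s.v 2 + s.v 3 + j)) S

/-- Variable 16 provides the `k + 1` rounds that `nonempty_iff_of_refines` asks for. Rounds that are
themselves linear in `k` make the bound quadratic. -/
theorem exists_treatPair_runs : ∃ C, ∀ (X : ℕ → ℕ) (s : State), Clean s → s.v 16 = s.v 3 + 1 →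
    Runs X treatPair s (C * ((s.v 1 + 1) * (s.v 3 + 2) ^ 2)) fun s' => Clean s' ∧
      (PairGood X s (s.v 6) → s'.v 0 = 1) ∧ (¬ PairGood X s (s.v 6) → s'.v 0 = s.v 0) := by
  obtain ⟨C, hC⟩ := exists_round_runs
  refine ⟨C + markStart.len + collect.len + 11, fun X s hc h16 => ?_⟩
  obtain ⟨t1, s1, x1, k1, h1⟩ := markStart_runs (X := X) (s := s)
  have ag1 := x1.agree
  have c1 : Clean s1 := hc.congr (ag1.v 1 (by decide)) (ag1.a 0 (by decide)) (ag1.a 1 (by decide))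
    (ag1.a 6 (by decide)) (ag1.a 8 (by decide))
  have r2 : Runs X (.forLoop 7 16 round) s1 _ _ :=
    -- The program keeps only the current marks; the sets of the earlier rounds are carried along
    -- existentially in the invariant.
    Runs.forLoop (K := C * ((s.v 1 + 1) * (s.v 3 + 1))) (fun r s' => Clean s' ∧
        ∃ A : ℕ → Set ℕ, A 0 = alive s1 ∧ A r = alive s' ∧
          ∀ q < r, StateRefines X s (s.v 6) (s.v 3) (A q) (A (q + 1)))
      (by decide) (by decide) (by decide)
      ⟨c1.congr rfl rfl rfl rfl rfl, fun _ => alive s1, rfl, rfl, fun q hq => by omega⟩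
      fun s' ag hlt hI => by
        have v' : ∀ y ∈ [1, 2, 3, 6], s'.v y = s.v y := fun y hy => by
          rw [ag.v y (by revert y; decide), ag1.v y (by revert y; decide)]
        have a' : ∀ b ∈ [(0 : Fin 16), 1, 2], s'.a b = s.a b := fun b hb => by
          rw [ag.a b (by revert b; decide), ag1.a b (by revert b; decide)]
        obtain ⟨hcl, A, hA0, hAr, hA⟩ := hI
        refine (hC X s' hcl).mono (by rw [v' 1 (by decide), v' 3 (by decide)]) fun s'' ag'' h => ?_
        refine ⟨h.1.congr (by simp) rfl rfl rfl rfl,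
          Function.update A (s'.v 7 + 1) (alive s''), ?_, ?_, ?_⟩
        · rw [Function.update_of_ne (by omega), hA0]
        · simp [alive]
        · intro q hq
          rw [Function.update_of_ne (by omega)]
          rcases Nat.lt_succ_iff_lt_or_eq.1 hq with h7 | rfl
          · rw [Function.update_of_ne (by omega)]
            exact hA q h7
          · rw [Function.update_self, hAr]
            have hb : ∀ o, Bit X s' o = Bit X s o := fun o => by
              ext e; simp only [Bit, a' 2 (by decide)]
            simpa only [StateRefines, v' 2 (by decide), v' 3 (by decide), v' 6 (by decide),
              a' 0 (by decide), a' 1 (by decide), hb] using h.2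
  obtain ⟨t2, s2, x2, k2, h2⟩ := r2
  have ag2 := x2.agree
  have e16 : s1.v 16 = s.v 3 + 1 := (ag1.v 16 (by decide)).trans h16
  rw [e16] at h2 k2
  obtain ⟨c2, A, hA0, hAr, hA⟩ := h2
  obtain ⟨t3, s3, x3, k3, h3⟩ := collect_runs (X := X) (s := s2)
  have ag3 := x3.agree
  have hiff : (alive s2).Nonempty ↔ PairGood X s (s.v 6) := by
    rw [← hAr, nonempty_iff_of_refines (fun r hr => hA r (by omega)), hA0, h1]
    rfl
  rw [hiff, ag2.v 0 (by decide), ag1.v 0 (by decide)] at h3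
  refine ⟨_, s3, x1.seq (x2.seq x3), ?_, c2.congr (ag3.v 1 (by decide)) (ag3.a 0 (by decide))
    (ag3.a 1 (by decide)) (ag3.a 6 (by decide)) (ag3.a 8 (by decide)), h3⟩
  rw [ag2.v 1 (by decide), ag1.v 1 (by decide)] at k3
  generalize markStart.len = l1 at *
  generalize collect.len = l3 at *
  have hp : s.v 1 + 1 ≤ (s.v 1 + 1) * (s.v 3 + 2) ^ 2 := Nat.le_mul_of_pos_right _ (by positivity)
  have hp' : (s.v 1 + 1) * (s.v 3 + 1) * (s.v 3 + 2) ≤ (s.v 1 + 1) * (s.v 3 + 2) ^ 2 := by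
    rw [mul_assoc]
    exact Nat.mul_le_mul_left _ (by nlinarith)
  have hp'' : s.v 3 + 2 ≤ (s.v 1 + 1) * (s.v 3 + 2) ^ 2 := by
    nlinarith [Nat.zero_le (s.v 1 * (s.v 3 + 2) ^ 2)]
  have := Nat.mul_le_mul_left l1 hp
  have := Nat.mul_le_mul_left l3 hp
  have := Nat.mul_le_mul_left C hp'
  have e : (C * ((s.v 1 + 1) * (s.v 3 + 1)) + 11) * (s.v 3 + 1 + 1) =
    C * ((s.v 1 + 1) * (s.v 3 + 1) * (s.v 3 + 2)) + 11 * (s.v 3 + 2) := by ring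
  rw [e] at k2
  generalize (s.v 1 + 1) * (s.v 3 + 2) ^ 2 = N at *
  simp only [add_mul]
  omega

end EmptinessProgram

namespace EmptinessProgram

open WhileLang EdgeGraph

/-! ### The complete program

Variables: `0` result, `1` number of edges, `2` number of Rabin pairs, `3` number of Streett pairs,
`4` initial state, `5` edge, `6` Rabin pair, `7` round, `8` Streett pair, `9` to `15` see
`searchBody`, `16` number of rounds, `17` position in the input, `18` length of a block. Arrays: `0`
and `1` sources and targets of edges, `2` positions of their blocks, `3` marks, `4` and `5` starts
and ends of edges in a search, `6` to `11` see `searchBody`, `12` reachable edges, `13` flags. -/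

/-- Read the parameters. -/
def setup : Cmd :=
  .set 1 (.inp (.lit 2)) ;; .set 2 (.inp (.lit 3)) ;; .set 3 (.inp (.lit 4)) ;;
  .set 4 (.inp (.lit 5)) ;; .set 16 (.add (.var 3) (.lit 1)) ;;
  .set 18 (.add (.add (.lit 3) (.add (.var 2) (.var 2))) (.add (.var 3) (.var 3))) ;;
  .set 17 (.lit 6) ;; .set 0 (.lit 0)

/-- Read the edges and mark all of them. -/
def readEdges : Cmd :=
  .forLoop 5 1 (.put 0 (.var 5) (.inp (.var 17)) ;;
    .put 1 (.var 5) (.inp (.add (.var 17) (.lit 2))) ;; .put 2 (.var 5) (.var 17) ;;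
    .put 3 (.var 5) (.lit 1) ;; .set 17 (.add (.var 17) (.var 18)))

/-- Store in array `12` which edges are reachable. -/
def storeReachable : Cmd := .forLoop 5 1 (.put 12 (.var 5) (.arr 8 (.arr 0 (.var 5))))

/-- Determine the reachable edges. -/
def findReachable : Cmd :=
  prepareForward ;; (.put 11 (.lit 0) (.var 4) ;; .set 9 (.lit 1)) ;; buildSearch ;;
    storeReachable ;; .put 8 (.var 4) (.lit 0)

/-- The program for the emptiness problem. -/
def main : Cmd :=
  setup ;; .ite (.var 1) (readEdges ;; findReachable ;; .forLoop 6 2 treatPair) .skip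

/-- The machine cannot multiply. The start of block `e`, after 6 parameters, is reached by adding
the block length once per pass. -/
theorem readEdges_runs {X : ℕ → ℕ} {s : State} (h17 : s.v 17 = 6) :
    Runs X readEdges s (readEdges.len * (s.v 1 + 1)) fun s' => ∀ e < s.v 1,
      s'.a 0 e = X (6 + s.v 18 * e) ∧ s'.a 1 e = X (6 + s.v 18 * e + 2) ∧
      s'.a 2 e = 6 + s.v 18 * e ∧ s'.a 3 e = 1 := by
  refine Runs.mono (Runs.forLoop (x := 5) (N := 1) (fun x s' => s'.v 17 = 6 + s.v 18 * x ∧ ∀ e < x,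
      s'.a 0 e = X (6 + s.v 18 * e) ∧ s'.a 1 e = X (6 + s.v 18 * e + 2) ∧
      s'.a 2 e = 6 + s.v 18 * e ∧ s'.a 3 e = 1)
    (by decide) (by decide) (by decide) ?_ fun s' hag hlt hI => Runs.of_simple rfl ?_) le_rfl
    fun s' ag h => h.2
  · simpa using h17
  · have v18 : s'.v 18 = s.v 18 := hag.v 18 (by decide)
    obtain ⟨h1, h2⟩ := hI
    refine ⟨by simp [Cmd.run, Expr.eval, v18, h1]; ring, fun e he => ?_⟩
    by_cases hev : e = s'.v 5
    · subst hev
      simp [Cmd.run, Expr.eval, h1]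
    · simpa [Cmd.run, Expr.eval, hev] using h2 e (by omega)

theorem storeReachable_runs {X : ℕ → ℕ} {s : State} :
    Runs X storeReachable s (storeReachable.len * (s.v 1 + 1)) fun s' => ∀ e < s.v 1,
      s'.a 12 e = s.a 8 (s.a 0 e) := by
  refine Runs.mono (Runs.forLoop (x := 5) (N := 1) (fun x s' => ∀ e < x,
      s'.a 12 e = s.a 8 (s.a 0 e))
    (by decide) (by decide) (by decide) ?_ fun s' hag hlt hI => Runs.of_simple rfl ?_) le_rfl
    fun s' ag h => h
  · intro e he; omega
  · have a0 : s'.a 0 = s.a 0 := hag.a 0 (by decide)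
    have a8 : s'.a 8 = s.a 8 := hag.a 8 (by decide)
    intro e he
    by_cases hev : e = s'.v 5
    · subst hev
      simp [Cmd.run, Expr.eval, a0, a8]
    · simpa [Cmd.run, Expr.eval, hev] using hI e (by omega)

/-- The search is reused with the initial state as its only root; nonzero labels then mean
reachability. -/
theorem findReachable_runs {X : ℕ → ℕ} {s : State} (hc : ∀ v, s.a 6 v = 0 ∧ s.a 8 v = 0)
    (hal : alive s = {e | e < s.v 1}) :
    Runs X findReachable s (4 * findReachable.len * (s.v 1 + 1)) fun s' => Clean s' ∧
      ∀ e < s.v 1, s'.a 12 e ≠ 0 ↔ Reach (s.a 0) (s.a 1) {e | e < s.v 1} (s.v 4) (s.a 0 e) := by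
  obtain ⟨t1, s1, x1, k1, h1, -⟩ := prepareForward_runs (X := X) (s := s)
  have ag1 := x1.agree
  obtain ⟨t2, s2, x2, k2, h2⟩ := Runs.of_simple (X := X) (s := s1)
    (c := .put 11 (.lit 0) (.var 4) ;; .set 9 (.lit 1))
    (Q := fun s' => s'.v 9 = 1 ∧ s'.a 11 0 = s1.v 4) rfl (by simp [Cmd.run, Expr.eval])
  have ag2 := x2.agree
  have e2 : s2.v 1 = s.v 1 := (ag2.v 1 (by decide)).trans (ag1.v 1 (by decide))
  have al2 : alive s2 = {e | e < s.v 1} := by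
    rw [← hal]
    simp only [alive, e2, ag2.a 3 (by decide), ag1.a 3 (by decide)]
  obtain ⟨t3, s3, x3, k3, h3, -, h3'⟩ := buildSearch_runs (X := X) (s := s2) fun v _ => by
    rw [ag2.a 6 (by decide), ag2.a 8 (by decide), ag1.a 6 (by decide), ag1.a 8 (by decide)]
    exact hc v
  have ag3 := x3.agree
  have e3 : s3.v 1 = s.v 1 := (ag3.v 1 (by decide)).trans e2
  rw [h2.1, e2] at k3
  rw [al2, h2.1] at h3
  rw [al2] at h3'
  have a24 : s2.a 4 = s1.a 4 := ag2.a 4 (by decide)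
  have a25 : s2.a 5 = s1.a 5 := ag2.a 5 (by decide)
  have d := h3.congr (src' := s.a 0) (tgt' := s.a 1) (rt' := fun _ => s.v 4)
    (fun e he => by rw [a24, a25]; exact ⟨(h1 e he).1, (h1 e he).2.1⟩)
    (fun i hi => by
      obtain rfl : i = 0 := by omega
      rw [h2.2, ag1.v 4 (by decide)])
  have hlab : ∀ v, s3.a 8 v ≠ 0 ↔ Reach (s.a 0) (s.a 1) {e | e < s.v 1} (s.v 4) v := fun v =>
    (d.lab_iff v).trans ⟨fun ⟨_, _, h⟩ => h, fun h => ⟨0, by omega, h⟩⟩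
  obtain ⟨t4, s4, x4, k4, h4⟩ := storeReachable_runs (X := X) (s := s3)
  have ag4 := x4.agree
  obtain ⟨t5, s5, x5, k5, h5⟩ := Runs.of_simple (X := X) (s := s4)
    (c := .put 8 (.var 4) (.lit 0))
    (Q := fun s' => s'.a 8 = Function.update (s4.a 8) (s4.v 4) 0) rfl (by simp [Cmd.run, Expr.eval])
  have ag5 := x5.agree
  have ag := (x1.seq (x2.seq (x3.seq (x4.seq x5)))).agree
  have a30 : s3.a 0 = s.a 0 :=
    (ag3.a 0 (by decide)).trans ((ag2.a 0 (by decide)).trans (ag1.a 0 (by decide)))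
  refine ⟨_, s5, x1.seq (x2.seq (x3.seq (x4.seq x5))), ?_, fun v hv => ⟨?_, ?_⟩, fun e he => ?_⟩
  · have e : findReachable.len = prepareForward.len + (Cmd.len (.put 11 (.lit 0) (.var 4) ;;
      .set 9 (.lit 1)) + (buildSearch.len + (storeReachable.len +
      Cmd.len (.put 8 (.var 4) (.lit 0))))) := rfl
    rw [e]
    rw [e3] at k4
    generalize prepareForward.len = l1 at *
    generalize Cmd.len (.put 11 (.lit 0) (.var 4) ;; .set 9 (.lit 1)) = l2 at *
    generalize buildSearch.len = l3 at *
    generalize storeReachable.len = l4 at *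
    generalize Cmd.len (.put 8 (.var 4) (.lit 0)) = l5 at *
    nlinarith [Nat.zero_le (l1 * s.v 1), Nat.zero_le (l2 * s.v 1), Nat.zero_le (l3 * s.v 1),
      Nat.zero_le (l4 * s.v 1), Nat.zero_le (l5 * s.v 1)]
  · rw [ag5.a 6 (by decide), ag4.a 6 (by decide)]
    by_contra hcon
    obtain ⟨e, he, hev⟩ := h3' v hcon
    rw [ag.v 1 (by decide), ag.a 0 (by decide)] at hv
    rw [a24, (h1 e he).1] at hev
    exact (hv e he).1 hev
  · rw [h5, ag4.a 8 (by decide), ag4.v 4 (by decide), ag3.v 4 (by decide), ag2.v 4 (by decide),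
      ag1.v 4 (by decide), Function.update_apply]
    -- The initial state is labelled as a root, possibly without being the end of an edge. The final
    -- reset of its label is what restores `Clean`.
    split_ifs with hv4
    · rfl
    · by_contra hcon
      rw [ag.v 1 (by decide), ag.a 1 (by decide)] at hv
      rcases ((hlab v).1 hcon).eq_or_exists with h | ⟨e, he, hev⟩
      · exact hv4 h.symm
      · exact (hv e he).2 hev
  · rw [ag5.a 12 (by decide), h4 e (by rwa [e3]), a30]
    exact hlab _

theorem pairs_runs {X : ℕ → ℕ} {C : ℕ} (hC : ∀ (X : ℕ → ℕ) (s : State), Clean s →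
      s.v 16 = s.v 3 + 1 → Runs X treatPair s (C * ((s.v 1 + 1) * (s.v 3 + 2) ^ 2)) fun s' =>
      Clean s' ∧ (PairGood X s (s.v 6) → s'.v 0 = 1) ∧ (¬ PairGood X s (s.v 6) → s'.v 0 = s.v 0))
    {s : State} (hc : Clean s) (h16 : s.v 16 = s.v 3 + 1) (h0 : s.v 0 = 0) :
    Runs X (.forLoop 6 2 treatPair) s ((C * ((s.v 1 + 1) * (s.v 3 + 2) ^ 2) + 11) * (s.v 2 + 1))
      fun s' => ((∃ i < s.v 2, PairGood X s i) → s'.v 0 = 1) ∧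
        ((¬ ∃ i < s.v 2, PairGood X s i) → s'.v 0 = 0) := by
  refine Runs.mono (Runs.forLoop (x := 6) (N := 2) (K := C * ((s.v 1 + 1) * (s.v 3 + 2) ^ 2))
    (fun x s' => Clean s' ∧ ((∃ i < x, PairGood X s i) → s'.v 0 = 1) ∧
        ((¬ ∃ i < x, PairGood X s i) → s'.v 0 = 0))
    (by decide) (by decide) (by decide) ?_ fun s' ag hlt hI => ?_) le_rfl fun s' ag h => h.2
  · exact ⟨hc.congr rfl rfl rfl rfl rfl, by simp, fun _ => by simpa using h0⟩
  · have v' : ∀ y ∈ [1, 2, 3, 16], s'.v y = s.v y := fun y hy => ag.v y (by revert y; decide)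
    have a' : ∀ b ∈ [(0 : Fin 16), 1, 2, 12], s'.a b = s.a b :=
      fun b hb => ag.a b (by revert b; decide)
    obtain ⟨hcl, h1, h2⟩ := hI
    have hP : ∀ i, PairGood X s' i ↔ PairGood X s i := fun i => by
      have hb : ∀ o, Bit X s' o = Bit X s o := fun o => by
        ext e; simp only [Bit, a' 2 (by decide)]
      simp only [PairGood, hb, v' 1 (by decide), v' 2 (by decide), v' 3 (by decide),
        a' 0 (by decide), a' 1 (by decide), a' 12 (by decide)]
    refine (hC X s' hcl (by rw [v' 16 (by decide), v' 3 (by decide), h16])).mono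
      (by rw [v' 1 (by decide), v' 3 (by decide)]) fun s'' ag'' ⟨hcl', g1, g2⟩ => ?_
    rw [hP] at g1 g2
    have hex : (∃ i < s'.v 6 + 1, PairGood X s i) ↔
        (∃ i < s'.v 6, PairGood X s i) ∨ PairGood X s (s'.v 6) := by
      constructor
      · rintro ⟨i, hi, hg⟩
        rcases Nat.lt_succ_iff_lt_or_eq.1 hi with h | rfl
        · exact Or.inl ⟨i, h, hg⟩
        · exact Or.inr hg
      · rintro (⟨i, hi, hg⟩ | hg)
        · exact ⟨i, by omega, hg⟩
        · exact ⟨_, by omega, hg⟩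
    rw [hex]
    refine ⟨hcl'.congr (by simp) rfl rfl rfl rfl, fun h => ?_, fun h => ?_⟩
    · by_cases hg : PairGood X s (s'.v 6)
      · simpa using g1 hg
      · simpa [g2 hg] using h1 (h.resolve_right hg)
    · push Not at h
      simpa [g2 h.2] using h2 (by push Not; exact h.1)

/-- The state `s` holds the edges that are encoded in `X`. -/
structure HoldsInput (X : ℕ → ℕ) (s : State) : Prop where
  edges : s.v 1 = X 2
  rabin : s.v 2 = X 3
  streett : s.v 3 = X 4
  start : s.v 4 = X 5
  src : ∀ e < X 2, s.a 0 e = X (6 + (3 + (X 3 + X 3) + (X 4 + X 4)) * e)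
  tgt : ∀ e < X 2, s.a 1 e = X (6 + (3 + (X 3 + X 3) + (X 4 + X 4)) * e + 2)
  block : ∀ e < X 2, s.a 2 e = 6 + (3 + (X 3 + X 3) + (X 4 + X 4)) * e
  reach : ∀ e < X 2, s.a 12 e ≠ 0 ↔ Reach (s.a 0) (s.a 1) {e | e < X 2} (s.v 4) (s.a 0 e)

/-- Automata without edges are answered in constant time. The parameters are written in binary, so
without edges loops up to the numbers of pairs would not be polynomial in the bit length of the
input. -/
theorem exists_main_runs : ∃ C, ∀ (X : ℕ → ℕ) (L : ℕ),
    (X 2 = 0 → Runs X main (initState L) C fun s' => s'.v 0 = 0) ∧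
    (X 2 ≠ 0 → Runs X main (initState L) (C * ((X 2 + 1) * (X 4 + 2) ^ 2 * (X 3 + 1))) fun s' =>
      ∃ s, HoldsInput X s ∧ ((∃ i < X 3, PairGood X s i) → s'.v 0 = 1) ∧
        ((¬ ∃ i < X 3, PairGood X s i) → s'.v 0 = 0)) := by
  obtain ⟨C, hC⟩ := exists_treatPair_runs
  refine ⟨setup.len + 3 + readEdges.len + 4 * findReachable.len + C + 11, fun X L => ?_⟩
  obtain ⟨t1, s1, x1, k1, h1⟩ := Runs.of_simple (X := X) (c := setup) (s := initState L)
    (Q := fun s' => s'.v 0 = 0 ∧ s'.v 1 = X 2 ∧ s'.v 2 = X 3 ∧ s'.v 3 = X 4 ∧ s'.v 4 = X 5 ∧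
      s'.v 16 = X 4 + 1 ∧ s'.v 17 = 6 ∧ s'.v 18 = 3 + (X 3 + X 3) + (X 4 + X 4)) rfl
    (by simp [setup, Cmd.run, Expr.eval])
  have ag1 := x1.agree
  obtain ⟨v0, v1, v2, v3, v4, v16, v17, v18⟩ := h1
  have z6 : s1.a 6 = fun _ => 0 := ag1.a 6 (by decide)
  have z8 : s1.a 8 = fun _ => 0 := ag1.a 8 (by decide)
  constructor
  · intro h0
    refine ⟨_, s1, x1.seq (.ite_false (by simp [Expr.eval, v1, h0]) (.skip s1)), ?_, v0⟩
    simp only [Expr.len]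
    omega
  · intro hne
    obtain ⟨t2, s2, x2, k2, h2⟩ := readEdges_runs (X := X) (s := s1) v17
    have ag2 := x2.agree
    rw [v1, v18] at h2
    rw [v1] at k2
    have e2 : s2.v 1 = X 2 := (ag2.v 1 (by decide)).trans v1
    obtain ⟨t3, s3, x3, k3, h3, h3'⟩ := findReachable_runs (X := X) (s := s2)
      (fun v => by
        rw [ag2.a 6 (by decide), ag2.a 8 (by decide), z6, z8]; exact ⟨rfl, rfl⟩)
      (by
        ext e
        simp only [alive, Set.mem_ofPred_eq, e2]
        exact ⟨fun h => h.1, fun h => ⟨h, by rw [(h2 e h).2.2.2]; omega⟩⟩)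
    have ag3 := x3.agree
    rw [e2] at h3' k3
    have w : ∀ y ∈ [0, 1, 2, 3, 4, 16], s3.v y = s1.v y := fun y hy =>
      (ag3.v y (by revert y; decide)).trans (ag2.v y (by revert y; decide))
    obtain ⟨t4, s4, x4, k4, h4⟩ := pairs_runs (X := X) hC h3
      (by rw [w 16 (by decide), w 3 (by decide), v16, v3]) (by rw [w 0 (by decide), v0])
    rw [w 1 (by decide), w 2 (by decide), w 3 (by decide), v1, v2, v3] at k4
    rw [w 2 (by decide), v2] at h4
    have a3 : ∀ b ∈ [(0 : Fin 16), 1, 2], s3.a b = s2.a b := fun b hb =>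
      ag3.a b (by revert b; decide)
    refine ⟨_, s4, x1.seq (.ite_true (by simpa [Expr.eval, v1] using hne)
      (x2.seq (x3.seq x4))), ?_, s3, ?_, h4⟩
    · have p1 : 1 ≤ (X 2 + 1) * (X 4 + 2) ^ 2 * (X 3 + 1) := Nat.succ_le_of_lt (by positivity)
      have p2 : X 2 + 1 ≤ (X 2 + 1) * (X 4 + 2) ^ 2 * (X 3 + 1) := by
        rw [mul_assoc]; exact Nat.le_mul_of_pos_right _ (by positivity)
      have p3 : X 3 + 1 ≤ (X 2 + 1) * (X 4 + 2) ^ 2 * (X 3 + 1) :=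
        Nat.le_mul_of_pos_left _ (by positivity)
      have e : (C * ((X 2 + 1) * (X 4 + 2) ^ 2) + 11) * (X 3 + 1) =
        C * ((X 2 + 1) * (X 4 + 2) ^ 2 * (X 3 + 1)) + 11 * (X 3 + 1) := by ring
      rw [e] at k4
      have q1 := Nat.mul_le_mul_left setup.len p1
      have q2 := Nat.mul_le_mul_left readEdges.len p2
      have q3 := Nat.mul_le_mul_left (4 * findReachable.len) p2
      generalize (X 2 + 1) * (X 4 + 2) ^ 2 * (X 3 + 1) = N at *
      simp only [add_mul, Expr.len]
      omega
    · have e0 : s3.a 0 = s2.a 0 := a3 0 (by decide)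
      refine ⟨by rw [w 1 (by decide), v1], by rw [w 2 (by decide), v2], by rw [w 3 (by decide), v3],
        by rw [w 4 (by decide), v4], fun e he => ?_, fun e he => ?_, fun e he => ?_, fun e he => ?_⟩
      · rw [e0]; exact (h2 e he).1
      · rw [a3 1 (by decide)]; exact (h2 e he).2.1
      · rw [a3 2 (by decide)]; exact (h2 e he).2.2.1
      · rw [h3' e he, e0, a3 1 (by decide), ag3.v 4 (by decide)]

end EmptinessProgram

/-! ### Automata as edge-indexed graphs -/

namespace ELFormula

variable {C : Type} {g : ℕ → Set C}

theorem sat_disj (l : List (ELFormula C)) : Sat g (disj l) ↔ ∃ φ ∈ l, Sat g φ := by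
  induction l with
  | nil => simp [disj, Sat]
  | cons φ l ih =>
    rw [show disj (φ :: l) = or φ (disj l) from rfl, Sat, ih]
    simp

theorem sat_conj (l : List (ELFormula C)) : Sat g (conj l) ↔ ∀ φ ∈ l, Sat g φ := by
  induction l with
  | nil => simp [conj, Sat]
  | cons φ l ih =>
    rw [show conj (φ :: l) = and φ (conj l) from rfl, Sat, ih]
    simp

theorem sat_rabinStreett {d k : ℕ} {g : ℕ → Set (RSColor d k)} :
    Sat g (rabinStreett d k) ↔
      (∃ i, {t | RSColor.rabinF i ∈ g t}.Infinite ∧ {t | RSColor.rabinE i ∈ g t}.Finite) ∧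
      ∀ j, {t | RSColor.streettR j ∈ g t}.Finite ∨ {t | RSColor.streettG j ∈ g t}.Infinite := by
  rw [rabinStreett, Sat, rabin, streett, sat_disj, sat_conj]
  simp [Sat]

end ELFormula

namespace RSAutomaton

open EdgeGraph

/-- An automaton whose transitions are listed in `l` is non-empty if and only if some Rabin pair
has a good set of reachable transitions. -/
theorem isNonempty_iff {M : RSAutomaton}
    {l : List (Fin M.numStates × Fin M.numLetters × Fin M.numStates)}
    (hl : ∀ t, t ∈ l ↔ t ∈ M.aut.trans) {src tgt : ℕ → ℕ} {E F R G : ℕ → ℕ → Prop}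
    (hs : ∀ e (h : e < l.length), src e = (l[e].1 : ℕ))
    (ht : ∀ e (h : e < l.length), tgt e = (l[e].2.2 : ℕ))
    (hE : ∀ (i : Fin M.rabinPairs) e (h : e < l.length), E i e ↔
      RSColor.rabinE i ∈ M.aut.color l[e])
    (hF : ∀ (i : Fin M.rabinPairs) e (h : e < l.length), F i e ↔
      RSColor.rabinF i ∈ M.aut.color l[e])
    (hR : ∀ (j : Fin M.streettPairs) e (h : e < l.length), R j e ↔
      RSColor.streettR j ∈ M.aut.color l[e])
    (hG : ∀ (j : Fin M.streettPairs) e (h : e < l.length), G j e ↔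
      RSColor.streettG j ∈ M.aut.color l[e]) :
    M.IsNonempty ↔ ∃ i < M.rabinPairs,
      ∃ S ⊆ {e | e < l.length ∧ Reach src tgt {e | e < l.length} M.aut.start (src e) ∧ ¬ E i e},
        GoodSet src tgt M.streettPairs (F i) R G S := by
  have step : ∀ i, (∃ S ⊆ {e | e < l.length ∧
      Reach src tgt {e | e < l.length} M.aut.start (src e) ∧ ¬ E i e},
        GoodSet src tgt M.streettPairs (F i) R G S) ↔ _ :=
    fun i => (exists_path_iff (E := E i)).symm
  simp only [step]
  have hcol : ∀ (p : ℕ → ℕ) (hp : ∀ t, p t < l.length) (c : RSColor M.rabinPairs M.streettPairs)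
      (P : ℕ → Prop), (∀ e (h : e < l.length), P e ↔ c ∈ M.aut.color l[e]) →
      {t | P (p t)} = {t | c ∈ M.aut.color (l[p t]'(hp t))} := fun p hp c P h => by
    ext t; exact h (p t) (hp t)
  rw [IsNonempty, ← Set.nonempty_iff_ne_empty]
  constructor
  · rintro ⟨w, r, ⟨h0, hr⟩, hsat⟩
    rw [M.acc_eq, ELFormula.sat_rabinStreett] at hsat
    -- Each transition of the run is replaced by its index in the list.
    have hex : ∀ t, ∃ e, ∃ h : e < l.length, l[e] = (r t, w t, r (t + 1)) :=
      fun t => List.getElem_of_mem ((hl _).2 (hr t))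
    choose p hp hpe using hex
    obtain ⟨⟨i, hFi, hEi⟩, hRG⟩ := hsat
    refine ⟨i, i.2, p, hp, ?_, fun t => ?_, ?_, ?_, fun j hj => ?_⟩
    · rw [hs _ (hp 0), hpe, h0]
    · rw [ht _ (hp t), hs _ (hp (t + 1)), hpe, hpe]
    · rw [hcol p hp (.rabinF i) _ (hF i)]
      simpa only [hpe] using hFi
    · rw [hcol p hp (.rabinE i) _ (hE i)]
      simpa only [hpe] using hEi
    · rw [hcol p hp (.streettR ⟨j, hj⟩) _ (hR ⟨j, hj⟩), hcol p hp (.streettG ⟨j, hj⟩) _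
        (hG ⟨j, hj⟩)]
      simpa only [hpe] using hRG ⟨j, hj⟩
  · rintro ⟨i, hi, p, hp, h0, hc, hFi, hEi, hRG⟩
    -- Consecutive edges share a state, so the sources and letters along the path recover its
    -- transitions.
    have hpe : ∀ t, ((l[p t]'(hp t)).1, (l[p t]'(hp t)).2.1, (l[p (t + 1)]'(hp (t + 1))).1) =
        l[p t]'(hp t) := fun t => by
      have := hc t
      rw [ht _ (hp t), hs _ (hp (t + 1))] at this
      rw [← Fin.ext this]
    refine ⟨fun t => (l[p t]'(hp t)).2.1, fun t => (l[p t]'(hp t)).1, ⟨?_, fun t => ?_⟩, ?_⟩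
    · rw [hs _ (hp 0)] at h0
      exact Fin.ext h0
    · rw [hpe, ← hl]
      exact List.getElem_mem _
    · rw [M.acc_eq, ELFormula.sat_rabinStreett]
      simp only [hpe]
      refine ⟨⟨⟨i, hi⟩, ?_, ?_⟩, fun j => ?_⟩
      · rwa [← hcol p hp (.rabinF ⟨i, hi⟩) _ (hF ⟨i, hi⟩)]
      · rwa [← hcol p hp (.rabinE ⟨i, hi⟩) _ (hE ⟨i, hi⟩)]
      · rw [← hcol p hp (.streettR j) _ (hR j), ← hcol p hp (.streettG j) _ (hG j)]
        exact hRG j j.2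

/-! ### The encoding -/

theorem getD_flatMap {α : Type*} {f : α → List ℕ} {W : ℕ} (hf : ∀ a, (f a).length = W)
    (l : List α) (e o : ℕ) (he : e < l.length) (ho : o < W) :
    (l.flatMap f).getD (W * e + o) 0 = (f l[e]).getD o 0 := by
  induction l generalizing e with
  | nil => simp at he
  | cons a l ih =>
    rw [List.flatMap_cons]
    cases e with
    | zero => rw [List.getD_append _ _ _ _ (by rw [hf]; omega)]; simp
    | succ e =>
      rw [List.getD_append_right _ _ _ _ (by rw [hf]; nlinarith), hf,
        show W * (e + 1) + o - W = W * e + o by rw [Nat.mul_succ]; omega,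
        ih e (by simpa using he)]
      simp

variable {M : RSAutomaton} (t : Fin M.numStates × Fin M.numLetters × Fin M.numStates)

theorem length_encodeEdge : (M.encodeEdge t).length =
    3 + (M.rabinPairs + M.rabinPairs) + (M.streettPairs + M.streettPairs) := by
  simp [encodeEdge]; omega

theorem colorBit_ne_zero (c : RSColor M.rabinPairs M.streettPairs) :
    M.colorBit t c ≠ 0 ↔ c ∈ M.aut.color t := by
  simp [colorBit]

theorem getD_encodeEdge_zero : (M.encodeEdge t).getD 0 0 = t.1 := by simp [encodeEdge]

theorem getD_encodeEdge_two : (M.encodeEdge t).getD 2 0 = t.2.2 := by simp [encodeEdge]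

theorem getD_encodeEdge_rabinE (i : Fin M.rabinPairs) :
    (M.encodeEdge t).getD (3 + i) 0 = M.colorBit t (.rabinE i) := by
  have := i.2
  simp only [encodeEdge, List.append_assoc]
  rw [List.getD_append_right _ _ _ _ (by simp), List.getD_append _ _ _ _ (by simp)]
  simp

theorem getD_encodeEdge_rabinF (i : Fin M.rabinPairs) :
    (M.encodeEdge t).getD (3 + (M.rabinPairs + i)) 0 = M.colorBit t (.rabinF i) := by
  have := i.2
  simp only [encodeEdge, List.append_assoc]
  rw [List.getD_append_right _ _ _ _ (by simp), List.getD_append_right _ _ _ _ (by simp),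
    List.getD_append _ _ _ _ (by simp)]
  simp

theorem getD_encodeEdge_streettR (j : Fin M.streettPairs) :
    (M.encodeEdge t).getD (3 + (M.rabinPairs + M.rabinPairs + j)) 0 =
      M.colorBit t (.streettR j) := by
  have := j.2
  simp only [encodeEdge, List.append_assoc]
  rw [List.getD_append_right _ _ _ _ (by simp), List.getD_append_right _ _ _ _ (by simp; omega),
    List.getD_append_right _ _ _ _ (by simp; omega), List.getD_append _ _ _ _ (by simp; omega)]
  simp [add_assoc]

theorem getD_encodeEdge_streettG (j : Fin M.streettPairs) :
    (M.encodeEdge t).getD (3 + (M.rabinPairs + M.rabinPairs + M.streettPairs + j)) 0 =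
      M.colorBit t (.streettG j) := by
  have := j.2
  simp only [encodeEdge, List.append_assoc]
  rw [List.getD_append_right _ _ _ _ (by simp), List.getD_append_right _ _ _ _ (by simp; omega),
    List.getD_append_right _ _ _ _ (by simp; omega),
    List.getD_append_right _ _ _ _ (by simp; omega)]
  simp [add_assoc]

end RSAutomaton

/-! ### The main theorem -/

open WhileLang EdgeGraph EmptinessProgram

/-- The list encoding an automaton, as a function. -/
theorem RSAutomaton.Encodes.getD {M : RSAutomaton} {x : List ℕ} (h : M.Encodes x) :
    ∃ l : List (Fin M.numStates × Fin M.numLetters × Fin M.numStates),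
      (∀ t, t ∈ l ↔ t ∈ M.aut.trans) ∧ M.numEdges = l.length ∧ x.getD 2 0 = l.length ∧
      x.getD 3 0 = M.rabinPairs ∧ x.getD 4 0 = M.streettPairs ∧ x.getD 5 0 = M.aut.start ∧
      x.length = 6 + l.length * (3 + (M.rabinPairs + M.rabinPairs) +
        (M.streettPairs + M.streettPairs)) ∧
      ∀ e (h : e < l.length), ∀ o < 3 + (M.rabinPairs + M.rabinPairs) +
        (M.streettPairs + M.streettPairs), x.getD (6 + (3 + (M.rabinPairs + M.rabinPairs) +
        (M.streettPairs + M.streettPairs)) * e + o) 0 = (M.encodeEdge l[e]).getD o 0 := by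
  obtain ⟨l, hnd, hmem, rfl⟩ := h
  refine ⟨l, hmem, ?_, by simp, by simp, by simp, by simp, ?_, fun e he o ho => ?_⟩
  · classical
    rw [RSAutomaton.numEdges, ← List.toFinset_card_of_nodup hnd, ← Set.ncard_coe_finset]
    congr 1
    ext t
    simp [hmem]
  · simp [List.length_flatMap, RSAutomaton.length_encodeEdge]
    omega
  · rw [List.getD_append_right _ _ _ _ (by simp; omega),
      ← RSAutomaton.getD_flatMap RSAutomaton.length_encodeEdge l e o he ho]
    congr 1
    simp
    omega

/-- The length of the input is part of the conclusion because, with at least one edge, it bounds all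
parameters. -/
theorem exists_decidesInTime : ∃ (P : RAMProgram) (c : ℕ), ∀ (M : RSAutomaton) (x : List ℕ),
    M.Encodes x → (M.numEdges = 0 → P.DecidesInTime x M.IsNonempty c) ∧
      (M.numEdges ≠ 0 → x.length = 6 + M.numEdges * (3 + (M.rabinPairs + M.rabinPairs) +
        (M.streettPairs + M.streettPairs)) ∧ P.DecidesInTime x M.IsNonempty
          (c * ((M.numEdges + 1) * (M.streettPairs + 2) ^ 2 * (M.rabinPairs + 1)))) := by
  obtain ⟨C, hC⟩ := exists_main_runs
  refine ⟨main.program, C + 3, fun M x hx => ?_⟩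
  obtain ⟨l, hmem, hm, x2, x3, x4, x5, hlen, hblk⟩ := hx.getD
  obtain ⟨h1, h2⟩ := hC (fun i => x.getD i 0) x.length
  simp only [x2, x3, x4] at h1 h2
  rw [hm]
  constructor
  · intro h0
    obtain ⟨t, s', hrun, ht, hs'⟩ := h1 h0
    have := Cmd.program_correct (b := M.IsNonempty) hrun (fun hne => ?_) fun _ => hs'
    · obtain ⟨n, hn, h⟩ := this
      exact ⟨n, by omega, h⟩
    -- A run would begin with a transition from the empty list.
    · exfalso
      rw [RSAutomaton.IsNonempty, ← Set.nonempty_iff_ne_empty] at hne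
      obtain ⟨w, r, ⟨-, hr⟩, -⟩ := hne
      rw [List.length_eq_zero_iff] at h0
      have := (hmem _).2 (hr 0)
      rw [h0] at this
      simp at this
  · intro hne
    obtain ⟨t, s', hrun, ht, s, hs, hyes, hno⟩ := h2 hne
    have e1 := hs.edges
    have e2 := hs.rabin
    have e3 := hs.streett
    have e4 := hs.start
    have hsrc := hs.src
    have htgt := hs.tgt
    have hblock := hs.block
    have hreach := hs.reach
    simp only [x2, x3, x4, x5] at e1 e2 e3 e4 hsrc htgt hblock hreach
    have hbit : ∀ o < (M.rabinPairs + M.rabinPairs) + (M.streettPairs + M.streettPairs),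
        ∀ e (h : e < l.length), Bit (fun i => x.getD i 0) s o e ↔
          (M.encodeEdge l[e]).getD (3 + o) 0 ≠ 0 := fun o ho e he => by
      rw [Bit, hblock e he, add_assoc _ 3 o, hblk e he (3 + o) (by omega)]
    have hiff : M.IsNonempty ↔ ∃ i < M.rabinPairs, PairGood (fun i => x.getD i 0) s i := by
      rw [RSAutomaton.isNonempty_iff (src := s.a 0) (tgt := s.a 1)
        (E := Bit (fun i => x.getD i 0) s)
        (F := fun i => Bit (fun i => x.getD i 0) s (M.rabinPairs + i))
        (R := fun j => Bit (fun i => x.getD i 0) s (M.rabinPairs + M.rabinPairs + j))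
        (G := fun j => Bit (fun i => x.getD i 0) s
          (M.rabinPairs + M.rabinPairs + M.streettPairs + j)) hmem]
      · refine exists_congr fun i => and_congr_right fun hi => ?_
        have hset : {e | e < l.length ∧ Reach (s.a 0) (s.a 1) {e | e < l.length} M.aut.start
            (s.a 0 e) ∧ ¬ Bit (fun i => x.getD i 0) s i e} =
            {e | e < s.v 1 ∧ s.a 12 e ≠ 0 ∧ ¬ Bit (fun i => x.getD i 0) s i e} := by
          ext e
          simp only [Set.mem_ofPred_eq, e1]
          refine and_congr_right fun he => ?_
          rw [hreach e he, e4]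
        rw [PairGood, hset, e2, e3]
      · intro e he
        rw [hsrc e he, ← RSAutomaton.getD_encodeEdge_zero, ← hblk e he 0 (by omega), add_zero]
      · intro e he
        rw [htgt e he, ← RSAutomaton.getD_encodeEdge_two, ← hblk e he 2 (by omega)]
      · intro i e he
        have := i.2
        rw [hbit _ (by omega) e he, RSAutomaton.getD_encodeEdge_rabinE,
          RSAutomaton.colorBit_ne_zero]
      · intro i e he
        have := i.2
        rw [hbit _ (by omega) e he, RSAutomaton.getD_encodeEdge_rabinF,
          RSAutomaton.colorBit_ne_zero]
      · intro j e he
        have := j.2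
        rw [hbit _ (by omega) e he, RSAutomaton.getD_encodeEdge_streettR,
          RSAutomaton.colorBit_ne_zero]
      · intro j e he
        have := j.2
        rw [hbit _ (by omega) e he, RSAutomaton.getD_encodeEdge_streettG,
          RSAutomaton.colorBit_ne_zero]
    rw [← hiff] at hyes hno
    refine ⟨hlen, ?_⟩
    obtain ⟨n, hn, h⟩ := Cmd.program_correct hrun hyes hno
    refine ⟨n, ?_, h⟩
    have : 1 ≤ (l.length + 1) * (M.streettPairs + 2) ^ 2 * (M.rabinPairs + 1) :=
      Nat.succ_le_of_lt (by positivity)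
    rw [add_mul]
    omega

theorem mainTheorem9 :
    InP RSAutomaton.Encodes RSAutomaton.IsNonempty ∧
    ∃ (P : RAMProgram) (c : ℕ), ∀ (M : RSAutomaton) (x : List ℕ), M.Encodes x →
      P.DecidesInTime x M.IsNonempty
        (c * (max 1 M.numEdges * max 1 M.rabinPairs * (max 1 M.streettPairs) ^ 2)) := by
  obtain ⟨P, c, h⟩ := exists_decidesInTime
  have mono : ∀ {x b T T'}, T ≤ T' → P.DecidesInTime x b T → P.DecidesInTime x b T' :=
    fun hT ⟨t, ht, h⟩ => ⟨t, ht.trans hT, h⟩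
  constructor
  · obtain ⟨b, hb⟩ := RAMProgram.exists_decidesInLogCost P
    -- The four factors stand for `m + 1`, `d + 1` and twice `k + 2`, each at most `bitLength x +
    -- 2`.
    let T : Polynomial ℕ := .C c * (.X + 2) ^ 4
    refine ⟨P, T * (1 + 2 * (.C b + .X + T)), fun M x hx => ?_⟩
    have key : P.DecidesInTime x M.IsNonempty (T.eval (bitLength x)) := by
      have hT : T.eval (bitLength x) = c * (bitLength x + 2) ^ 4 := by simp [T]
      rw [hT]
      obtain ⟨h1, h2⟩ := h M x hx
      by_cases h0 : M.numEdges = 0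
      · exact mono (Nat.le_mul_of_pos_right _ (by positivity)) (h1 h0)
      · obtain ⟨hlen, hdec⟩ := h2 h0
        refine mono (Nat.mul_le_mul_left _ ?_) hdec
        have hx := RAMProgram.length_le_bitLength x
        -- A single edge already takes up a whole block of the input, and this block is longer than
        -- the numbers of pairs.
        have h3 : 3 + (M.rabinPairs + M.rabinPairs) + (M.streettPairs + M.streettPairs) ≤
            M.numEdges * (3 + (M.rabinPairs + M.rabinPairs) +
              (M.streettPairs + M.streettPairs)) := Nat.le_mul_of_pos_left _ (by omega)
        have h4 : M.numEdges ≤ M.numEdges * (3 + (M.rabinPairs + M.rabinPairs) +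
              (M.streettPairs + M.streettPairs)) := Nat.le_mul_of_pos_right _ (by omega)
        calc (M.numEdges + 1) * (M.streettPairs + 2) ^ 2 * (M.rabinPairs + 1)
            ≤ (bitLength x + 2) * (bitLength x + 2) ^ 2 * (bitLength x + 2) := by
              gcongr <;> omega
          _ = _ := by ring
    obtain ⟨t, ht, hdec⟩ := hb x _ _ key
    refine ⟨t, ?_, hdec⟩
    simpa using ht
  -- `36 = 2 * 3 ^ 2 * 2`, from `m + 1 ≤ 2 * max 1 m`, `k + 2 ≤ 3 * max 1 k` and `d + 1 ≤ 2 * max 1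
  -- d`.
  · refine ⟨P, 36 * c, fun M x hx => ?_⟩
    obtain ⟨h1, h2⟩ := h M x hx
    by_cases h0 : M.numEdges = 0
    · refine mono ?_ (h1 h0)
      have : 1 ≤ max 1 M.numEdges * max 1 M.rabinPairs * (max 1 M.streettPairs) ^ 2 :=
        Nat.succ_le_of_lt (by positivity)
      nlinarith
    · refine mono ?_ (h2 h0).2
      calc c * ((M.numEdges + 1) * (M.streettPairs + 2) ^ 2 * (M.rabinPairs + 1))
          ≤ c * ((2 * max 1 M.numEdges) * (3 * max 1 M.streettPairs) ^ 2 *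
              (2 * max 1 M.rabinPairs)) := by
            gcongr <;> omega
        _ = _ := by ring
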